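/- **Theorem (twisted GKLO homomorphism).** Let $n\ge 1$ and let $\mu,\lambda$ be dominant coweights of $SL_n$, regarded as integer vectors with coordinates $\epsilon_i^\vee(\mu),\epsilon_i^\vee(\lambda)$ ($1\le i\le n$) of sum $0$. Suppose $\lambda-\mu=\sum_{i=1}^{n-1}m_i\alpha_i$, where the $\alpha_i$ are the simple coroots and $m_i\in\mathbb N$, and put $\lambda_i=\alpha_i^\vee(\lambda)$, $m_0=m_n=0$. Fix $r_{i,k}\in\mathbb C$ and set $R_i(u)=\prod_{k=1}^{\lambda_i}(u^2-r_{i,k}^2)$. *Source.* Let ${}^{tw}\widetilde Y_{\mu,\hbar}$ be the $\mu$-shifted twisted Yangian of type $\mathsf{AI}$ for $\mathfrak{gl}_n$ in the current presentation. It is the $\mathbb C[\hbar]$-algebra generated by the coefficients of $$h_i(u)=u^{-2\epsilon_i^\vee(\mu)}+\hbar\sum_{r\ge 2\epsilon_i^\vee(\mu)}h_i^{(r)}u^{-r-1},\quad \tilde h_i(u)=h_i(u)^{-1}=u^{2\epsilon_i^\vee(\mu)}+\hbar\sum_{s\ge -2\epsilon_i^\vee(\mu)}\tilde h_i^{(s)}u^{-s-1}\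 (1\le i\le n),\quad b_j(u)=\hbar\sum_{r\ge 0}b_j^{(r)}u^{-r-1}\ (1\le j<n).$$ Put $z_i(u)=\tilde h_i(u-\tfrac\hbar2)h_{i+1}(u)$. The defining relations are $z_i(u)=z_i(-u)$; $[h_i(u),h_j(v)]=0$; $$\begin{aligned}[h_i(u),b_j(v)]={}&\tfrac{\delta_{ij}\hbar}{u-v+\hbar/2}\big(b_i(u+\tfrac\hbar2)-b_i(v)\big)h_i(u)+\tfrac{\delta_{ij}\hbar}{u+v+\hbar/2}h_i(u)\big(b_i(v)-b_i(-u-\tfrac\hbar2)\big)\\&+\tfrac{\delta_{i,j+1}\hbar}{u+v}h_i(u)\big(b_j(-u)-b_j(v)\big)+\tfrac{\delta_{i,j+1}\hbar}{u-v}\big(b_j(v)-b_j(u)\big)h_i(u);\end{aligned}$$ $[b_i(u),b_j(v)]=0$ for $|i-j|>1$; $$[b_i(u),b_i(v)]=\tfrac{\hbar}{v-u}(b_i(v)-b_i(u))^2+\tfrac{\hbar}{u+v}(\underline z_i(v)-\underline z_i(u)),$$ where $\underline z_i$ is the part of $z_i$ with strictly negative powers; $$(u-v)[b_i(u),b_{i+1}(v)]=-\tfrac\hbar2\big(b_i(u)b_{i+1}(v)+b_{i+1}(v)b_i(u)\big)+\hbar[b_i^{(0)},b_{i+1}(v)]+\hbar[b_{i+1}^{(0)},b_i(u)];$$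 and, for $|i-j|=1$, $$(u_1+u_2)\operatorname{Sym}_{u_1,u_2}[b_i(u_1),[b_i(u_2),b_j(t)]]=4\hbar\sum_{u=u_1,u_2}\Big[\tfrac{u(t-\hbar)z_i(u)b_j(t)-u(t+\hbar)b_j(t)z_i(u)}{4u^2-\hbar^2}\Big]_-,$$ where the fraction is expanded at $u=\infty$ and $[\ ]_-$ keeps the terms with strictly negative powers of both $u$ and $t$. The resulting relations between generators are taken after cancelling powers of $\hbar$ (that is, the algebra is the quotient by the $\hbar$-saturation of the ideal generated by the coefficients). Let ${}^{tw}\mathbf Y_\mu$ be the $\mathbb C[\hbar]$-subalgebra generated by the elements $\hbar b_\beta^{(r)}$ and $\hbar z_i^{(2s+1)}$, for $r\ge 0$, $s\ge-\alpha_i^\vee(\mu)$, where $b^{(r)}_\beta=[b_i^{(0)},[b_{i-1}^{(0)},\dots,[b_{j+1}^{(0)},b_j^{(r)}]\dots]]$ for $\beta=\alpha_j^\vee+\dots+\alpha_i^\vee$, and $z_i(u)=u^{2\alpha_i^\vee(\mu)}+\hbar\sum_r z_i^{(r)}u^{-r-1}$. *Target.* Let $D$ be the $\mathbb C[\hbar]$-algebra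 of localized difference operators generated by $\gamma_{i,k}$, $\beta_{i,k}^{\pm1}=e^{\pm\hbar\partial_{\gamma_{i,k}}}$ ($1\le i<n$, $1\le k\le m_i$), $((\gamma_{i,k}+r\hbar)^2-(\gamma_{i,l}+s\hbar)^2)^{-1}$ ($k\ne l$) and $(\gamma_{i,k}+\tfrac r2\hbar)^{-1}$ ($r,s\in\mathbb Z$). Let $P$ be the $\mathbb C[\hbar]$-algebra generated by the $\gamma_{i,k}$ and the same inverses, on which $D$ acts. With $\xi_{i,k}=\gamma_{i,k}+\hbar$ put $$\varkappa_{i,k}=\frac{\prod_{l=1}^{m_{i+1}}(\gamma_{i,k}^2-(\gamma_{i+1,l}+\frac\hbar2)^2)\prod_{l=1}^{m_{i-1}}(\gamma_{i,k}+\gamma_{i-1,l}+\frac\hbar2)}{2(\gamma_{i,k}-\frac\hbar2)\prod_{l\ne k}(\gamma_{i,k}^2-\gamma_{i,l}^2)}\beta_{i,k}^{-1},\qquad \varkappa'_{i,k}=R_i(\xi_{i,k})\frac{\prod_{l=1}^{m_{i-1}}(\xi_{i,k}-(\gamma_{i-1,l}+\frac\hbar2))}{2(\gamma_{i,k}+\frac32\hbar)\prod_{l\ne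 k}(\xi_{i,k}^2-\xi_{i,l}^2)}\beta_{i,k}.$$ *Statement.* There is a unique $\mathbb C[\hbar]$-algebra homomorphism $\Phi^\lambda_\mu\colon{}^{tw}\widetilde Y_{\mu,\hbar}\to D[\hbar^{-1}]$ such that, expanding at $u=\infty$, $$b_i(u)\mapsto\sum_{k=1}^{m_i}\frac1{u-\gamma_{i,k}}\varkappa_{i,k}+\frac1{u+\gamma_{i,k}+\hbar}\varkappa'_{i,k},$$ $$h_i(u)\mapsto\big(u-\tfrac{i-1}2\hbar\big)^{-2\epsilon_1^\vee(\lambda)}\prod_{j=1}^{i-1}R_j\big(u-\tfrac{i-1-j}2\hbar\big)\frac{\prod_{k=1}^{m_i}(u^2-(\gamma_{i,k}+\frac\hbar2)^2)}{\prod_{l=1}^{m_{i-1}}(u-\gamma_{i-1,l})(u+\gamma_{i-1,l}+\hbar)}.$$ Its image (the truncated shifted twisted Yangian) preserves $P[\hbar^{-1}]$, so that ${}^{tw}\widetilde Y_{\mu,\hbar}$ acts on $P[\hbar^{-1}]$ (the twisted GKLO representation). Moreover $\Phi^\lambda_\mu({}^{tw}\mathbf Y_\mu)\subset D$ (the truncation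 of the integral form), so that ${}^{tw}\mathbf Y_\mu$ acts on $P$. -/

import Mathlib

open Polynomial

noncomputable section

namespace TwistedYangian

/-- The deformation parameter `ħ`, as the variable of the ground ring `ℂ[ħ]`. -/
def hb : ℂ[X] := Polynomial.X

/-- `c ħ` for a complex number `c`. -/
def chb (c : ℂ) : ℂ[X] := Polynomial.C c * Polynomial.X

/-! ### Coweights of `SL_n`, with `n = N + 1`

The Dynkin nodes `1, …, n - 1` are `j : Fin N` (the node `j + 1`) and the indices `1, …, n` are
`i : Fin (N + 1)` (the index `i + 1`). A coweight of `GL_n` is a function `Fin (N + 1) → ℤ`, the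
value at `i` being its pairing with `ε_{i+1}`; it is a coweight of `SL_n` if the values add up
to `0`. -/

/-- Pairing of a coweight with the simple root `α_{j+1} = ε_{j+1} - ε_{j+2}`. -/
def rootPairing {N : ℕ} (μ : Fin (N + 1) → ℤ) (j : Fin N) : ℤ := μ j.castSucc - μ j.succ

/-- The simple coroot dual to `α_{j+1}`. -/
def simpleCoroot {N : ℕ} (j : Fin N) : Fin (N + 1) → ℤ :=
  Pi.single j.castSucc 1 - Pi.single j.succ 1

/-- Dominant coweights of `SL_{N+1}`. -/
def IsDominantCoweight {N : ℕ} (μ : Fin (N + 1) → ℤ) : Prop :=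
  ∑ i, μ i = 0 ∧ ∀ j : Fin N, 0 ≤ rootPairing μ j

/-! ### Formal series in one variable

Throughout `A` is a (noncommutative) `ℂ[ħ]`-algebra. A series in `u⁻¹` is a power series in
`x = u⁻¹`; a series with leading power `u^k` is written as `u^k f(u)` with `f` a power series. -/

section Series

variable {A : Type*} [Ring A] [Algebra ℂ[X] A]

/-- The series `g(u)` with `(u + c)^e f(u + c) = u^e g(u)`, where `c ∈ ℂ[ħ]` and `e ∈ ℤ`: one has
`(u + c)^(e - k) = ∑_s binom(e - k, s) c^s u^(e - k - s)`. -/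
def shiftSeries (e : ℤ) (c : ℂ[X]) (f : PowerSeries A) : PowerSeries A :=
  PowerSeries.mk fun d =>
    ∑ k ∈ Finset.range (d + 1),
      (Ring.choose (e - (k : ℤ)) (d - k) : ℤ) • (c ^ (d - k) • PowerSeries.coeff k f)

/-- The series `f(-u)`. -/
def negSeries (f : PowerSeries A) : PowerSeries A :=
  PowerSeries.mk fun d => (-1 : ℤ) ^ d • PowerSeries.coeff d f

/-- The principal part of `u^k f(u)`: its part with strictly negative powers of `u`. -/
def principal (k : ℕ) (f : PowerSeries A) : PowerSeries A :=
  PowerSeries.mk fun d => if d = 0 then 0 else PowerSeries.coeff (d + k) f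

/-- The expansion `∑_p (ħ / 2)^(2p) u^(-2p)` of `4 u² / (4 u² - ħ²)`. -/
def evenGeom : PowerSeries A :=
  PowerSeries.mk fun d => if Even d then algebraMap ℂ[X] A (chb (1 / 2) ^ d) else 0

/-- A one-variable series, viewed as a series in the `s`-th of three variables. -/
def inVar (s : Fin 3) (f : PowerSeries A) : MvPowerSeries (Fin 3) A :=
  fun d => if d = Finsupp.single s (d s) then PowerSeries.coeff (d s) f else 0

/-- The commutator `[a, b] = a b - b a`. -/
def comm {R : Type*} [Ring R] (a b : R) : R := a * b - b * a

end Series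

/-! ### The defining series of the shifted twisted Yangian -/

/-- Generators of the shifted twisted Yangian: `h i k` is `h_{i+1}^{(2 ε_{i+1}(μ) + k)}`,
`ht i k` is `h̃_{i+1}^{(-2 ε_{i+1}(μ) + k)}` and `b j r` is `b_{j+1}^{(r)}`. -/
inductive Gen (N : ℕ) : Type
  | h (i : Fin (N + 1)) (k : ℕ) : Gen N
  | ht (i : Fin (N + 1)) (k : ℕ) : Gen N
  | b (j : Fin N) (r : ℕ) : Gen N

section Relations

variable {A : Type*} [Ring A] [Algebra ℂ[X] A] {N : ℕ} (μ : Fin (N + 1) → ℤ) (g : Gen N → A)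

/-- `u^{2 ε_i(μ)} h_i(u) = 1 + ħ ∑_k h_i^{(2 ε_i(μ) + k)} u^{-k-1}`. -/
def hSer (i : Fin (N + 1)) : PowerSeries A :=
  PowerSeries.mk fun d => if d = 0 then 1 else hb • g (.h i (d - 1))

/-- `u^{-2 ε_i(μ)} h̃_i(u) = 1 + ħ ∑_k h̃_i^{(-2 ε_i(μ) + k)} u^{-k-1}`. -/
def htSer (i : Fin (N + 1)) : PowerSeries A :=
  PowerSeries.mk fun d => if d = 0 then 1 else hb • g (.ht i (d - 1))

/-- `b_j(u) = ħ ∑_r b_j^{(r)} u^{-r-1}`. -/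
def bSer (j : Fin N) : PowerSeries A :=
  PowerSeries.mk fun d => if d = 0 then 0 else hb • g (.b j (d - 1))

/-- `u^{-2 α_j(μ)} z_j(u)`, where `z_j(u) = h̃_j(u - ħ/2) h_{j+1}(u)`. -/
def zSer (j : Fin N) : PowerSeries A :=
  shiftSeries (2 * μ j.castSucc) (chb (-1 / 2)) (htSer g j.castSucc) * hSer g j.succ

/-- The principal part of `z_j(u)`. -/
def zPrin (j : Fin N) : PowerSeries A :=
  principal (2 * rootPairing μ j).toNat (zSer μ g j)

/-- The principal part of `4 u z_j(u) / (4 u² - ħ²)`, expanded in powers of `u⁻¹`. -/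
def wPrin (j : Fin N) : PowerSeries A :=
  principal (2 * rootPairing μ j).toNat (PowerSeries.X * (evenGeom * zSer μ g j))

/-- `u⁻¹`, `v⁻¹`, `t⁻¹` as elements of the ring of series in three variables. -/
def xv (s : Fin 3) : MvPowerSeries (Fin 3) A := MvPowerSeries.X s

/-- `[h_i(u), h_k(v)]`, up to a power of `u` and of `v`. -/
def relHH (i k : Fin (N + 1)) : MvPowerSeries (Fin 3) A :=
  comm (inVar 0 (hSer g i)) (inVar 1 (hSer g k))

/-- The difference of the two sides of
`[h_i(u), b_j(v)] = δ_{ij} ħ (u - v + ħ/2)⁻¹ (b_i(u + ħ/2) - b_i(v)) h_i(u)`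
`+ δ_{ij} ħ (u + v + ħ/2)⁻¹ h_i(u) (b_i(v) - b_i(-u - ħ/2))`
`+ δ_{i,j+1} ħ (u + v)⁻¹ h_i(u) (b_j(-u) - b_j(v)) + δ_{i,j+1} ħ (u - v)⁻¹ (b_j(v) - b_j(u)) h_i(u)`,
times a power of `u` and the denominators that occur (in the form
`u⁻¹ v⁻¹ (u - v + ħ/2) = v⁻¹ - u⁻¹ + (ħ/2) u⁻¹ v⁻¹`, and similarly for the others). -/
def relHB (i : Fin (N + 1)) (j : Fin N) : MvPowerSeries (Fin 3) A :=
  let x : MvPowerSeries (Fin 3) A := xv 0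
  let y : MvPowerSeries (Fin 3) A := xv 1
  let h := inVar 0 (hSer g i)
  let bv := inVar 1 (bSer g j)
  if i = j.castSucc then
    let p := y - x + chb (1 / 2) • (x * y)
    let q := y + x + chb (1 / 2) • (x * y)
    let bp := inVar 0 (shiftSeries 0 (chb (1 / 2)) (bSer g j))
    let bn := inVar 0 (negSeries (shiftSeries 0 (chb (-1 / 2)) (bSer g j)))
    p * q * comm h bv
      - (hb • (x * y * q * ((bp - bv) * h)) + hb • (x * y * p * (h * (bv - bn))))
  else if i = j.succ then
    let bu := inVar 0 (bSer g j)
    let bm := inVar 0 (negSeries (bSer g j))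
    (y + x) * (y - x) * comm h bv
      - (hb • (x * y * (y - x) * (h * (bm - bv))) + hb • (x * y * (y + x) * ((bv - bu) * h)))
  else comm h bv

/-- `[b_i(u), b_j(v)]`. -/
def relBBfar (i j : Fin N) : MvPowerSeries (Fin 3) A :=
  comm (inVar 0 (bSer g i)) (inVar 1 (bSer g j))

/-- The difference of the two sides of
`[b_i(u), b_i(v)] = ħ (v - u)⁻¹ (b_i(v) - b_i(u))² + ħ (u + v)⁻¹ (z_i(v) - z_i(u))`,
where `z_i` stands for its principal part, times
`u⁻² v⁻² (v - u) (u + v) = u⁻² - v⁻²`. -/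
def relBB (i : Fin N) : MvPowerSeries (Fin 3) A :=
  let x : MvPowerSeries (Fin 3) A := xv 0
  let y : MvPowerSeries (Fin 3) A := xv 1
  let bu := inVar 0 (bSer g i)
  let bv := inVar 1 (bSer g i)
  (x - y) * (x + y) * comm bu bv
    - (hb • (x * y * (x + y) * (bv - bu) ^ 2)
      + hb • (x * y * (x - y) * (inVar 1 (zPrin μ g i) - inVar 0 (zPrin μ g i))))

/-- The difference of the two sides of
`(u - v) [b_i(u), b_j(v)] = -(ħ/2) (b_i(u) b_j(v) + b_j(v) b_i(u))`
`+ ħ [b_i^{(0)}, b_j(v)] + ħ [b_j^{(0)}, b_i(u)]` (used for `j = i + 1`), times `u⁻¹ v⁻¹`. -/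
def relBBnext (i j : Fin N) : MvPowerSeries (Fin 3) A :=
  let x : MvPowerSeries (Fin 3) A := xv 0
  let y : MvPowerSeries (Fin 3) A := xv 1
  let bu := inVar 0 (bSer g i)
  let bv := inVar 1 (bSer g j)
  (y - x) * comm bu bv
    - x * y * (-(chb (1 / 2) • (bu * bv + bv * bu))
      + hb • comm (MvPowerSeries.C (g (.b i 0))) bv
      + hb • comm (MvPowerSeries.C (g (.b j 0))) bu)

/-- The `u`-summand of the right-hand side of the Serre relation, for `u` the `s`-th variable:
the principal part, in `u` and in `t`, of
`4 ħ u ((t - ħ) z_i(u) b_j(t) - (t + ħ) b_j(t) z_i(u)) / (4 u² - ħ²)`. -/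
def serreRHS (i j : Fin N) (s : Fin 3) : MvPowerSeries (Fin 3) A :=
  let w := inVar s (wPrin μ g i)
  let b := inVar 2 (bSer g j)
  let tb := inVar 2 (principal 1 (bSer g j))
  hb • (w * (tb - hb • b) - (tb + hb • b) * w)

/-- The difference of the two sides of the Serre relation
`(u₁ + u₂) Sym_{u₁,u₂} [b_i(u₁), [b_i(u₂), b_j(t)]] = serreRHS(u₁, t) + serreRHS(u₂, t)`
(`|i - j| = 1`), times `u₁⁻¹ u₂⁻¹`. -/
def relSerre (i j : Fin N) : MvPowerSeries (Fin 3) A :=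
  let x : MvPowerSeries (Fin 3) A := xv 0
  let y : MvPowerSeries (Fin 3) A := xv 1
  let b1 := inVar 0 (bSer g i)
  let b2 := inVar 1 (bSer g i)
  let bt := inVar 2 (bSer g j)
  (y + x) * (comm b1 (comm b2 bt) + comm b2 (comm b1 bt))
    - x * y * (serreRHS μ g i j 0 + serreRHS μ g i j 1)

/-- The elements of `A` that have to vanish for `g` to satisfy the defining relations: all
coefficients of the differences of the two sides of the relations. -/
inductive IsRelator : A → Prop
  | inv_right (i : Fin (N + 1)) (d : ℕ) :
      IsRelator (PowerSeries.coeff d (hSer g i * htSer g i - 1))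
  | inv_left (i : Fin (N + 1)) (d : ℕ) :
      IsRelator (PowerSeries.coeff d (htSer g i * hSer g i - 1))
  | z_even (j : Fin N) (d : ℕ) :
      IsRelator (PowerSeries.coeff d (zSer μ g j - negSeries (zSer μ g j)))
  | hh (i k : Fin (N + 1)) (d : Fin 3 →₀ ℕ) : IsRelator (MvPowerSeries.coeff d (relHH g i k))
  | hb (i : Fin (N + 1)) (j : Fin N) (d : Fin 3 →₀ ℕ) :
      IsRelator (MvPowerSeries.coeff d (relHB g i j))
  | bb_far (i j : Fin N) (hij : (i : ℕ) + 1 < j ∨ (j : ℕ) + 1 < i) (d : Fin 3 →₀ ℕ) :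
      IsRelator (MvPowerSeries.coeff d (relBBfar g i j))
  | bb (i : Fin N) (d : Fin 3 →₀ ℕ) : IsRelator (MvPowerSeries.coeff d (relBB μ g i))
  | bb_next (i j : Fin N) (hij : (j : ℕ) = i + 1) (d : Fin 3 →₀ ℕ) :
      IsRelator (MvPowerSeries.coeff d (relBBnext g i j))
  | serre (i j : Fin N) (hij : (j : ℕ) = i + 1 ∨ (i : ℕ) = j + 1) (d : Fin 3 →₀ ℕ) :
      IsRelator (MvPowerSeries.coeff d (relSerre μ g i j))

end Relations

/-- Equality imposed in the shifted twisted Yangian. The defining relations between generating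
series carry a power of `ħ` in front of the relations between the generators (the series `b_j(u)`
and `h_i(u) - u^{-2 ε_i(μ)}` being multiples of `ħ`), which is cancelled: an element of the free
algebra vanishes if a multiple of it by a power of `ħ` lies in the two-sided ideal generated by
the coefficients of the relations. -/
def Rel {N : ℕ} (μ : Fin (N + 1) → ℤ) (a b : FreeAlgebra ℂ[X] (Gen N)) : Prop :=
  ∃ k : ℕ, hb ^ k • (a - b) ∈
    TwoSidedIdeal.span {c | IsRelator μ (FreeAlgebra.ι ℂ[X] : Gen N → _) c}

/-- The `μ`-shifted twisted Yangian of split type associated to `gl_{N+1}`, a `ℂ[ħ]`-algebra. -/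
abbrev TY {N : ℕ} (μ : Fin (N + 1) → ℤ) : Type := RingQuot (Rel μ)

/-- The generators of the shifted twisted Yangian. -/
def gen {N : ℕ} (μ : Fin (N + 1) → ℤ) (x : Gen N) : TY μ :=
  RingQuot.mkAlgHom ℂ[X] (Rel μ) (FreeAlgebra.ι ℂ[X] x)

/-- The coefficient of `u^{-e}` in `h_i(u)`, for `e ∈ ℤ`. -/
def hCoeff {N : ℕ} (μ : Fin (N + 1) → ℤ) (i : Fin (N + 1)) (e : ℤ) : TY μ :=
  if 2 * μ i ≤ e then PowerSeries.coeff (e - 2 * μ i).toNat (hSer (gen μ) i) else 0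

/-- The root vectors `b_β^{(r)} = [b_{j+d}^{(0)}, [b_{j+d-1}^{(0)}, …, [b_{j+1}^{(0)}, b_j^{(r)}]…]]`
for `β = α_j + ⋯ + α_{j+d}`. -/
def rootVector {N : ℕ} (μ : Fin (N + 1) → ℤ) (j : Fin N) (r : ℕ) : ℕ → TY μ
  | 0 => gen μ (.b j r)
  | d + 1 =>
      if hd : (j : ℕ) + (d + 1) < N then
        comm (gen μ (.b ⟨(j : ℕ) + (d + 1), hd⟩ 0)) (rootVector μ j r d)
      else 0

/-- The integral form of the `μ`-shifted twisted Yangian of `sl_{N+1}`: the `ℂ[ħ]`-subalgebra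
generated by the `ħ b_β^{(r)}`, for `β` a positive root and `r ≥ 0`, and the `ħ z_i^{(2s+1)}`, for
`s ≥ -α_i(μ)`, where `z_i(u) = u^{2 α_i(μ)} + ħ ∑_{r ≥ -2 α_i(μ)} z_i^{(r)} u^{-r-1}`. -/
def integralForm {N : ℕ} (μ : Fin (N + 1) → ℤ) : Subalgebra ℂ[X] (TY μ) :=
  Algebra.adjoin ℂ[X]
    ({y | ∃ (j : Fin N) (r d : ℕ), (j : ℕ) + d < N ∧ y = hb • rootVector μ j r d} ∪
      {y | ∃ (j : Fin N) (k : ℕ), y = PowerSeries.coeff (2 * k + 2) (zSer μ (gen μ) j)})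

/-! ### Difference operators -/

section Difference

variable {N : ℕ} (m : Fin N → ℕ)

/-- Index set of the variables `γ_{i,k}`, `1 ≤ k ≤ m_i`. -/
abbrev Idx : Type := (j : Fin N) × Fin (m j)

/-- The polynomial ring `ℂ[ħ][γ_{i,k}]`. -/
abbrev PolyRing : Type := MvPolynomial (Idx m) ℂ[X]

/-- The field of rational functions in `ħ` and the `γ_{i,k}`. -/
def Fld : Type := FractionRing (PolyRing m)

instance : Field (Fld m) := inferInstanceAs (Field (FractionRing (PolyRing m)))

instance : Algebra (PolyRing m) (Fld m) :=
  inferInstanceAs (Algebra (PolyRing m) (FractionRing (PolyRing m)))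

instance : Algebra ℂ[X] (Fld m) :=
  inferInstanceAs (Algebra ℂ[X] (FractionRing (PolyRing m)))

instance : IsScalarTower ℂ[X] (PolyRing m) (Fld m) :=
  inferInstanceAs (IsScalarTower ℂ[X] (PolyRing m) (FractionRing (PolyRing m)))

instance : IsFractionRing (PolyRing m) (Fld m) :=
  inferInstanceAs (IsFractionRing (PolyRing m) (FractionRing (PolyRing m)))

theorem algebraMap_fld_injective : Function.Injective (algebraMap ℂ[X] (Fld m)) := by
  rw [IsScalarTower.algebraMap_eq ℂ[X] (PolyRing m) (Fld m)]
  exact (IsFractionRing.injective (PolyRing m) (Fld m)).comp (MvPolynomial.C_injective _ _)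

attribute [irreducible] Fld

instance : CharZero (Fld m) := charZero_of_injective_algebraMap (algebraMap_fld_injective m)

/-- `ħ` as a rational function. -/
def hbF : Fld m := algebraMap ℂ[X] (Fld m) hb

variable {m}

/-- The variable `γ_{i,k}` as a rational function. -/
def gam (p : Idx m) : Fld m := algebraMap (PolyRing m) (Fld m) (MvPolynomial.X p)

/-- The substitution `γ_p ↦ γ_p + a_p ħ` on polynomials. -/
def shiftPolyHom (a : Idx m → ℤ) : PolyRing m →ₐ[ℂ[X]] PolyRing m :=
  MvPolynomial.aeval fun p => MvPolynomial.X p + MvPolynomial.C ((a p : ℂ[X]) * hb)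

theorem shiftPolyHom_comp (a b : Idx m → ℤ) (h : a + b = 0) :
    (shiftPolyHom a).comp (shiftPolyHom b) = AlgHom.id ℂ[X] (PolyRing m) := by
  ext1 p
  have h1 : a p + b p = 0 := congrFun h p
  have h2 : (a p : ℂ[X]) * hb + (b p : ℂ[X]) * hb = 0 := by
    rw [← add_mul, ← Int.cast_add, h1]; simp
  simp only [shiftPolyHom, AlgHom.comp_apply, MvPolynomial.aeval_X, map_add, AlgHom.id_apply,
    MvPolynomial.aeval_C, MvPolynomial.algebraMap_eq, add_assoc]
  rw [← MvPolynomial.C_add, h2, map_zero, add_zero]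

/-- The substitution `γ_p ↦ γ_p + a_p ħ` as an automorphism of the polynomial ring. -/
def shiftPoly (a : Idx m → ℤ) : PolyRing m ≃ₐ[ℂ[X]] PolyRing m :=
  AlgEquiv.ofAlgHom (shiftPolyHom a) (shiftPolyHom (-a))
    (shiftPolyHom_comp _ _ (by simp)) (shiftPolyHom_comp _ _ (by simp))

/-- The substitution `γ_p ↦ γ_p + a_p ħ` as an automorphism of the field of rational functions. -/
def shift (a : Idx m → ℤ) : Fld m ≃ₐ[ℂ[X]] Fld m :=
  IsFractionRing.algEquivOfAlgEquiv (shiftPoly a)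

theorem shift_gam (a : Idx m → ℤ) (p : Idx m) : shift a (gam p) = gam p + (a p : Fld m) * hbF m := by
  rw [shift, gam, IsFractionRing.algEquivOfAlgEquiv_algebraMap]
  have h : shiftPoly a (MvPolynomial.X p)
      = MvPolynomial.X p + MvPolynomial.C ((a p : ℂ[X]) * hb) := by
    exact MvPolynomial.aeval_X _ p
  rw [h, map_add, ← MvPolynomial.algebraMap_eq, ← IsScalarTower.algebraMap_apply, map_mul,
    map_intCast, hbF]

variable (m) in
/-- The ring of `ℂ[ħ]`-linear operators on the field of rational functions. -/
abbrev Op : Type := Module.End ℂ[X] (Fld m)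

/-- Multiplication by a rational function. -/
def mulOp (f : Fld m) : Op m := LinearMap.mulLeft ℂ[X] f

@[simp] theorem mulOp_apply (f x : Fld m) : mulOp f x = f * x := rfl

/-- The difference operator `e^{a ħ ∂/∂γ_p} : f ↦ f(…, γ_p + a ħ, …)`, that is, `β_p^a`. -/
def betaOp (p : Idx m) (a : ℤ) : Op m := (shift (Pi.single p a)).toLinearMap

@[simp] theorem betaOp_apply (p : Idx m) (a : ℤ) (x : Fld m) :
    betaOp p a x = shift (Pi.single p a) x := rfl

theorem betaOp_comm_gam (p q : Idx m) (a : ℤ) :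
    comm (betaOp p a) (mulOp (gam q))
      = if q = p then mulOp ((a : Fld m) * hbF m) * betaOp p a else 0 := by
  refine LinearMap.ext fun f => ?_
  have key : comm (betaOp p a) (mulOp (gam q)) f
      = ((Pi.single p a : Idx m → ℤ) q : Fld m) * hbF m * shift (Pi.single p a) f := by
    rw [comm, LinearMap.sub_apply, Module.End.mul_apply, Module.End.mul_apply, mulOp_apply,
      betaOp_apply, betaOp_apply, mulOp_apply, map_mul, shift_gam]
    ring
  rw [key]
  by_cases h : q = p
  · subst h
    rw [if_pos rfl, Module.End.mul_apply, mulOp_apply, betaOp_apply, Pi.single_eq_same]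
  · rw [if_neg h, Pi.single_eq_of_ne h, Int.cast_zero, zero_mul, zero_mul, LinearMap.zero_apply]

/-- The operators `f ↦ f(γ + a ħ)`, `a ∈ ℤ^Idx`, are linearly independent over the field of
rational functions. Hence the operators below satisfy no relations besides the commutation
relations of the `γ_p`, their localized inverses, and the `β_p^{±1}`. -/
theorem linearIndependent_shift :
    LinearIndependent (Fld m) (fun (a : Idx m → ℤ) (f : Fld m) => shift a f) := by
  have hinj : Function.Injective
      (fun a : Idx m → ℤ => ((shift a : Fld m ≃ₐ[ℂ[X]] Fld m) : Fld m →* Fld m)) := by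
    intro a b hab
    funext p
    have h1 : shift a (gam p) = shift b (gam p) := DFunLike.congr_fun hab (gam p)
    rw [shift_gam, shift_gam] at h1
    have hne : hbF m ≠ 0 :=
      (map_ne_zero_iff _ (algebraMap_fld_injective m)).2 Polynomial.X_ne_zero
    have h2 : (a p : Fld m) = b p := mul_right_cancel₀ hne (add_left_cancel h1)
    exact_mod_cast h2
  have h := (linearIndependent_monoidHom (Fld m) (Fld m)).comp _ hinj
  exact h

variable (m)

/-- The functions `γ_p`, `((γ_p + r ħ)² - (γ_q + s ħ)²)⁻¹` for `p = (i,k)`, `q = (i,l)`, `k ≠ l`,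
and `(γ_p + (r/2) ħ)⁻¹`, for `r, s ∈ ℤ`. -/
def polGens : Set (Fld m) :=
  {f | ∃ p, f = gam p} ∪
  {f | ∃ (p q : Idx m) (r s : ℤ), p.1 = q.1 ∧ p ≠ q ∧
      f = ((gam p + r * hbF m) ^ 2 - (gam q + s * hbF m) ^ 2)⁻¹} ∪
  {f | ∃ (p : Idx m) (r : ℤ), f = (gam p + (r / 2 : Fld m) * hbF m)⁻¹}

/-- The localized polynomial ring on which the algebra of difference operators acts. -/
def Pol : Subalgebra ℂ[X] (Fld m) := Algebra.adjoin ℂ[X] (polGens m)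

/-- The localized polynomial ring with `ħ` inverted. -/
def PolLoc : Subalgebra ℂ[X] (Fld m) := Algebra.adjoin ℂ[X] (insert (hbF m)⁻¹ (polGens m))

/-- The localized algebra of difference operators: generated over `ℂ[ħ]` by `γ_p`, `β_p^{±1}`,
`((γ_p + r ħ)² - (γ_q + s ħ)²)⁻¹` and `(γ_p + (r/2) ħ)⁻¹`. -/
def DiffAlg : Subalgebra ℂ[X] (Op m) :=
  Algebra.adjoin ℂ[X] (mulOp '' polGens m ∪ {x | ∃ p, x = betaOp p 1 ∨ x = betaOp p (-1)})

/-- The localized algebra of difference operators with `ħ` inverted. -/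
def DiffAlgLoc : Subalgebra ℂ[X] (Op m) :=
  Algebra.adjoin ℂ[X] (insert (mulOp (hbF m)⁻¹)
    (mulOp '' polGens m ∪ {x | ∃ p, x = betaOp p 1 ∨ x = betaOp p (-1)}))

/-! ### The operators and series in the theorem -/

variable {m}

/-- The variables attached to the node after `j` (none if `j` is the last node). -/
def nextIdx (j : Fin N) : Finset (Idx m) := Finset.univ.filter fun q => (q.1 : ℕ) = j + 1

/-- The variables attached to the node before `j` (none if `j` is the first node). -/
def prevIdx (j : Fin N) : Finset (Idx m) := Finset.univ.filter fun q => (q.1 : ℕ) + 1 = j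

/-- The variables attached to the node of `p`, other than `p`. -/
def otherIdx (p : Idx m) : Finset (Idx m) := Finset.univ.filter fun q => q.1 = p.1 ∧ q ≠ p

/-- The polynomial `R_i(w) = ∏_k (w² - r_{i,k}²)`, evaluated in a commutative `ℂ[ħ]`-algebra. -/
def Rpoly {ℓ : Fin N → ℕ} (r : (j : Fin N) → Fin (ℓ j) → ℂ) (j : Fin N)
    {L : Type*} [CommRing L] [Algebra ℂ[X] L] (w : L) : L :=
  ∏ k, (w ^ 2 - algebraMap ℂ[X] L (Polynomial.C (r j k)) ^ 2)

/-- The operator `ϰ_{i,k}`. -/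
def kap (p : Idx m) : Op m :=
  mulOp ((∏ q ∈ nextIdx p.1, (gam p ^ 2 - (gam q + hbF m / 2) ^ 2)) *
      (∏ q ∈ prevIdx p.1, (gam p + gam q + hbF m / 2)) /
      (2 * (gam p - hbF m / 2) * ∏ q ∈ otherIdx p, (gam p ^ 2 - gam q ^ 2))) *
    betaOp p (-1)

/-- The operator `ϰ'_{i,k}`, where `ξ_{i,k} = γ_{i,k} + ħ`. -/
def kap' {ℓ : Fin N → ℕ} (r : (j : Fin N) → Fin (ℓ j) → ℂ) (p : Idx m) : Op m :=
  mulOp (Rpoly r p.1 (gam p + hbF m) *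
      (∏ q ∈ prevIdx p.1, (gam p + hbF m - (gam q + hbF m / 2))) /
      (2 * (gam p + 3 / 2 * hbF m) *
        ∏ q ∈ otherIdx p, ((gam p + hbF m) ^ 2 - (gam q + hbF m) ^ 2))) *
    betaOp p 1

variable (m) in
/-- The field of Laurent series in `u⁻¹` with coefficients rational functions in `ħ` and the
`γ_{i,k}`. -/
abbrev Ser : Type := LaurentSeries (Fld m)

variable (m) in
/-- The element `u`: the series variable is `u⁻¹`. -/
def uSer : Ser m := HahnSeries.single (-1) 1

/-- A rational function in `ħ` and the `γ_{i,k}`, as a constant series. -/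
def cst (f : Fld m) : Ser m := HahnSeries.C f

/-- The coefficient of `u^{-d}` in the series
`∑_k (u - γ_{j,k})⁻¹ ϰ_{j,k} + (u + γ_{j,k} + ħ)⁻¹ ϰ'_{j,k}`. -/
def bImage {ℓ : Fin N → ℕ} (r : (j : Fin N) → Fin (ℓ j) → ℂ) (j : Fin N) (d : ℕ) : Op m :=
  ∑ k : Fin (m j),
    (mulOp (((uSer m - cst (gam ⟨j, k⟩))⁻¹).coeff d) * kap ⟨j, k⟩ +
      mulOp (((uSer m + cst (gam ⟨j, k⟩) + cst (hbF m))⁻¹).coeff d) * kap' r ⟨j, k⟩)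

/-- The rational function of `u`
`(u - (i-1)ħ/2)^{-2 ε_1(λ)} ∏_{j<i} R_j(u - (i-1-j)ħ/2) ∏_k (u² - (γ_{i,k} + ħ/2)²) /`
`∏_l (u - γ_{i-1,l}) (u + γ_{i-1,l} + ħ)`, for the index `i + 1` in place of `i`. -/
def hImage (lam : Fin (N + 1) → ℤ) {ℓ : Fin N → ℕ} (r : (j : Fin N) → Fin (ℓ j) → ℂ)
    (i : Fin (N + 1)) : Ser m :=
  (uSer m - cst (((i : ℕ) : Fld m) / 2 * hbF m)) ^ (-2 * lam 0) *
    (∏ j ∈ Finset.univ.filter fun j : Fin N => (j : ℕ) < i,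
      Rpoly r j (uSer m - cst ((((i : ℕ) : Fld m) - 1 - ((j : ℕ) : Fld m)) / 2 * hbF m))) *
    (∏ q ∈ Finset.univ.filter fun q : Idx m => (q.1 : ℕ) = i,
      (uSer m ^ 2 - cst ((gam q + hbF m / 2) ^ 2))) /
    ∏ q ∈ Finset.univ.filter fun q : Idx m => (q.1 : ℕ) + 1 = i,
      ((uSer m - cst (gam q)) * (uSer m + cst (gam q) + cst (hbF m)))

/-- `Φ` is given by the explicit formulas for the images of the series `b_j(u)` and `h_i(u)`. -/
structure IsTwistedGKLO (μ lam : Fin (N + 1) → ℤ) {ℓ : Fin N → ℕ}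
    (r : (j : Fin N) → Fin (ℓ j) → ℂ) (Φ : TY μ →ₐ[ℂ[X]] DiffAlgLoc m) : Prop where
  map_b : ∀ (j : Fin N) (d : ℕ),
    (Φ (PowerSeries.coeff d (bSer (gen μ) j)) : Op m) = bImage r j d
  map_h : ∀ (i : Fin (N + 1)) (e : ℤ),
    (Φ (hCoeff μ i e) : Op m) = mulOp ((hImage lam r i).coeff e)

/-- The truncated shifted twisted Yangian of `gl_{N+1}`: the image of `Φ`. -/
def truncation {μ : Fin (N + 1) → ℤ} (Φ : TY μ →ₐ[ℂ[X]] DiffAlgLoc m) :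
    Subalgebra ℂ[X] (Op m) :=
  ((DiffAlgLoc m).val.comp Φ).range

/-- The truncation of the integral form: its image under `Φ`. -/
def integralTruncation {μ : Fin (N + 1) → ℤ} (Φ : TY μ →ₐ[ℂ[X]] DiffAlgLoc m) :
    Subalgebra ℂ[X] (Op m) :=
  (integralForm μ).map ((DiffAlgLoc m).val.comp Φ)

end Difference

end TwistedYangian

end

/-! Write c = γ + ħ/2. The two halves of b_i(u) become one formula once each variable is taken with
a sign: a signed variable w = ±c has the pole a = w - ħ/2 and an operator k (`sop`) that shifts w to
w - ħ. Sign + gives ϰ, sign - gives ϰ', and b_i(u) = ∑ (u - a)⁻¹ k, while h_i(u) acts by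
multiplication by functions. After all functions are moved to the left, each defining relation is an
identity between the coefficients of monomials in the k. Only the following is needed about the k: *
operators at non-adjacent nodes commute (`sop_far`); * at adjacent nodes (w - w' + ħ/2) k k' = (w -
w' - ħ/2) k' k (`sop_adj`); * for different variables at one node (a' - a + ħ) k k' = -(a - a' + ħ)
k' k (`sop_same`); * for opposite signs k k⁻ is a function (`sop_mul_sop_sneg`), and (2a - ħ) k k⁻ =
-ħ ρ with ρ the residue of z_i at u² = a² (`kprod_eq`).

In [b_i(u), b_i(v)] minus the squared term, and in the symmetrized double commutator of the Serre
relation, the coefficient of k_p k_q carries the same factor a'_q - a_p + ħ, where a'_q is the pole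
a_q after passing through k_p. It vanishes for p = q, cancels against the swapped term by the
exchange relation for different variables, and leaves the pairs of opposite signs. These give a sum
over poles which is the partial fraction expansion of the z-term on the right-hand side
(`relBB_of_nodeData`, `relSerre_of_nodeData`).

This requires z_i(u) explicitly: telescoping the product formulas for h_i and h_{i+1} gives R_i(u) ∏
(u² - c²) / ∏ (u² - a²), with numerator over the variables of the adjacent nodes and denominator
over the signed variables of node i (`hOff_succ_eq`). It is even in u, so its principal part is
determined by residues in u². In the Serre relation the apparent poles at u = ±ħ/2 disappear,
because passing b_j through z_i changes only one factor of the numerator (`wPS_bracket`). The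
relations with h_i(u) only record how one linear factor pair of h_i moves under k.

Operators on the field of rational functions have no ħ-torsion, so passing to the saturated ideal
costs nothing (`lift_eq_of_rel`). The same fact gives uniqueness: the formulas prescribe ħ times the
images of the h and b generators, and h̃ is the inverse of h.

For the integral form, commutators in the difference algebra D are divisible by ħ
(`comm_mem_DiffAlg`), since a finite difference of a localized polynomial is. As [ħx, ħy] = ħ · ħ[x,
y], membership of the elements ħ b_β in D propagates along the iterated commutators. The
coefficients of z_i are polynomials in γ and ħ, because all linear factors are monic in u. Finally
the localized polynomial rings are stable under the generators of the difference algebras. -/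

noncomputable section

namespace TwistedYangian

/-! ### Relations between generating series, deduced from exchange relations of their residues -/

section AbstractRelations

variable {P : Type*} [CommRing P] {R : Type*} [Ring R] [Module P R] [IsScalarTower P R R]

/-- Here x = u⁻¹, y = v⁻¹, `e i` is (u - a_i)⁻¹, `e' j` is (v - a'_j)⁻¹ and `h` plays the role of
ħ/2. The sums without poles stand for ħ b^{(0)}. Since e - e' = e e' ((v - a') - (u - a)), the
spectral parameters drop out: up to the common factor x y e e', the coefficients of k k' and of k' k
are the two sides of `hk`. -/
theorem relBBnext_of_exchange {ι ι' : Type*} [Fintype ι] [Fintype ι'] (x y h : P)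
    (k : ι → R) (k' : ι' → R) (a e : ι → P) (a' e' : ι' → P)
    (he : ∀ i, (1 - a i * x) * e i = x) (he' : ∀ i, (1 - a' i * y) * e' i = y)
    (hc : ∀ i j z, k i * (e' j • z) = e' j • (k i * z))
    (hc' : ∀ i j z, k' j * (e i • z) = e i • (k' j * z))
    (hk : ∀ i j, (a i - a' j + h) • (k i * k' j) = (a i - a' j - h) • (k' j * k i)) :
    (y - x) • comm (∑ i, e i • k i) (∑ j, e' j • k' j)
      - (x * y) • (-(h • ((∑ i, e i • k i) * (∑ j, e' j • k' j) +
          (∑ j, e' j • k' j) * (∑ i, e i • k i)))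
        + comm (∑ i, k i) (∑ j, e' j • k' j) + comm (∑ j, k' j) (∑ i, e i • k i)) = 0 := by
  have e1 : (∑ i, e i • k i) * (∑ j, e' j • k' j) =
      ∑ i, ∑ j, (e i * e' j) • (k i * k' j) := by
    simp only [Finset.sum_mul_sum, smul_mul_assoc, hc, smul_smul]
  have e2 : (∑ j, e' j • k' j) * (∑ i, e i • k i) =
      ∑ i, ∑ j, (e i * e' j) • (k' j * k i) := by
    rw [Finset.sum_mul_sum, Finset.sum_comm]
    simp only [smul_mul_assoc, hc', smul_smul, mul_comm]
  have e3 : (∑ i, k i) * (∑ j, e' j • k' j) = ∑ i, ∑ j, e' j • (k i * k' j) := by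
    simp only [Finset.sum_mul_sum, hc]
  have e4 : (∑ j, e' j • k' j) * (∑ i, k i) = ∑ i, ∑ j, e' j • (k' j * k i) := by
    rw [Finset.sum_mul_sum, Finset.sum_comm]
    simp only [smul_mul_assoc]
  have e5 : (∑ j, k' j) * (∑ i, e i • k i) = ∑ i, ∑ j, e i • (k' j * k i) := by
    rw [Finset.sum_mul_sum, Finset.sum_comm]
    simp only [hc']
  have e6 : (∑ i, e i • k i) * (∑ j, k' j) = ∑ i, ∑ j, e i • (k i * k' j) := by
    simp only [Finset.sum_mul_sum, smul_mul_assoc]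
  simp only [comm]
  rw [e1, e2, e3, e4, e5, e6]
  simp only [← Finset.sum_add_distrib, ← Finset.sum_sub_distrib, ← Finset.sum_neg_distrib,
    Finset.smul_sum]
  refine Finset.sum_eq_zero fun i _ => Finset.sum_eq_zero fun j _ => ?_
  have h1 := he i
  have h2 := he' j
  have p1 : (y - x) * (e i * e' j) + x * y * h * (e i * e' j) - x * y * e' j + x * y * e i
      = x * y * (e i * e' j) * (a i - a' j + h) := by
    linear_combination -(x * e i) * h2 + y * e' j * h1
  have p2 : -(y - x) * (e i * e' j) + x * y * h * (e i * e' j) + x * y * e' j - x * y * e i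
      = - (x * y * (e i * e' j) * (a i - a' j - h)) := by
    linear_combination (x * e i) * h2 - y * e' j * h1
  calc _ = ((y - x) * (e i * e' j) + x * y * h * (e i * e' j) - x * y * e' j + x * y * e i) •
        (k i * k' j) + (-(y - x) * (e i * e' j) + x * y * h * (e i * e' j) + x * y * e' j
          - x * y * e i) • (k' j * k i) := by module
    _ = 0 := by
      rw [p1, p2, mul_smul, hk]
      module

/-- The swap (i, j) ↦ (j, i) is an involution that preserves the graph of `neg`. Off this graph the
terms cancel in pairs, and the fixed points of the swap are diagonal terms, which vanish. -/
theorem sum_sum_eq_sum_neg {ι M : Type*} [Fintype ι] [DecidableEq ι] [AddCommGroup M]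
    (neg : ι → ι) (hneg : ∀ i, neg (neg i) = i) (G : ι → ι → M)
    (hdiag : ∀ i, G i i = 0) (hswap : ∀ i j, j ≠ i → j ≠ neg i → G i j + G j i = 0) :
    ∑ i, ∑ j, G i j = ∑ i, G i (neg i) := by
  -- The terms on the graph of `neg` are subtracted first, so that the swap cancels everything that
  -- is left.
  have h0 : ∑ p : ι × ι, (G p.1 p.2 - if p.2 = neg p.1 then G p.1 p.2 else 0) = 0 := by
    refine Finset.sum_involution (fun p _ => (p.2, p.1)) ?_ ?_ (fun _ _ => Finset.mem_univ _)
      (fun _ _ => rfl)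
    · rintro ⟨i, j⟩ -
      by_cases h1 : j = neg i
      · subst h1; simp [hneg]
      · have h2 : i ≠ neg j := fun h => h1 (by rw [h, hneg])
        by_cases h3 : j = i
        · subst h3; simp [hdiag]
        · simp [h1, h2, hswap i j h3 h1]
    · rintro ⟨i, j⟩ - hp heq
      simp only [Prod.mk.injEq] at heq
      obtain ⟨h, -⟩ := heq
      subst h
      simp [hdiag] at hp
  rw [Finset.sum_sub_distrib, sub_eq_zero, Fintype.sum_prod_type, Fintype.sum_prod_type] at h0
  simpa using h0

/-- The commutation data of the operators attached to one node: `k i` are the operators, `a i` the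
positions of the poles, `a' i j` the position of the pole `j` after moving it through `k i`. -/
structure NodeData (P : Type*) [CommRing P] (R : Type*) [Ring R] [Module P R] (ι : Type*) where
  k : ι → R
  neg : ι → ι
  a : ι → P
  a' : ι → ι → P
  h : P
  q : ι → P
  res : ι → P
  neg_neg : ∀ i, neg (neg i) = i
  a'_self : ∀ i, a' i i = a i - h
  a'_neg : ∀ i, a' i (neg i) = - a i
  a'_other : ∀ i j, j ≠ i → j ≠ neg i → a' i j = a j
  k_mul_neg : ∀ i, k i * k (neg i) = q i • (1 : R)
  q_res : ∀ i, (2 * a i - h) * q i = -(2 * h * a i * res i)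
  exchange : ∀ i j, j ≠ i → j ≠ neg i →
    (a j - a i + h) • (k i * k j) + (a i - a j + h) • (k j * k i) = 0

variable {ι : Type*} [Fintype ι]

section Triple

variable {ι' : Type*} [Fintype ι'] (k : ι → R) (k' : ι' → R) (f g : ι → P) (g' : ι → ι → P)
  (t : ι' → P) (r : ι → ι' → P) (r' : ι → ι → ι' → P)

/-- This and the next two lemmas normally order the triple products of a double commutator: all
become combinations of k_i k_j k'_τ with functions on the left. The factor `r` arises from moving k'
past k, and a prime on a function records its passage through k_i. -/
theorem sum_mul_sum_mul_sum (hg : ∀ i j z, k i * (g j • z) = g' i j • (k i * z))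
    (ht : ∀ i τ z, k i * (t τ • z) = t τ • (k i * z)) :
    (∑ i, f i • k i) * ((∑ i, g i • k i) * ∑ τ, t τ • k' τ) =
      ∑ i, ∑ j, ∑ τ, (f i * g' i j * t τ) • (k i * (k j * k' τ)) := by
  simp only [Finset.sum_mul_sum]
  refine Finset.sum_congr rfl fun i _ => Finset.sum_congr rfl fun j _ => ?_
  rw [Finset.mul_sum]
  refine Finset.sum_congr rfl fun τ _ => ?_
  simp only [smul_mul_assoc, hg, ht]
  simp only [smul_smul, mul_assoc]

theorem sum_mul_sum_mul_sum_mid (hg : ∀ i j z, k i * (g j • z) = g' i j • (k i * z))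
    (ht : ∀ i τ z, k i * (t τ • z) = t τ • (k i * z))
    (hg' : ∀ i τ z, k' τ * (g i • z) = g i • (k' τ * z))
    (hkk : ∀ i τ, k' τ * k i = r i τ • (k i * k' τ))
    (hr : ∀ i j τ z, k i * (r j τ • z) = r' i j τ • (k i * z)) :
    (∑ i, f i • k i) * ((∑ τ, t τ • k' τ) * ∑ i, g i • k i) =
      ∑ i, ∑ j, ∑ τ, (f i * g' i j * t τ * r' i j τ) • (k i * (k j * k' τ)) := by
  rw [Finset.sum_mul_sum, Finset.sum_comm]
  simp only [Finset.sum_mul_sum]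
  refine Finset.sum_congr rfl fun i _ => Finset.sum_congr rfl fun j _ => ?_
  rw [Finset.mul_sum]
  refine Finset.sum_congr rfl fun τ _ => ?_
  simp only [smul_mul_assoc, hg, ht, hg', hkk, hr]
  simp only [smul_smul]
  congr 1
  ring

theorem sum_mul_sum_mul_sum_left (hg : ∀ i j z, k i * (g j • z) = g' i j • (k i * z))
    (hf' : ∀ i τ z, k' τ * (f i • z) = f i • (k' τ * z))
    (hg' : ∀ i τ z, k' τ * (g i • z) = g i • (k' τ * z))
    (hkk : ∀ i τ, k' τ * k i = r i τ • (k i * k' τ))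
    (hr : ∀ i j τ z, k i * (r j τ • z) = r' i j τ • (k i * z)) :
    (∑ τ, t τ • k' τ) * ((∑ i, f i • k i) * ∑ i, g i • k i) =
      ∑ i, ∑ j, ∑ τ, (f i * g' i j * t τ * r i τ * r' i j τ) • (k i * (k j * k' τ)) := by
  have hkk' : ∀ i τ z, k' τ * (k i * z) = r i τ • (k i * (k' τ * z)) := fun i τ z => by
    rw [← mul_assoc, hkk, smul_mul_assoc, mul_assoc]
  rw [Finset.sum_mul_sum]
  simp only [Finset.mul_sum]
  refine Finset.sum_congr rfl fun i _ => Finset.sum_congr rfl fun j _ => ?_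
  rw [Finset.sum_mul]
  refine Finset.sum_congr rfl fun τ _ => ?_
  simp only [smul_mul_assoc, hf', hg', hkk', hkk]
  simp only [hg, hr]
  simp only [smul_smul]
  congr 1
  ring

end Triple

/-- `ep`, `en`, `ev` are (u + c - a)⁻¹, (-u - c - a)⁻¹ and (v - a)⁻¹, the terms of b(u + c), b(-u -
c) and b(v). The relation is linear in the operators, so it can be checked one k_i at a time, where
it reduces to the ratio of H to its transform H' in `hH`. -/
theorem relHB_same_of_exchange (x y h c H : P) (k : ι → R) (a ep en ev H' : ι → P)
    (hp : ∀ i, (1 - (a i - c) * x) * ep i = x) (hn : ∀ i, (1 + (a i + c) * x) * en i = -x)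
    (hv : ∀ i, (1 - a i * y) * ev i = y) (hk : ∀ i z, k i * (H • z) = H' i • (k i * z))
    (hH : ∀ i, H' i * (1 - h * ep i) = H * (1 + h * en i)) :
    ((y - x + c * (x * y)) * (y + x + c * (x * y))) • comm (H • (1 : R)) (∑ i, ev i • k i)
      - (h • ((x * y * (y + x + c * (x * y))) •
          ((∑ i, ep i • k i - ∑ i, ev i • k i) * (H • (1 : R))))
        + h • ((x * y * (y - x + c * (x * y))) •
          ((H • (1 : R)) * (∑ i, ev i • k i - ∑ i, en i • k i)))) = 0 := by
  simp only [← Finset.sum_sub_distrib, comm, Finset.sum_mul, Finset.mul_sum, Finset.smul_sum,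
    ← Finset.sum_add_distrib, smul_mul_assoc, one_mul, hk, mul_one, ← sub_smul]
  refine Finset.sum_eq_zero fun i _ => ?_
  simp only [smul_smul, ← sub_smul, ← add_smul]
  -- A difference of two simple poles is their product times the difference of the denominators;
  -- this absorbs the denominators u - v + c and u + v + c of the relation.
  have s1 : x * y * (ep i - ev i) = -((y - x + c * (x * y)) * ep i * ev i) := by
    linear_combination (y * ev i) * hp i - (x * ep i) * hv i
  have s2 : x * y * (ev i - en i) = -((y + x + c * (x * y)) * ev i * en i) := by
    linear_combination (y * ev i) * hn i + (x * en i) * hv i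
  convert zero_smul P (k i) using 2
  linear_combination (-(h * (y + x + c * (x * y)) * H' i)) * s1
    - (h * (y - x + c * (x * y)) * H) * s2
    - ((y - x + c * (x * y)) * (y + x + c * (x * y)) * ev i) * hH i

theorem relHB_succ_of_exchange (x y h H : P) (k : ι → R) (a eu en ev H' : ι → P)
    (hu : ∀ i, (1 - a i * x) * eu i = x) (hn : ∀ i, (1 + a i * x) * en i = -x)
    (hv : ∀ i, (1 - a i * y) * ev i = y) (hk : ∀ i z, k i * (H • z) = H' i • (k i * z))
    (hH : ∀ i, H' i * (1 + h * eu i) = H * (1 - h * en i)) :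
    ((y + x) * (y - x)) • comm (H • (1 : R)) (∑ i, ev i • k i)
      - (h • ((x * y * (y - x)) • ((H • (1 : R)) * (∑ i, en i • k i - ∑ i, ev i • k i)))
        + h • ((x * y * (y + x)) •
          ((∑ i, ev i • k i - ∑ i, eu i • k i) * (H • (1 : R))))) = 0 := by
  simp only [← Finset.sum_sub_distrib, comm, Finset.sum_mul, Finset.mul_sum, Finset.smul_sum,
    ← Finset.sum_add_distrib, smul_mul_assoc, one_mul, hk, mul_one, ← sub_smul]
  refine Finset.sum_eq_zero fun i _ => ?_
  simp only [smul_smul, ← sub_smul, ← add_smul]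
  have s1 : x * y * (ev i - eu i) = (y - x) * eu i * ev i := by
    linear_combination (-(y * ev i)) * hu i + (x * eu i) * hv i
  have s2 : x * y * (en i - ev i) = (y + x) * ev i * en i := by
    linear_combination (-(y * ev i)) * hn i - (x * en i) * hv i
  convert zero_smul P (k i) using 2
  linear_combination (-(h * (y + x) * H' i)) * s1
    - (h * (y - x) * H) * s2
    - ((y - x) * (y + x) * ev i) * hH i

variable [DecidableEq ι]

/-- The z-free part of the relation is a double sum of k_i k_j whose coefficients contain a'_{ij} -
a_i + h. By `sum_sum_eq_sum_neg` only the pairs (i, neg i) survive. There k_i k_{neg i} is the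
function q_i, the factor is -(2a_i - h), and `q_res` turns their product into the residue of z at
a_i. -/
theorem relBB_of_nodeData (D : NodeData P R ι) (x y : P) (i1 i2 : ι → P) (i1' i2' : ι → ι → P)
    (h1 : ∀ i, (1 - D.a i * x) * i1 i = 1) (h2 : ∀ i, (1 - D.a i * y) * i2 i = 1)
    (h1' : ∀ i j, (1 - D.a' i j * x) * i1' i j = 1)
    (h2' : ∀ i j, (1 - D.a' i j * y) * i2' i j = 1)
    (hc1 : ∀ i j z, D.k i * ((x * i1 j) • z) = (x * i1' i j) • (D.k i * z))
    (hc2 : ∀ i j z, D.k i * ((y * i2 j) • z) = (y * i2' i j) • (D.k i * z)) :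
    let b1 := ∑ i, (x * i1 i) • D.k i
    let b2 := ∑ i, (y * i2 i) • D.k i
    ((x - y) * (x + y)) • comm b1 b2 - (D.h • ((x * y * (x + y)) • (b2 - b1) ^ 2)
      + D.h • ((x * y * (x - y)) •
        ((∑ i, D.res i * (y * i2 i - y * i2' i (D.neg i))) • (1 : R) -
         (∑ i, D.res i * (x * i1 i - x * i1' i (D.neg i))) • (1 : R)))) = 0 := by
  intro b1 b2
  have e12 : b1 * b2 = ∑ i, ∑ j, ((x * i1 i) * (y * i2' i j)) • (D.k i * D.k j) := by
    simp only [b1, b2, Finset.sum_mul_sum, smul_mul_assoc, hc2, smul_smul]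
  have e21 : b2 * b1 = ∑ i, ∑ j, ((y * i2 i) * (x * i1' i j)) • (D.k i * D.k j) := by
    simp only [b1, b2, Finset.sum_mul_sum, smul_mul_assoc, hc1, smul_smul]
  have e11 : b1 * b1 = ∑ i, ∑ j, ((x * i1 i) * (x * i1' i j)) • (D.k i * D.k j) := by
    simp only [b1, Finset.sum_mul_sum, smul_mul_assoc, hc1, smul_smul]
  have e22 : b2 * b2 = ∑ i, ∑ j, ((y * i2 i) * (y * i2' i j)) • (D.k i * D.k j) := by
    simp only [b2, Finset.sum_mul_sum, smul_mul_assoc, hc2, smul_smul]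
  have hd : ∀ i, y * i2 i - x * i1 i = (y - x) * (i1 i * i2 i) := fun i => by
    linear_combination (-(y * i2 i)) * h1 i + (x * i1 i) * h2 i
  have hd' : ∀ i j, y * i2' i j - x * i1' i j = (y - x) * (i1' i j * i2' i j) := fun i j => by
    linear_combination (-(y * i2' i j)) * h1' i j + (x * i1' i j) * h2' i j
  -- The coefficient of k_i k_j: the commutator contributes a'_{ij} - a_i and the squared term
  -- contributes h.
  let pf : ι → ι → P := fun i j => -((y - x) ^ 2 * (x + y) * x * y *
    (i1 i * i2 i * i1' i j * i2' i j) * (D.a' i j - D.a i + D.h))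
  have hcross : ∀ i j, i1 i * i2' i j - i2 i * i1' i j =
      (y - x) * (D.a' i j - D.a i) * (i1 i * i2 i * i1' i j * i2' i j) := fun i j => by
    have u1 := h1 i
    have u2 := h2 i
    have u3 := h1' i j
    have u4 := h2' i j
    have s1 : i1 i * i2' i j = ((1 - D.a i * y) * (1 - D.a' i j * x)) *
        (i1 i * i2 i * i1' i j * i2' i j) := by
      linear_combination (-(i1 i * i2' i j)) * u2 -
        (i1 i * i2' i j) * ((1 - D.a i * y) * i2 i) * u3
    have s2 : i2 i * i1' i j = ((1 - D.a i * x) * (1 - D.a' i j * y)) *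
        (i1 i * i2 i * i1' i j * i2' i j) := by
      linear_combination (-(i2 i * i1' i j)) * u1 -
        (i2 i * i1' i j) * ((1 - D.a i * x) * i1 i) * u4
    rw [s1, s2]; ring
  have key : ((x - y) * (x + y)) • comm b1 b2 - D.h • ((x * y * (x + y)) • (b2 - b1) ^ 2)
      = ∑ i, ∑ j, pf i j • (D.k i * D.k j) := by
    have hsq : (b2 - b1) ^ 2 = b2 * b2 - b2 * b1 - b1 * b2 + b1 * b1 := by noncomm_ring
    rw [hsq, comm, e11, e12, e21, e22]
    simp only [← Finset.sum_add_distrib, ← Finset.sum_sub_distrib, Finset.smul_sum, smul_smul,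
      ← sub_smul, ← add_smul]
    refine Finset.sum_congr rfl fun i _ => Finset.sum_congr rfl fun j _ => ?_
    congr 1
    have c1 := hd i
    have c2 := hd' i j
    have c3 := hcross i j
    calc _ = (x - y) * (x + y) * (x * y * (i1 i * i2' i j - i2 i * i1' i j)) -
          D.h * (x * y * (x + y) * ((y * i2 i - x * i1 i) * (y * i2' i j - x * i1' i j))) := by
          ring
      _ = _ := by rw [c1, c2, c3]; simp only [pf]; ring
  have hsum : ∑ i, ∑ j, pf i j • (D.k i * D.k j) = ∑ i, pf i (D.neg i) • (D.q i • (1 : R)) := by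
    rw [sum_sum_eq_sum_neg D.neg D.neg_neg]
    · simp only [D.k_mul_neg]
    · intro i
      have : pf i i = 0 := by simp only [pf, D.a'_self]; ring
      rw [this, zero_smul]
    · intro i j hij hij'
      have hji' : i ≠ D.neg j := fun h => hij' (by rw [h, D.neg_neg])
      -- The pole j does not move through k_i, and inverses are unique. This makes all of `pf`
      -- except its last factor symmetric in i and j, as `exchange` requires.
      have t1 : i1' i j = i1 j := by
        have := h1' i j; rw [D.a'_other i j hij hij'] at this
        linear_combination i1 j * this - i1' i j * h1 j
      have t2 : i2' i j = i2 j := by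
        have := h2' i j; rw [D.a'_other i j hij hij'] at this
        linear_combination i2 j * this - i2' i j * h2 j
      have t3 : i1' j i = i1 i := by
        have := h1' j i; rw [D.a'_other j i hij.symm hji'] at this
        linear_combination i1 i * this - i1' j i * h1 i
      have t4 : i2' j i = i2 i := by
        have := h2' j i; rw [D.a'_other j i hij.symm hji'] at this
        linear_combination i2 i * this - i2' j i * h2 i
      simp only [pf, D.a'_other i j hij hij', D.a'_other j i hij.symm hji', t1, t2, t3, t4]
      have hx := congrArg (fun z => (-((y - x) ^ 2 * (x + y) * x * y *
        (i1 i * i2 i * i1 j * i2 j))) • z) (D.exchange i j hij hij')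
      simp only [smul_zero] at hx
      rw [← hx]
      module
  rw [← sub_sub, key, hsum]
  simp only [← sub_smul, smul_smul, ← Finset.sum_smul]
  suffices hp : ∑ i, pf i (D.neg i) * D.q i - D.h * (x * y * (x - y) *
      (∑ i, D.res i * (y * i2 i - y * i2' i (D.neg i)) -
        ∑ i, D.res i * (x * i1 i - x * i1' i (D.neg i)))) = 0 by
    rw [hp, zero_smul]
  rw [← Finset.sum_sub_distrib, Finset.mul_sum, Finset.mul_sum, ← Finset.sum_sub_distrib]
  refine Finset.sum_eq_zero fun i _ => ?_
  have u1 := h1 i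
  have u2 := h2 i
  have u3 := h1' i (D.neg i)
  have u4 := h2' i (D.neg i)
  have hq := D.q_res i
  have ha := D.a'_neg i
  rw [ha] at u3 u4
  simp only [pf, ha]
  generalize i1' i (D.neg i) = v1 at *
  generalize i2' i (D.neg i) = v2 at *
  -- Partial fractions for poles at ±a: 1/(u - a) - 1/(u + a) = 2a/(u² - a²), compared at u and v.
  have hz : (y * i2 i - y * v2) - (x * i1 i - x * v1) =
      2 * D.a i * (y ^ 2 - x ^ 2) * (i1 i * i2 i * v1 * v2) := by
    have w1 : i1 i - v1 = 2 * D.a i * x * (i1 i * v1) := by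
      linear_combination (-i1 i) * u3 + v1 * u1
    have w2 : i2 i - v2 = 2 * D.a i * y * (i2 i * v2) := by
      linear_combination (-i2 i) * u4 + v2 * u2
    have w3 : i1 i * v1 * (1 - D.a i ^ 2 * x ^ 2) = 1 := by
      linear_combination ((1 - -D.a i * x) * v1) * u1 + u3
    have w4 : i2 i * v2 * (1 - D.a i ^ 2 * y ^ 2) = 1 := by
      linear_combination ((1 - -D.a i * y) * v2) * u2 + u4
    linear_combination y * w2 - x * w1 - 2 * D.a i * y ^ 2 * (i2 i * v2) * w3
      + 2 * D.a i * x ^ 2 * (i1 i * v1) * w4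
  have hz' : D.res i * (y * i2 i - y * v2) - D.res i * (x * i1 i - x * v1) =
      D.res i * (2 * D.a i * (y ^ 2 - x ^ 2) * (i1 i * i2 i * v1 * v2)) := by
    rw [← hz]; ring
  rw [hz']
  linear_combination ((y - x) ^ 2 * (x + y) * x * y * (i1 i * i2 i * v1 * v2)) * hq

/-- The function d is (a_i - w_τ)⁻¹, so k' passes k at the cost of r = 1 + h d. The symmetrized
double commutator gives k_i k_j k'_τ the coefficient 1 - 2r' + r r' = h d d' (a'_{ij} - a_i + h).
This is the factor that occurs in [b(u), b(v)], so the same pairs cancel and the opposite pairs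
again produce residues. -/
theorem relSerre_of_nodeData (D : NodeData P R ι) {ι' : Type*} [Fintype ι'] (x y : P)
    (i1 i2 : ι → P) (i1' i2' : ι → ι → P) (k' : ι' → R) (t w : ι' → P) (d : ι → ι' → P)
    (d' : ι → ι → ι' → P)
    (h1 : ∀ i, (1 - D.a i * x) * i1 i = 1) (h2 : ∀ i, (1 - D.a i * y) * i2 i = 1)
    (h1' : ∀ i j, (1 - D.a' i j * x) * i1' i j = 1)
    (h2' : ∀ i j, (1 - D.a' i j * y) * i2' i j = 1)
    (hd : ∀ i τ, (D.a i - w τ) * d i τ = 1) (hd' : ∀ i j τ, (D.a' i j - w τ) * d' i j τ = 1)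
    (hc1 : ∀ i j z, D.k i * ((x * i1 j) • z) = (x * i1' i j) • (D.k i * z))
    (hc2 : ∀ i j z, D.k i * ((y * i2 j) • z) = (y * i2' i j) • (D.k i * z))
    (hct : ∀ i τ z, D.k i * (t τ • z) = t τ • (D.k i * z))
    (hk1 : ∀ i τ z, k' τ * ((x * i1 i) • z) = (x * i1 i) • (k' τ * z))
    (hk2 : ∀ i τ z, k' τ * ((y * i2 i) • z) = (y * i2 i) • (k' τ * z))
    (hkk : ∀ i τ, k' τ * D.k i = (1 + D.h * d i τ) • (D.k i * k' τ))
    (hkd : ∀ i j τ z, D.k i * ((1 + D.h * d j τ) • z) = (1 + D.h * d' i j τ) • (D.k i * z)) :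
    let b1 := ∑ i, (x * i1 i) • D.k i
    let b2 := ∑ i, (y * i2 i) • D.k i
    let bt := ∑ τ, t τ • k' τ
    (y + x) • (comm b1 (comm b2 bt) + comm b2 (comm b1 bt)) -
      (x * y) • (∑ τ, (t τ * ∑ i, 2 * D.h ^ 2 * D.res i * D.a i *
          (d i τ * d' i (D.neg i) τ) * (x * i1 i + x * i1' i (D.neg i))) • k' τ +
        ∑ τ, (t τ * ∑ i, 2 * D.h ^ 2 * D.res i * D.a i *
          (d i τ * d' i (D.neg i) τ) * (y * i2 i + y * i2' i (D.neg i))) • k' τ) = 0 := by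
  intro b1 b2 bt
  have hcomm : comm b1 (comm b2 bt) + comm b2 (comm b1 bt) =
      (b1 * (b2 * bt) - (b1 * (bt * b2) + b1 * (bt * b2)) + bt * (b1 * b2)) +
      (b2 * (b1 * bt) - (b2 * (bt * b1) + b2 * (bt * b1)) + bt * (b2 * b1)) := by
    simp only [comm]; noncomm_ring
  -- The coefficient of k_i k_j k'_τ; the identity d - d' = d d' (a' - a) is what makes the last
  -- factor appear.
  let pf : ι → ι → ι' → P := fun i j τ => x * y * (i1 i * i2' i j + i2 i * i1' i j) * t τ *
    (D.h * (d i τ * d' i j τ) * (D.a' i j - D.a i + D.h))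
  have key : comm b1 (comm b2 bt) + comm b2 (comm b1 bt) =
      ∑ i, ∑ j, ∑ τ, pf i j τ • (D.k i * (D.k j * k' τ)) := by
    rw [hcomm]
    simp only [b1, b2, bt]
    rw [sum_mul_sum_mul_sum D.k k' _ _ _ t hc2 hct, sum_mul_sum_mul_sum D.k k' _ _ _ t hc1 hct,
      sum_mul_sum_mul_sum_mid D.k k' _ _ _ t _ _ hc2 hct hk2 hkk hkd,
      sum_mul_sum_mul_sum_mid D.k k' _ _ _ t _ _ hc1 hct hk1 hkk hkd,
      sum_mul_sum_mul_sum_left D.k k' _ _ _ t _ _ hc2 hk1 hk2 hkk hkd,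
      sum_mul_sum_mul_sum_left D.k k' _ _ _ t _ _ hc1 hk2 hk1 hkk hkd]
    simp only [← Finset.sum_add_distrib, ← Finset.sum_sub_distrib, ← sub_smul, ← add_smul]
    refine Finset.sum_congr rfl fun i _ => Finset.sum_congr rfl fun j _ =>
      Finset.sum_congr rfl fun τ _ => ?_
    congr 1
    simp only [pf]
    linear_combination (x * y * (i1 i * i2' i j + i2 i * i1' i j) * t τ * D.h) *
      (d' i j τ * hd i τ - d i τ * hd' i j τ)
  have hsum : ∑ i, ∑ j, ∑ τ, pf i j τ • (D.k i * (D.k j * k' τ)) =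
      ∑ i, ∑ τ, (pf i (D.neg i) τ * D.q i) • k' τ := by
    rw [sum_sum_eq_sum_neg D.neg D.neg_neg]
    · refine Finset.sum_congr rfl fun i _ => Finset.sum_congr rfl fun τ _ => ?_
      rw [← mul_assoc, D.k_mul_neg, smul_mul_assoc, one_mul, smul_smul]
    · intro i
      refine Finset.sum_eq_zero fun τ _ => ?_
      have : pf i i τ = 0 := by simp only [pf, D.a'_self]; ring
      rw [this, zero_smul]
    · intro i j hij hij'
      rw [← Finset.sum_add_distrib]
      refine Finset.sum_eq_zero fun τ _ => ?_
      have hji' : i ≠ D.neg j := fun h => hij' (by rw [h, D.neg_neg])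
      have t1 : i1' i j = i1 j := by
        have := h1' i j; rw [D.a'_other i j hij hij'] at this
        linear_combination i1 j * this - i1' i j * h1 j
      have t2 : i2' i j = i2 j := by
        have := h2' i j; rw [D.a'_other i j hij hij'] at this
        linear_combination i2 j * this - i2' i j * h2 j
      have t3 : i1' j i = i1 i := by
        have := h1' j i; rw [D.a'_other j i hij.symm hji'] at this
        linear_combination i1 i * this - i1' j i * h1 i
      have t4 : i2' j i = i2 i := by
        have := h2' j i; rw [D.a'_other j i hij.symm hji'] at this
        linear_combination i2 i * this - i2' j i * h2 i
      have t5 : d' i j τ = d j τ := by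
        have := hd' i j τ; rw [D.a'_other i j hij hij'] at this
        linear_combination d j τ * this - d' i j τ * hd j τ
      have t6 : d' j i τ = d i τ := by
        have := hd' j i τ; rw [D.a'_other j i hij.symm hji'] at this
        linear_combination d i τ * this - d' j i τ * hd i τ
      simp only [pf, D.a'_other i j hij hij', D.a'_other j i hij.symm hji', t1, t2, t3, t4, t5,
        t6, ← mul_assoc]
      have hx := congrArg (fun z => (x * y * (i1 i * i2 j + i2 i * i1 j) * t τ *
        (D.h * (d i τ * d j τ))) • (z * k' τ)) (D.exchange i j hij hij')
      simp only [smul_zero, zero_mul, add_mul, smul_mul_assoc] at hx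
      rw [← hx]
      module
  rw [key, hsum, Finset.sum_comm, ← Finset.sum_add_distrib, Finset.smul_sum, Finset.smul_sum,
    ← Finset.sum_sub_distrib]
  refine Finset.sum_eq_zero fun τ _ => ?_
  rw [← Finset.sum_smul, ← add_smul, smul_smul, smul_smul, ← sub_smul]
  suffices hp : (y + x) * ∑ i, pf i (D.neg i) τ * D.q i - x * y * (t τ * ∑ i, 2 * D.h ^ 2 *
      D.res i * D.a i * (d i τ * d' i (D.neg i) τ) * (x * i1 i + x * i1' i (D.neg i)) +
        t τ * ∑ i, 2 * D.h ^ 2 * D.res i * D.a i *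
          (d i τ * d' i (D.neg i) τ) * (y * i2 i + y * i2' i (D.neg i))) = 0 by
    rw [hp, zero_smul]
  rw [← mul_add, ← Finset.sum_add_distrib, Finset.mul_sum, Finset.mul_sum, Finset.mul_sum,
    ← Finset.sum_sub_distrib]
  refine Finset.sum_eq_zero fun i _ => ?_
  have u1 := h1 i
  have u2 := h2 i
  have u3 := h1' i (D.neg i)
  have u4 := h2' i (D.neg i)
  have hq := D.q_res i
  have ha := D.a'_neg i
  rw [ha] at u3 u4
  simp only [pf, ha]
  generalize i1' i (D.neg i) = v1 at *
  generalize i2' i (D.neg i) = v2 at *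
  generalize d' i (D.neg i) τ = dm at *
  have s1 : i1 i * v2 + i2 i * v1 =
      2 * (1 - D.a i ^ 2 * x * y) * (i1 i * v1 * (i2 i * v2)) := by
    have r1 : i1 i * v2 = (1 + D.a i * x) * (1 - D.a i * y) * (i1 i * v1 * (i2 i * v2)) := by
      linear_combination (-(i1 i * v2)) * u2 - (i1 i * v2) * ((1 - D.a i * y) * i2 i) * u3
    have r2 : i2 i * v1 = (1 - D.a i * x) * (1 + D.a i * y) * (i1 i * v1 * (i2 i * v2)) := by
      linear_combination (-(i2 i * v1)) * u1 - (i2 i * v1) * ((1 - D.a i * x) * i1 i) * u4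
    rw [r1, r2]; ring
  have s2 : (x * i1 i + x * v1) + (y * i2 i + y * v2) =
      2 * (x + y) * (1 - D.a i ^ 2 * x * y) * (i1 i * v1 * (i2 i * v2)) := by
    have w1 : i1 i + v1 = 2 * (i1 i * v1) := by
      linear_combination (-i1 i) * u3 - v1 * u1
    have w2 : i2 i + v2 = 2 * (i2 i * v2) := by
      linear_combination (-i2 i) * u4 - v2 * u2
    have w3 : i1 i * v1 * (1 - D.a i ^ 2 * x ^ 2) = 1 := by
      linear_combination ((1 - -D.a i * x) * v1) * u1 + u3
    have w4 : i2 i * v2 * (1 - D.a i ^ 2 * y ^ 2) = 1 := by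
      linear_combination ((1 - -D.a i * y) * v2) * u2 + u4
    linear_combination y * w2 + x * w1 - 2 * x * (i1 i * v1) * w4 - 2 * y * (i2 i * v2) * w3
  have s3 : 2 * D.h ^ 2 * D.res i * D.a i * (d i τ * dm) * (x * i1 i + x * v1) +
      2 * D.h ^ 2 * D.res i * D.a i * (d i τ * dm) * (y * i2 i + y * v2) =
      2 * D.h ^ 2 * D.res i * D.a i * (d i τ * dm) *
      (2 * (x + y) * (1 - D.a i ^ 2 * x * y) * (i1 i * v1 * (i2 i * v2))) := by
    rw [← s2]; ring
  rw [s3, s1]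
  linear_combination (-(x * y * (x + y) * t τ * D.h * (d i τ * dm)) *
    (2 * (1 - D.a i ^ 2 * x * y) * (i1 i * v1 * (i2 i * v2)))) * hq

end AbstractRelations

/-! ### Power series with one pole -/

section Pole

variable {F : Type*} [CommRing F]

/-- The expansion `∑ a^d u^{-d}` of `(1 - a u⁻¹)⁻¹`. -/
def geoSer (a : F) : PowerSeries F := PowerSeries.mk fun d => a ^ d

/-- The expansion of `(u - a)⁻¹`. -/
def poleSer (a : F) : PowerSeries F := PowerSeries.X * geoSer a

theorem one_sub_mul_geoSer (a : F) : (1 - PowerSeries.C a * PowerSeries.X) * geoSer a = 1 := by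
  ext d
  rw [sub_mul, one_mul, mul_assoc, map_sub, PowerSeries.coeff_C_mul, geoSer]
  cases d with
  | zero => simp
  | succ d => rw [PowerSeries.coeff_succ_X_mul]; simp [PowerSeries.coeff_one, pow_succ']

theorem coeff_poleSer (a : F) (d : ℕ) :
    PowerSeries.coeff d (poleSer a) = if d = 0 then 0 else a ^ (d - 1) := by
  cases d with
  | zero => simp [poleSer]
  | succ d => rw [poleSer, PowerSeries.coeff_succ_X_mul, geoSer]; simp

theorem map_geoSer {G : Type*} [CommRing G] (f : F →+* G) (a : F) :
    PowerSeries.map f (geoSer a) = geoSer (f a) := by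
  ext d; simp [geoSer]

theorem map_poleSer {G : Type*} [CommRing G] (f : F →+* G) (a : F) :
    PowerSeries.map f (poleSer a) = poleSer (f a) := by
  simp [poleSer, map_geoSer]

/-- Identifying `inVar` with renaming of variables supplies its multiplicativity over a commutative
ring, from which `inVarHom` is built. -/
theorem inVar_eq_rename (s : Fin 3) (f : PowerSeries F) :
    inVar s f = MvPowerSeries.rename (fun _ : Unit => s) f := by
  classical
  ext d
  by_cases h : d = Finsupp.single s (d s)
  · have h1 : d = Finsupp.embDomain (⟨fun _ : Unit => s, fun _ _ _ => rfl⟩ : Unit ↪ Fin 3)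
        (Finsupp.single () (d s)) := by
      rw [Finsupp.embDomain_single]; exact h
    have h2 := MvPowerSeries.coeff_embDomain_rename
      (⟨fun _ : Unit => s, fun _ _ _ => rfl⟩ : Unit ↪ Fin 3) f (Finsupp.single () (d s))
    rw [← h1] at h2
    refine Eq.trans ?_ h2.symm
    change (if d = Finsupp.single s (d s) then PowerSeries.coeff (d s) f else 0) = _
    rw [if_pos h]
    rfl
  · rw [MvPowerSeries.coeff_rename_eq_zero]
    · exact if_neg h
    · rintro ⟨y, rfl⟩
      apply h
      have hy : y = Finsupp.single () (y ()) := by ext; simp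
      rw [hy, Finsupp.mapDomain_single]
      simp

/-- Viewing a one-variable series as a series in the `s`-th of three variables, as a ring
homomorphism. -/
def inVarHom (s : Fin 3) : PowerSeries F →+* MvPowerSeries (Fin 3) F where
  toFun := inVar s
  map_one' := by rw [inVar_eq_rename, map_one]
  map_mul' f g := by simp only [inVar_eq_rename, map_mul]
  map_zero' := by rw [inVar_eq_rename, map_zero]
  map_add' f g := by simp only [inVar_eq_rename, map_add]

@[simp] theorem inVarHom_apply (s : Fin 3) (f : PowerSeries F) : inVarHom s f = inVar s f := rfl

theorem inVarHom_X (s : Fin 3) :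
    inVarHom s (PowerSeries.X : PowerSeries F) = MvPowerSeries.X s := by
  rw [inVarHom_apply, inVar_eq_rename]; exact MvPowerSeries.rename_X _ _

theorem inVarHom_C (s : Fin 3) (a : F) :
    inVarHom s (PowerSeries.C a) = MvPowerSeries.C a := by
  rw [inVarHom_apply, inVar_eq_rename]; exact MvPowerSeries.rename_C _ _

theorem inVar_map {A B : Type*} [Ring A] [Ring B] (f : A →+* B) (s : Fin 3) (g : PowerSeries A) :
    inVar s (PowerSeries.map f g) = MvPowerSeries.map f (inVar s g) := by
  ext d
  change (if d = Finsupp.single s (d s) then PowerSeries.coeff (d s) (PowerSeries.map f g) else 0)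
    = f (if d = Finsupp.single s (d s) then PowerSeries.coeff (d s) g else 0)
  split_ifs <;> simp

theorem one_sub_mul_inVar_geoSer (s : Fin 3) (a : F) :
    (1 - MvPowerSeries.C a * MvPowerSeries.X s) * inVar s (geoSer a) = 1 := by
  have h := congrArg (inVarHom s) (one_sub_mul_geoSer a)
  simpa [inVarHom_X, inVarHom_C, -inVarHom_apply, ← inVarHom_apply] using h

theorem inVar_poleSer (s : Fin 3) (a : F) :
    inVar s (poleSer a) = MvPowerSeries.X s * inVar s (geoSer a) := by
  rw [← inVarHom_apply, poleSer, map_mul, inVarHom_X, inVarHom_apply]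

end Pole

/-! ### Multiplicativity of the shift -/

section Shift

variable {F : Type*} [CommRing F] [Algebra ℂ[X] F] (c : ℂ[X])

theorem coeff_shiftSeries (e : ℤ) (f : PowerSeries F) (d : ℕ) :
    PowerSeries.coeff d (shiftSeries e c f) = ∑ k ∈ Finset.range (d + 1),
      (Ring.choose (e - (k : ℤ)) (d - k) : ℤ) • (c ^ (d - k) • PowerSeries.coeff k f) := by
  simp [shiftSeries]

theorem shiftSeries_add (e : ℤ) (f g : PowerSeries F) :
    shiftSeries e c (f + g) = shiftSeries e c f + shiftSeries e c g := by
  ext d; simp only [map_add, coeff_shiftSeries, smul_add, Finset.sum_add_distrib]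

/-- The expansion of `(u + c)^e u^{-e}`. -/
def binSer (e : ℤ) : PowerSeries F :=
  PowerSeries.rescale (algebraMap ℂ[X] F c) (PowerSeries.binomialSeries F e)

theorem binSer_add (e e' : ℤ) :
    (binSer c (e + e') : PowerSeries F) = binSer c e * binSer c e' := by
  rw [binSer, PowerSeries.binomialSeries_add, map_mul, binSer, binSer]

theorem coeff_binSer (e : ℤ) (d : ℕ) : PowerSeries.coeff d (binSer c e : PowerSeries F) =
    algebraMap ℂ[X] F c ^ d * (Ring.choose e d : ℤ) := by
  rw [binSer, PowerSeries.coeff_rescale, PowerSeries.binomialSeries_coeff]; simp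

theorem shiftSeries_monomial (e : ℤ) (k : ℕ) (a : F) :
    shiftSeries e c (PowerSeries.C a * PowerSeries.X ^ k) =
      PowerSeries.C a * (PowerSeries.X ^ k * binSer c (e - k)) := by
  ext d
  rw [coeff_shiftSeries, PowerSeries.coeff_C_mul, PowerSeries.coeff_X_pow_mul']
  simp only [PowerSeries.coeff_C_mul, PowerSeries.coeff_X_pow]
  by_cases h : k ≤ d
  · rw [if_pos h, Finset.sum_eq_single k]
    · simp only [if_true, mul_one, coeff_binSer, Algebra.smul_def, map_pow, eq_intCast]; ring
    · intro b _ hb; simp [hb]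
    · intro hk; exact absurd (Finset.mem_range.2 (by omega)) hk
  · rw [if_neg h, mul_zero]
    refine Finset.sum_eq_zero fun b hb => ?_
    have : b ≠ k := by have := Finset.mem_range.1 hb; omega
    simp [this]

/-- By bilinearity this is a statement about monomials, where it reads (u + c)^(e - n) (u + c)^(e' -
k) = (u + c)^(e + e' - n - k), i.e. the Vandermonde identity contained in `binSer_add`. -/
theorem shiftSeries_coe_mul_coe (e e' : ℤ) (p q : F[X]) :
    shiftSeries (e + e') c ((p : PowerSeries F) * (q : PowerSeries F)) = shiftSeries e c (p : PowerSeries F) * shiftSeries e' c (q : PowerSeries F) := by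
  induction p using Polynomial.induction_on' with
  | add p₁ p₂ h₁ h₂ => simp only [Polynomial.coe_add, add_mul, shiftSeries_add, h₁, h₂]
  | monomial n a =>
    induction q using Polynomial.induction_on' with
    | add p₁ p₂ h₁ h₂ => simp only [Polynomial.coe_add, mul_add, shiftSeries_add, h₁, h₂]
    | monomial k b =>
      simp only [← Polynomial.C_mul_X_pow_eq_monomial, Polynomial.coe_mul, Polynomial.coe_C,
        Polynomial.coe_pow, Polynomial.coe_X]
      have h1 : (PowerSeries.C a * PowerSeries.X ^ n * (PowerSeries.C b * PowerSeries.X ^ k)) =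
          PowerSeries.C (a * b) * PowerSeries.X ^ (n + k) := by rw [map_mul, pow_add]; ring
      have h2 : e + e' - ((n + k : ℕ) : ℤ) = (e - n) + (e' - k) := by push_cast; ring
      rw [h1, shiftSeries_monomial, shiftSeries_monomial, shiftSeries_monomial, h2, binSer_add,
        map_mul, pow_add]
      ring

theorem coeff_shiftSeries_trunc (e : ℤ) (f : PowerSeries F) {d n : ℕ} (h : d < n) :
    PowerSeries.coeff d (shiftSeries e c (PowerSeries.trunc n f : PowerSeries F)) =
      PowerSeries.coeff d (shiftSeries e c f) := by
  rw [coeff_shiftSeries, coeff_shiftSeries]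
  refine Finset.sum_congr rfl fun k hk => ?_
  have := Finset.mem_range.1 hk
  rw [PowerSeries.coeff_coe_trunc_of_lt (by omega)]

/-- The coefficient of degree d depends only on the coefficients of degree at most d of the factors,
so these may be truncated to polynomials. -/
theorem shiftSeries_mul (e e' : ℤ) (f g : PowerSeries F) :
    shiftSeries (e + e') c (f * g) = shiftSeries e c f * shiftSeries e' c g := by
  ext d
  have h0 : PowerSeries.coeff d (shiftSeries (e + e') c (f * g)) =
      PowerSeries.coeff d (shiftSeries (e + e') c
        ((PowerSeries.trunc (d + 1) f : PowerSeries F) * (PowerSeries.trunc (d + 1) g : PowerSeries F))) := by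
    rw [coeff_shiftSeries, coeff_shiftSeries]
    refine Finset.sum_congr rfl fun k hk => ?_
    rw [PowerSeries.coeff_mul_eq_coeff_trunc_mul_trunc f g (Finset.mem_range.1 hk)]
  rw [h0, shiftSeries_coe_mul_coe, PowerSeries.coeff_mul, PowerSeries.coeff_mul]
  refine Finset.sum_congr rfl fun p hp => ?_
  have := Finset.HasAntidiagonal.mem_antidiagonal.1 hp
  rw [coeff_shiftSeries_trunc _ _ _ (by omega), coeff_shiftSeries_trunc _ _ _ (by omega)]

theorem binSer_zero : (binSer c 0 : PowerSeries F) = 1 := by simp [binSer]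

theorem shiftSeries_one_eq (e : ℤ) : shiftSeries e c (1 : PowerSeries F) = binSer c e := by
  simpa using shiftSeries_monomial c e 0 (1 : F)

theorem shiftSeries_zero_one : shiftSeries 0 c (1 : PowerSeries F) = 1 := by
  rw [shiftSeries_one_eq, binSer_zero]

theorem binSer_one : (binSer c 1 : PowerSeries F) =
    1 + PowerSeries.C (algebraMap ℂ[X] F c) * PowerSeries.X := by
  ext d
  rw [coeff_binSer, map_add, PowerSeries.coeff_C_mul]
  rcases d with _ | _ | d
  · simp
  · simp [PowerSeries.coeff_one]
  · have : (Ring.choose (1 : ℤ) (d + 1 + 1)) = 0 := by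
      have := Ring.choose_natCast (R := ℤ) 1 (d + 1 + 1)
      rw [Nat.choose_eq_zero_of_lt (by omega)] at this
      simpa using this
    rw [this]; simp [PowerSeries.coeff_one, PowerSeries.coeff_X]

/-- The variable is u⁻¹, so a factor X^n lowers the exponent of the prefactor u^e by n. -/
theorem shiftSeries_X_pow_mul (e : ℤ) (n : ℕ) (f : PowerSeries F) :
    shiftSeries e c (PowerSeries.X ^ n * f) = PowerSeries.X ^ n * shiftSeries (e - n) c f := by
  have h : shiftSeries n c (PowerSeries.X ^ n : PowerSeries F) = PowerSeries.X ^ n := by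
    simpa [binSer_zero] using shiftSeries_monomial c n n (1 : F)
  conv_lhs => rw [show e = n + (e - n) by ring, shiftSeries_mul, h]

theorem shiftSeries_lin (a : F) :
    shiftSeries 1 c (1 - PowerSeries.C a * PowerSeries.X : PowerSeries F) =
      1 - PowerSeries.C (a - algebraMap ℂ[X] F c) * PowerSeries.X := by
  have h1 : (1 - PowerSeries.C a * PowerSeries.X : PowerSeries F) =
      1 + PowerSeries.C (-a) * PowerSeries.X ^ 1 := by rw [map_neg]; ring
  rw [h1, shiftSeries_add, shiftSeries_one_eq, shiftSeries_monomial, binSer_one]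
  simp only [Nat.cast_one, sub_self, binSer_zero, map_neg, map_sub]
  ring

/-- The factor 1 - a/u is shifted with exponent 1 and its inverse with exponent -1; the shifts are
again inverse to each other, and the first is linear. -/
theorem shiftSeries_poleSer (a : F) :
    shiftSeries 0 c (poleSer a) = poleSer (a - algebraMap ℂ[X] F c) := by
  have h1 : shiftSeries (1 + -1) c ((1 - PowerSeries.C a * PowerSeries.X) * geoSer a) = 1 := by
    rw [one_sub_mul_geoSer]; exact shiftSeries_zero_one c
  rw [shiftSeries_mul, shiftSeries_lin] at h1
  have h2 := one_sub_mul_geoSer (a - algebraMap ℂ[X] F c)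
  have h3 : shiftSeries (-1) c (geoSer a) = geoSer (a - algebraMap ℂ[X] F c) := by
    linear_combination (geoSer (a - algebraMap ℂ[X] F c)) * h1 - shiftSeries (-1) c (geoSer a) * h2
  have h4 := shiftSeries_X_pow_mul c 0 1 (geoSer a)
  simpa [poleSer, h3] using h4

end Shift

theorem coeff_negSeries {A : Type*} [Ring A] (f : PowerSeries A) (d : ℕ) :
    PowerSeries.coeff d (negSeries f) = (-1) ^ d * PowerSeries.coeff d f := by
  simp [negSeries]

theorem negSeries_eq_rescale {F : Type*} [CommRing F] (f : PowerSeries F) :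
    negSeries f = PowerSeries.rescale (-1) f := by
  ext d; rw [coeff_negSeries, PowerSeries.coeff_rescale]

theorem negSeries_poleSer {F : Type*} [CommRing F] (a : F) :
    negSeries (poleSer a) = -poleSer (-a) := by
  ext d
  rw [coeff_negSeries, map_neg, coeff_poleSer, coeff_poleSer]
  cases d with
  | zero => simp
  | succ d => simp only [Nat.succ_ne_zero, if_false, Nat.add_sub_cancel]; rw [neg_pow a]; ring

/-! ### The operators `ϰ`, indexed by signed variables -/

section Signed

variable {N : ℕ} {m : Fin N → ℕ}

theorem hbF_ne_zero : hbF m ≠ 0 :=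
  (map_ne_zero_iff _ (algebraMap_fld_injective m)).2 Polynomial.X_ne_zero

theorem shift_hbF (a : Idx m → ℤ) : shift a (hbF m) = hbF m := (shift a).commutes hb

theorem fld_ringHom_ext {S : Type*} [CommRing S] {f g : Fld m →+* S}
    (hc : ∀ c : ℂ[X], f (algebraMap ℂ[X] (Fld m) c) = g (algebraMap ℂ[X] (Fld m) c))
    (hg : ∀ p, f (gam p) = g (gam p)) : f = g := by
  refine IsLocalization.ringHom_ext (nonZeroDivisors (PolyRing m)) ?_
  refine MvPolynomial.ringHom_ext (fun c => ?_) (fun p => hg p)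
  have := hc c
  rwa [IsScalarTower.algebraMap_apply ℂ[X] (PolyRing m) (Fld m)] at this

theorem shift_shift (a b : Idx m → ℤ) (f : Fld m) : shift a (shift b f) = shift (a + b) f := by
  have h : ((shift a : Fld m ≃ₐ[ℂ[X]] Fld m) : Fld m →+* Fld m).comp
      ((shift b : Fld m ≃ₐ[ℂ[X]] Fld m) : Fld m →+* Fld m) =
      ((shift (a + b) : Fld m ≃ₐ[ℂ[X]] Fld m) : Fld m →+* Fld m) := by
    refine fld_ringHom_ext (fun c => ?_) (fun p => ?_)
    · exact ((congrArg _ ((shift b).commutes c)).trans ((shift a).commutes c)).trans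
        ((shift (a + b)).commutes c).symm
    · change shift a (shift b (gam p)) = shift (a + b) (gam p)
      rw [shift_gam, shift_gam, map_add, shift_gam, map_mul, shift_hbF, map_intCast,
        Pi.add_apply]
      push_cast; ring
  exact RingHom.congr_fun h f

theorem shift_zero (f : Fld m) : shift (0 : Idx m → ℤ) f = f := by
  have h := shift_shift (0 : Idx m → ℤ) 0 f
  rw [add_zero] at h
  exact (shift (0 : Idx m → ℤ)).injective h

/-- A variable together with a sign. -/
abbrev SIdx (m : Fin N → ℕ) : Type := Idx m × Bool

/-- The opposite signed variable. -/
def sneg (s : SIdx m) : SIdx m := (s.1, !s.2)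

@[simp] theorem sneg_fst (s : SIdx m) : (sneg s).1 = s.1 := rfl

theorem fst_ne_of_ne {s t : SIdx m} (h : t ≠ s) (h' : t ≠ sneg s) : t.1 ≠ s.1 := by
  rcases s with ⟨p, b⟩
  rcases t with ⟨q, c⟩
  rintro rfl
  cases b <;> cases c <;> simp_all [sneg]

/-- The variable `γ_p + ħ/2`. -/
def cen (p : Idx m) : Fld m := gam p + hbF m / 2

/-- The signed variable `±(γ_p + ħ/2)`. -/
def sv (s : SIdx m) : Fld m := if s.2 then cen s.1 else -cen s.1

/-- The pole `±(γ_p + ħ/2) - ħ/2`. -/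
def pol (s : SIdx m) : Fld m := sv s - hbF m / 2

/-- The exponent of the shift `sv s ↦ sv s - ħ`. -/
def sexp (s : SIdx m) : Idx m → ℤ := Pi.single s.1 (if s.2 then -1 else 1)

/-- The automorphism with `sv s ↦ sv s - ħ`. -/
def strans (s : SIdx m) : Fld m ≃ₐ[ℂ[X]] Fld m := shift (sexp s)

theorem strans_hbF (s : SIdx m) : strans s (hbF m) = hbF m := shift_hbF _

theorem strans_cen_of_ne {s : SIdx m} {q : Idx m} (h : q ≠ s.1) : strans s (cen q) = cen q := by
  have h2 : shift (sexp s) (hbF m / 2) = hbF m / 2 := by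
    rw [map_div₀, shift_hbF, map_ofNat]
  rw [strans, cen, map_add, shift_gam, h2, sexp, Pi.single_eq_of_ne h]; simp

theorem strans_cen_self (s : SIdx m) :
    strans s (cen s.1) = if s.2 then cen s.1 - hbF m else cen s.1 + hbF m := by
  have h2 : shift (sexp s) (hbF m / 2) = hbF m / 2 := by
    rw [map_div₀, shift_hbF, map_ofNat]
  rw [strans, cen, map_add, shift_gam, h2, sexp, Pi.single_eq_same]
  split_ifs <;> push_cast <;> ring

theorem strans_sv_self (s : SIdx m) : strans s (sv s) = sv s - hbF m := by
  rw [sv]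
  split_ifs with h
  · rw [strans_cen_self, if_pos h]
  · rw [map_neg, strans_cen_self, if_neg h]; ring

theorem sv_sneg (s : SIdx m) : sv (sneg s) = -sv s := by
  rcases s with ⟨p, b⟩
  cases b <;> simp [sv, sneg]

theorem strans_sv_of_ne {s t : SIdx m} (h : t.1 ≠ s.1) : strans s (sv t) = sv t := by
  rw [sv]
  split_ifs
  · rw [strans_cen_of_ne h]
  · rw [map_neg, strans_cen_of_ne h]

theorem pol_sneg (s : SIdx m) : pol (sneg s) = -pol s - hbF m := by
  rw [pol, pol, sv_sneg]; ring

theorem strans_half (s : SIdx m) : strans s (hbF m / 2) = hbF m / 2 := by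
  rw [map_div₀, strans_hbF, map_ofNat]

theorem strans_pol_self (s : SIdx m) : strans s (pol s) = pol s - hbF m := by
  rw [pol, map_sub, strans_sv_self, strans_half]; ring

theorem strans_sv_sneg (s : SIdx m) : strans s (sv (sneg s)) = -sv s + hbF m := by
  rw [sv_sneg, map_neg, strans_sv_self]; ring

theorem strans_pol_sneg (s : SIdx m) : strans s (pol (sneg s)) = -pol s := by
  rw [pol_sneg, map_sub, map_neg, strans_pol_self, strans_hbF]; ring

theorem strans_pol_of_ne {s t : SIdx m} (h : t.1 ≠ s.1) : strans s (pol t) = pol t := by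
  rw [pol, map_sub, strans_sv_of_ne h, strans_half]

theorem strans_comm (s t : SIdx m) (f : Fld m) :
    strans s (strans t f) = strans t (strans s f) := by
  rw [strans, strans, shift_shift, shift_shift, add_comm]

theorem strans_sneg (s : SIdx m) (f : Fld m) : strans s (strans (sneg s) f) = f := by
  rw [strans, strans, shift_shift]
  have : sexp s + sexp (sneg s) = 0 := by
    rcases s with ⟨p, b⟩
    cases b <;> simp [sexp, sneg, ← Pi.single_add]
  rw [this, shift_zero]

/-- A test for non-vanishing: an element which some shift automorphism moves by a nonzero amount
cannot be 0. It shows that all denominators below are nonzero. -/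
theorem ne_zero_of_strans (s : SIdx m) {f c : Fld m} (h : strans s f = f + c) (hc : c ≠ 0) :
    f ≠ 0 := by
  rintro rfl
  rw [map_zero, zero_add] at h
  exact hc h.symm

theorem strans_natCast_mul_hbF (s : SIdx m) (c : ℚ) :
    strans s ((c : Fld m) * hbF m) = c * hbF m := by
  rw [map_mul, strans_hbF, map_ratCast]

/-- A signed variable is not a rational multiple of `ħ`. -/
theorem sv_add_ne_zero (s : SIdx m) (c : ℚ) : sv s + c * hbF m ≠ 0 := by
  refine ne_zero_of_strans s (c := -hbF m) ?_ (neg_ne_zero.2 hbF_ne_zero)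
  rw [map_add, strans_sv_self, strans_natCast_mul_hbF]; ring

/-- Sums of different signed variables are not rational multiples of `ħ`. -/
theorem sv_add_sv_add_ne_zero {s t : SIdx m} (h : t.1 ≠ s.1) (c : ℚ) :
    sv s + sv t + c * hbF m ≠ 0 := by
  refine ne_zero_of_strans s (c := -hbF m) ?_ (neg_ne_zero.2 hbF_ne_zero)
  rw [map_add, map_add, strans_sv_self, strans_sv_of_ne h, strans_natCast_mul_hbF]; ring

theorem sv_sub_sv_add_ne_zero {s t : SIdx m} (h : t.1 ≠ s.1) (c : ℚ) :
    sv s - sv t + c * hbF m ≠ 0 := by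
  have := sv_add_sv_add_ne_zero (s := s) (t := sneg t) h c
  rwa [sv_sneg, ← sub_eq_add_neg] at this

theorem sv_ne_zero (s : SIdx m) : sv s ≠ 0 := by simpa using sv_add_ne_zero s 0

theorem sv_sub_hbF_ne_zero (s : SIdx m) : sv s - hbF m ≠ 0 := by
  have := sv_add_ne_zero s (-1); push_cast at this; convert this using 1; ring

theorem pol_ne_zero (s : SIdx m) : pol s ≠ 0 := by
  have := sv_add_ne_zero s (-1 / 2); push_cast at this; rw [pol]; convert this using 1; ring

theorem sv_mk_true (q : Idx m) : sv (q, true) = cen q := by simp [sv]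

theorem sv_sub_cen_add_ne_zero {s : SIdx m} {q : Idx m} (h : q ≠ s.1) (c : ℚ) :
    sv s - cen q + c * hbF m ≠ 0 := by
  have := sv_sub_sv_add_ne_zero (s := s) (t := (q, true)) h c
  rwa [sv_mk_true] at this

theorem sv_add_cen_add_ne_zero {s : SIdx m} {q : Idx m} (h : q ≠ s.1) (c : ℚ) :
    sv s + cen q + c * hbF m ≠ 0 := by
  have := sv_add_sv_add_ne_zero (s := s) (t := (q, true)) h c
  rwa [sv_mk_true] at this

theorem pol_sub_sv_ne_zero {s t : SIdx m} (h : t.1 ≠ s.1) : pol s - sv t ≠ 0 := by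
  have := sv_sub_sv_add_ne_zero h (-1 / 2); push_cast at this; rw [pol]; convert this using 1; ring

/-- The squares of the poles are different. -/
theorem pol_sq_ne {s t : SIdx m} (h : t ≠ s) : pol s ^ 2 - pol t ^ 2 ≠ 0 := by
  by_cases h' : t = sneg s
  · subst h'
    have : pol s ^ 2 - pol (sneg s) ^ 2 = -2 * hbF m * sv s := by
      rw [pol_sneg, pol]; ring
    rw [this]
    exact mul_ne_zero (mul_ne_zero (by norm_num) hbF_ne_zero) (sv_ne_zero s)
  · have h1 := sv_sub_sv_add_ne_zero (fst_ne_of_ne h h') 0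
    have h2 := sv_add_sv_add_ne_zero (fst_ne_of_ne h h') (-1)
    push_cast at h1 h2
    have : pol s ^ 2 - pol t ^ 2 = (sv s - sv t + 0 * hbF m) * (sv s + sv t + -1 * hbF m) := by
      rw [pol, pol]; ring
    rw [this]
    exact mul_ne_zero h1 h2

/-! The factors of the coefficients of `ϰ` and `ϰ'`. -/

variable {ℓ : Fin N → ℕ} (r : (j : Fin N) → Fin (ℓ j) → ℂ)

/-- The factor for a variable at the next node. -/
def nxtF (s : SIdx m) (q : Idx m) : Fld m := if s.2 then pol s ^ 2 - cen q ^ 2 else 1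

/-- The factor for a variable at the previous node. -/
def prvF (s : SIdx m) (q : Idx m) : Fld m := if s.2 then pol s + cen q else -(pol s + cen q)

/-- The factor for another variable at the same node. -/
def othF (s : SIdx m) (q : Idx m) : Fld m :=
  if s.2 then (sv s - cen q) * (sv s + cen q - hbF m) else (sv s + cen q) * (sv s - cen q - hbF m)

/-- The factor depending on the variable itself. -/
def slfF (s : SIdx m) : Fld m :=
  (if s.2 then 1 else Rpoly r s.1.1 (pol s)) /
    (if s.2 then 2 * (sv s - hbF m) else -(2 * (sv s - hbF m)))

/-- The coefficient of the operator `ϰ` or `ϰ'`. -/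
def kco (s : SIdx m) : Fld m :=
  slfF r s * (∏ q ∈ nextIdx s.1.1, nxtF s q) * (∏ q ∈ prevIdx s.1.1, prvF s q) /
    ∏ q ∈ otherIdx s.1, othF s q

/-- The operators `ϰ` (sign `true`) and `ϰ'` (sign `false`). -/
def sop (s : SIdx m) : Op m := mulOp (kco r s) * (strans s).toLinearMap

theorem Rpoly_neg (j : Fin N) {L : Type*} [CommRing L] [Algebra ℂ[X] L] (w : L) :
    Rpoly r j (-w) = Rpoly r j w := by
  simp [Rpoly]

theorem sop_true (p : Idx m) : sop r (p, true) = kap p := by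
  rw [sop, kap]
  have h1 : pol (p, true) = gam p := by simp [pol, sv, cen]
  have h2 : (strans (p, true)).toLinearMap = betaOp p (-1) := by simp [strans, sexp, betaOp]
  rw [h2]
  congr 2
  have h3 : ∏ q ∈ otherIdx p, othF (p, true) q = ∏ q ∈ otherIdx p, (gam p ^ 2 - gam q ^ 2) := by
    refine Finset.prod_congr rfl fun q _ => ?_
    simp only [othF, sv, cen, if_true]; ring
  have h4 : ∏ q ∈ prevIdx p.1, prvF (p, true) q =
      ∏ q ∈ prevIdx p.1, (gam p + gam q + hbF m / 2) := by
    refine Finset.prod_congr rfl fun q _ => ?_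
    simp only [prvF, h1, cen, if_true]; ring
  have h5 : slfF r (p, true) = 1 / (2 * (gam p - hbF m / 2)) := by
    simp only [slfF, sv, cen, if_true]; congr 2; ring
  simp only [kco, h3, h4, h5, nxtF, h1, cen, if_true]
  rw [div_mul_eq_mul_div, div_mul_eq_mul_div, one_mul, div_div]

theorem sop_false (p : Idx m) : sop r (p, false) = kap' r p := by
  rw [sop, kap']
  have h1 : pol (p, false) = -(gam p + hbF m) := by simp [pol, sv, cen]; ring
  have h2 : (strans (p, false)).toLinearMap = betaOp p 1 := by simp [strans, sexp, betaOp]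
  rw [h2]
  congr 2
  have h3 : ∏ q ∈ otherIdx p, othF (p, false) q =
      ∏ q ∈ otherIdx p, ((gam p + hbF m) ^ 2 - (gam q + hbF m) ^ 2) := by
    refine Finset.prod_congr rfl fun q _ => ?_
    simp only [othF, sv, cen, Bool.false_eq_true, if_false]; ring
  have h4 : ∏ q ∈ prevIdx p.1, prvF (p, false) q =
      ∏ q ∈ prevIdx p.1, (gam p + hbF m - (gam q + hbF m / 2)) := by
    refine Finset.prod_congr rfl fun q _ => ?_
    simp only [prvF, h1, cen, Bool.false_eq_true, if_false]; ring
  have h5 : slfF r (p, false) = Rpoly r p.1 (gam p + hbF m) / (2 * (gam p + 3 / 2 * hbF m)) := by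
    simp only [slfF, h1, Rpoly_neg, sv, cen, Bool.false_eq_true, if_false]; congr 1; ring
  simp only [kco, h3, h4, h5, nxtF, Bool.false_eq_true, if_false, Finset.prod_const_one, mul_one]
  rw [div_mul_eq_mul_div, div_div]

end Signed

/-! ### Exchange relations of the operators ϰ and ϰ' -/

section Exchange

variable {N : ℕ} {m : Fin N → ℕ} {ℓ : Fin N → ℕ} (r : (j : Fin N) → Fin (ℓ j) → ℂ)

theorem mem_nextIdx {j : Fin N} {q : Idx m} : q ∈ nextIdx j ↔ (q.1 : ℕ) = j + 1 := by
  simp [nextIdx]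

theorem mem_prevIdx {j : Fin N} {q : Idx m} : q ∈ prevIdx j ↔ (q.1 : ℕ) + 1 = j := by
  simp [prevIdx]

theorem mem_otherIdx {p q : Idx m} : q ∈ otherIdx p ↔ q.1 = p.1 ∧ q ≠ p := by
  simp [otherIdx]

theorem mulOp_mul (f g : Fld m) : (mulOp (f * g) : Op m) = mulOp f * mulOp g := by
  ext x; simp [mul_assoc]

theorem sop_mul_mulOp (s : SIdx m) (f : Fld m) :
    sop r s * mulOp f = mulOp (strans s f) * sop r s := by
  ext x
  simp only [sop, Module.End.mul_apply, mulOp_apply, AlgEquiv.toLinearMap_apply, map_mul]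
  ring

theorem sop_mul_sop (s t : SIdx m) : sop r s * sop r t =
    mulOp (kco r s * strans s (kco r t)) * ((strans s).toLinearMap * (strans t).toLinearMap) := by
  ext x
  simp only [sop, Module.End.mul_apply, mulOp_apply, AlgEquiv.toLinearMap_apply, map_mul]
  ring

/-- The shift parts of two operators commute, so a relation between the two orders is an identity
between their function coefficients. -/
theorem mulOp_mul_sop_mul_sop {s t : SIdx m} {f g : Fld m}
    (h : f * (kco r s * strans s (kco r t)) = g * (kco r t * strans t (kco r s))) :
    mulOp f * (sop r s * sop r t) = mulOp g * (sop r t * sop r s) := by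
  have e : ((strans s).toLinearMap * (strans t).toLinearMap : Op m) =
      (strans t).toLinearMap * (strans s).toLinearMap := LinearMap.ext fun x => strans_comm s t x
  rw [sop_mul_sop, sop_mul_sop, ← mul_assoc (mulOp f), ← mulOp_mul, ← mul_assoc (mulOp g),
    ← mulOp_mul, h, e]

theorem strans_Rpoly (s : SIdx m) (j : Fin N) (f : Fld m) :
    strans s (Rpoly r j f) = Rpoly r j (strans s f) := by
  simp only [Rpoly, map_prod, map_sub, map_pow, AlgEquiv.commutes]

theorem strans_two_mul (s : SIdx m) (f : Fld m) : strans s (2 * f) = 2 * strans s f := by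
  rw [map_mul, map_ofNat]

theorem strans_slfF {s t : SIdx m} (h : s.1 ≠ t.1) : strans t (slfF r s) = slfF r s := by
  simp only [slfF, map_div₀, apply_ite (strans t), strans_Rpoly, strans_pol_of_ne h,
    strans_sv_of_ne h, map_one, map_neg, map_sub, strans_two_mul, strans_hbF]

theorem strans_nxtF {s t : SIdx m} (h : s.1 ≠ t.1) {q : Idx m} (hq : q ≠ t.1) :
    strans t (nxtF s q) = nxtF s q := by
  simp only [nxtF, apply_ite (strans t), map_sub, map_pow, strans_pol_of_ne h,
    strans_cen_of_ne hq, map_one]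

theorem strans_prvF {s t : SIdx m} (h : s.1 ≠ t.1) {q : Idx m} (hq : q ≠ t.1) :
    strans t (prvF s q) = prvF s q := by
  simp only [prvF, apply_ite (strans t), map_neg, map_add, strans_pol_of_ne h,
    strans_cen_of_ne hq]

theorem strans_othF {s t : SIdx m} (h : s.1 ≠ t.1) {q : Idx m} (hq : q ≠ t.1) :
    strans t (othF s q) = othF s q := by
  simp only [othF, apply_ite (strans t), map_mul, map_add, map_sub, strans_sv_of_ne h,
    strans_cen_of_ne hq, strans_hbF]

theorem othF_ne_zero {s : SIdx m} {q : Idx m} (h : q ≠ s.1) : othF s q ≠ 0 := by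
  have h1 := sv_sub_cen_add_ne_zero h 0
  have h2 := sv_add_cen_add_ne_zero h (-1)
  have h3 := sv_add_cen_add_ne_zero h 0
  have h4 := sv_sub_cen_add_ne_zero h (-1)
  push_cast at h1 h2 h3 h4
  rw [othF]
  split_ifs
  · convert mul_ne_zero h1 h2 using 1; ring
  · convert mul_ne_zero h3 h4 using 1; ring

theorem nxtF_ne_zero {s : SIdx m} {q : Idx m} (h : q ≠ s.1) : nxtF s q ≠ 0 := by
  have h1 := sv_sub_cen_add_ne_zero h (-1 / 2)
  have h2 := sv_add_cen_add_ne_zero h (-1 / 2)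
  push_cast at h1 h2
  rw [nxtF, pol]
  split_ifs
  · convert mul_ne_zero h1 h2 using 1; ring
  · exact one_ne_zero

theorem prvF_ne_zero {s : SIdx m} {q : Idx m} (h : q ≠ s.1) : prvF s q ≠ 0 := by
  have h2 := sv_add_cen_add_ne_zero h (-1 / 2)
  push_cast at h2
  rw [prvF, pol]
  split_ifs
  · convert h2 using 1; ring
  · convert neg_ne_zero.2 h2 using 1; ring

theorem prod_othF_ne_zero (s : SIdx m) : ∏ q ∈ otherIdx s.1, othF s q ≠ 0 :=
  Finset.prod_ne_zero_iff.2 fun _ hq => othF_ne_zero (mem_otherIdx.1 hq).2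

theorem strans_prod_of_forall {S : Finset (Idx m)} {f : Idx m → Fld m} (t : SIdx m)
    (h : ∀ q ∈ S, strans t (f q) = f q) : strans t (∏ q ∈ S, f q) = ∏ q ∈ S, f q := by
  rw [map_prod]; exact Finset.prod_congr rfl h

/-- Only the factor of the shifted variable changes. The cross-multiplied form needs no
non-vanishing hypothesis. -/
theorem strans_prod_of_mem {S : Finset (Idx m)} {f : Idx m → Fld m} (t : SIdx m)
    (hS : t.1 ∈ S) (h : ∀ q ≠ t.1, strans t (f q) = f q) :
    strans t (∏ q ∈ S, f q) * f t.1 = (∏ q ∈ S, f q) * strans t (f t.1) := by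
  rw [map_prod, ← Finset.mul_prod_erase S _ hS, ← Finset.mul_prod_erase S f hS,
    Finset.prod_congr rfl fun q hq => h q (Finset.ne_of_mem_erase hq)]
  ring

/-- The variable of t enters the coefficient of `sop r s` through at most one factor, according to
whether its node is the same, next or previous. This lemma and the three after it express the effect
of the shift through that single factor. -/
theorem strans_kco_far {s t : SIdx m} (h0 : s.1.1 ≠ t.1.1) (h1 : (t.1.1 : ℕ) ≠ s.1.1 + 1)
    (h2 : (t.1.1 : ℕ) + 1 ≠ s.1.1) : strans t (kco r s) = kco r s := by
  have h : s.1 ≠ t.1 := fun e => h0 (by rw [e])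
  rw [kco, map_div₀, map_mul, map_mul, strans_slfF r h,
    strans_prod_of_forall t fun q hq => strans_nxtF h (by
      rintro rfl; exact h1 (mem_nextIdx.1 hq)),
    strans_prod_of_forall t fun q hq => strans_prvF h (by
      rintro rfl; exact h2 (mem_prevIdx.1 hq)),
    strans_prod_of_forall t fun q hq => strans_othF h (by
      rintro rfl; exact h0 (mem_otherIdx.1 hq).1.symm)]

theorem strans_kco_same {s t : SIdx m} (h : t.1 ≠ s.1) (h0 : t.1.1 = s.1.1) :
    strans t (kco r s) * strans t (othF s t.1) = kco r s * othF s t.1 := by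
  rw [kco, map_div₀, map_mul, map_mul, strans_slfF r h.symm,
    strans_prod_of_forall t fun q hq => strans_nxtF h.symm (by
      rintro rfl; have := mem_nextIdx.1 hq; rw [h0] at this; omega),
    strans_prod_of_forall t fun q hq => strans_prvF h.symm (by
      rintro rfl; have := mem_prevIdx.1 hq; rw [h0] at this; omega)]
  have hp := strans_prod_of_mem (S := otherIdx s.1) (f := othF s) t (mem_otherIdx.2 ⟨h0, h⟩)
    fun q hq => strans_othF h.symm hq
  have n1 := prod_othF_ne_zero s
  have n2 : strans t (∏ q ∈ otherIdx s.1, othF s q) ≠ 0 :=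
    (map_ne_zero_iff _ (strans t).injective).2 n1
  generalize strans t (∏ q ∈ otherIdx s.1, othF s q) = A at *
  generalize (∏ q ∈ otherIdx s.1, othF s q) = B at *
  rw [div_mul_eq_mul_div, div_mul_eq_mul_div, div_eq_div_iff n2 n1]
  linear_combination (-(slfF r s * (∏ q ∈ nextIdx s.1.1, nxtF s q) *
    (∏ q ∈ prevIdx s.1.1, prvF s q))) * hp

theorem strans_kco_next {s t : SIdx m} (h : (t.1.1 : ℕ) = s.1.1 + 1) :
    strans t (kco r s) * nxtF s t.1 = kco r s * strans t (nxtF s t.1) := by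
  have h0 : s.1 ≠ t.1 := fun e => by rw [e] at h; omega
  have hp := strans_prod_of_mem (S := nextIdx s.1.1) (f := nxtF s) t (mem_nextIdx.2 h)
    fun q hq => strans_nxtF h0 hq
  rw [kco, map_div₀, map_mul, map_mul, strans_slfF r h0,
    strans_prod_of_forall t fun q hq => strans_prvF h0 (by
      rintro rfl; have := mem_prevIdx.1 hq; omega),
    strans_prod_of_forall t fun q hq => strans_othF h0 (by
      rintro rfl; have := (mem_otherIdx.1 hq).1; rw [this] at h; omega)]
  linear_combination (slfF r s * (∏ q ∈ prevIdx s.1.1, prvF s q) /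
    ∏ q ∈ otherIdx s.1, othF s q) * hp

theorem strans_kco_prev {s t : SIdx m} (h : (t.1.1 : ℕ) + 1 = s.1.1) :
    strans t (kco r s) * prvF s t.1 = kco r s * strans t (prvF s t.1) := by
  have h0 : s.1 ≠ t.1 := fun e => by rw [e] at h; omega
  have hp := strans_prod_of_mem (S := prevIdx s.1.1) (f := prvF s) t (mem_prevIdx.2 h)
    fun q hq => strans_prvF h0 hq
  rw [kco, map_div₀, map_mul, map_mul, strans_slfF r h0,
    strans_prod_of_forall t fun q hq => strans_nxtF h0 (by
      rintro rfl; have := mem_nextIdx.1 hq; omega),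
    strans_prod_of_forall t fun q hq => strans_othF h0 (by
      rintro rfl; have := (mem_otherIdx.1 hq).1; rw [this] at h; omega)]
  linear_combination (slfF r s * (∏ q ∈ nextIdx s.1.1, nxtF s q) /
    ∏ q ∈ otherIdx s.1, othF s q) * hp

/-- Operators at non-adjacent nodes commute. -/
theorem sop_far {s t : SIdx m} (h0 : s.1.1 ≠ t.1.1) (h1 : (t.1.1 : ℕ) ≠ s.1.1 + 1)
    (h2 : (t.1.1 : ℕ) + 1 ≠ s.1.1) : sop r s * sop r t = sop r t * sop r s := by
  have h := mulOp_mul_sop_mul_sop r (s := s) (t := t) (f := 1) (g := 1) (by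
    rw [strans_kco_far r h0 h1 h2, strans_kco_far r h0.symm (by omega) (by omega)]; ring)
  have e : (mulOp 1 : Op m) = 1 := by ext x; simp
  simpa [e] using h

theorem cen_eq (s : SIdx m) : cen s.1 = if s.2 then sv s else -sv s := by
  rcases s with ⟨p, b⟩
  cases b <;> simp [sv]

/-- The exchange relation of two operators at the same node. -/
theorem sop_same {s t : SIdx m} (h : t.1 ≠ s.1) (h0 : t.1.1 = s.1.1) :
    mulOp (pol t - pol s + hbF m) * (sop r s * sop r t) =
      mulOp (-(pol s - pol t + hbF m)) * (sop r t * sop r s) := by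
  refine mulOp_mul_sop_mul_sop r ?_
  have e1 := strans_kco_same r h h0
  have e2 := strans_kco_same r h.symm h0.symm
  have n1 : strans t (othF s t.1) ≠ 0 :=
    (map_ne_zero_iff _ (strans t).injective).2 (othF_ne_zero h)
  have n2 : strans s (othF t s.1) ≠ 0 :=
    (map_ne_zero_iff _ (strans s).injective).2 (othF_ne_zero h.symm)
  refine mul_right_cancel₀ (mul_ne_zero n1 n2) ?_
  -- After division by the unchanged factors, only the mutual factors of s and t remain; the
  -- identity is checked for the four choices of signs.
  have key : (pol t - pol s + hbF m) * (othF t s.1 * strans t (othF s t.1)) =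
      -(pol s - pol t + hbF m) * (othF s t.1 * strans s (othF t s.1)) := by
    have a1 := strans_sv_of_ne h
    have a2 := strans_sv_of_ne h.symm
    have a3 := strans_sv_self s
    have a4 := strans_sv_self t
    simp only [othF, pol, cen_eq]
    cases s.2 <;> cases t.2 <;>
    simp only [Bool.false_eq_true, if_false, if_true, map_mul, map_add, map_sub, map_neg, a1, a2,
      a3, a4, strans_hbF] <;> ring
  linear_combination ((pol t - pol s + hbF m) * kco r s * strans t (othF s t.1)) * e2 +
    ((pol s - pol t + hbF m) * kco r t * strans s (othF t s.1)) * e1 +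
    (kco r s * kco r t) * key

/-- The coefficient at the first node sees the second variable only through `nxtF`, and the
coefficient at the second node sees the first only through `prvF`. What remains is an identity
between these two factors, for each choice of signs. -/
theorem sop_next {s t : SIdx m} (h : (t.1.1 : ℕ) = s.1.1 + 1) :
    mulOp (sv s - sv t + hbF m / 2) * (sop r s * sop r t) =
      mulOp (sv s - sv t - hbF m / 2) * (sop r t * sop r s) := by
  refine mulOp_mul_sop_mul_sop r ?_
  have h0 : t.1 ≠ s.1 := fun e => by rw [e] at h; omega
  have e1 := strans_kco_next r h
  have e2 := strans_kco_prev r h.symm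
  have n1 := nxtF_ne_zero h0
  have n2 := prvF_ne_zero h0.symm
  refine mul_right_cancel₀ (mul_ne_zero n1 n2) ?_
  have key : (sv s - sv t + hbF m / 2) * (nxtF s t.1 * strans s (prvF t s.1)) =
      (sv s - sv t - hbF m / 2) * (prvF t s.1 * strans t (nxtF s t.1)) := by
    have a1 := strans_sv_of_ne h0
    have a2 := strans_sv_of_ne h0.symm
    have a3 := strans_sv_self s
    have a4 := strans_sv_self t
    have a5 := strans_half s
    have a6 := strans_half t
    simp only [nxtF, prvF, pol, cen_eq]
    cases s.2 <;> cases t.2 <;>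
    simp only [Bool.false_eq_true, if_false, if_true, map_add, map_sub, map_neg, map_pow,
      map_one, a1, a2, a3, a4, a5, a6] <;> ring
  linear_combination ((sv s - sv t + hbF m / 2) * kco r s * nxtF s t.1) * e2 -
    ((sv s - sv t - hbF m / 2) * kco r t * prvF t s.1) * e1 +
    (kco r s * kco r t) * key

/-- The exchange relation of two operators at adjacent nodes. -/
theorem sop_adj {s t : SIdx m} (h : (t.1.1 : ℕ) = s.1.1 + 1 ∨ (s.1.1 : ℕ) = t.1.1 + 1) :
    mulOp (sv s - sv t + hbF m / 2) * (sop r s * sop r t) =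
      mulOp (sv s - sv t - hbF m / 2) * (sop r t * sop r s) := by
  rcases h with h | h
  · exact sop_next r h
  -- Exchanging s and t multiplies both sides by -1.
  · have := sop_next r h
    refine LinearMap.ext fun x => ?_
    have h2 := LinearMap.congr_fun this x
    simp only [Module.End.mul_apply, mulOp_apply] at h2 ⊢
    linear_combination h2

/-- The value of `ϰ ϰ'` and `ϰ' ϰ`. -/
def kprod (s : SIdx m) : Fld m :=
  Rpoly r s.1.1 (pol s) * (∏ q ∈ nextIdx s.1.1, (pol s ^ 2 - cen q ^ 2)) *
    (∏ q ∈ prevIdx s.1.1, (pol s ^ 2 - cen q ^ 2)) /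
    (4 * sv s * (sv s - hbF m) * ∏ q ∈ otherIdx s.1,
      ((sv s - cen q) * (sv s + cen q - hbF m) * ((sv s + cen q) * (sv s - cen q - hbF m))))

/-- Opposite signs shift the same variable in opposite directions, so the shifts cancel. The
coefficients are matched factor by factor, using that transport by s sends the pole of the opposite
signed variable to -a. -/
theorem sop_mul_sop_sneg (s : SIdx m) : sop r s * sop r (sneg s) = mulOp (kprod r s) := by
  have h1 : kco r s * strans s (kco r (sneg s)) = kprod r s := by
    -- The factor of the next node sits entirely in the operator of sign +. In contrast, the factor
    -- of the previous node is shared, a + c coming from one operator and a - c from the other, up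
    -- to signs.
    have hn : (∏ q ∈ nextIdx s.1.1, nxtF s q) * ∏ q ∈ nextIdx s.1.1, strans s (nxtF (sneg s) q) =
        ∏ q ∈ nextIdx s.1.1, (pol s ^ 2 - cen q ^ 2) := by
      rw [← Finset.prod_mul_distrib]
      refine Finset.prod_congr rfl fun q hq => ?_
      have hq' : q ≠ s.1 := by
        rintro rfl; have := mem_nextIdx.1 hq; omega
      rcases s with ⟨p, _ | _⟩ <;>
      simp only [nxtF, sneg, Bool.not_true, Bool.not_false, Bool.false_eq_true, if_true, if_false,
        map_one, map_sub, map_pow, strans_cen_of_ne hq', mul_one, one_mul]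
      have := strans_pol_sneg ((p, false) : SIdx m)
      simp only [sneg, Bool.not_false] at this
      rw [this, neg_sq]
    have hp : (∏ q ∈ prevIdx s.1.1, prvF s q) * ∏ q ∈ prevIdx s.1.1, strans s (prvF (sneg s) q) =
        ∏ q ∈ prevIdx s.1.1, (pol s ^ 2 - cen q ^ 2) := by
      rw [← Finset.prod_mul_distrib]
      refine Finset.prod_congr rfl fun q hq => ?_
      have hq' : q ≠ s.1 := by
        rintro rfl; have := mem_prevIdx.1 hq; omega
      have := strans_pol_sneg s
      rcases s with ⟨p, _ | _⟩ <;>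
      simp only [sneg, Bool.not_true, Bool.not_false] at this <;>
      simp only [prvF, sneg, Bool.not_true, Bool.not_false, Bool.false_eq_true, if_true, if_false,
        map_neg, map_add, strans_cen_of_ne hq', this] <;> ring
    have ho : (∏ q ∈ otherIdx s.1, othF s q) * ∏ q ∈ otherIdx s.1, strans s (othF (sneg s) q) =
        ∏ q ∈ otherIdx s.1, ((sv s - cen q) * (sv s + cen q - hbF m) *
          ((sv s + cen q) * (sv s - cen q - hbF m))) := by
      rw [← Finset.prod_mul_distrib]
      refine Finset.prod_congr rfl fun q hq => ?_
      have hq' := (mem_otherIdx.1 hq).2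
      have := strans_sv_sneg s
      rcases s with ⟨p, _ | _⟩ <;>
      simp only [sneg, Bool.not_true, Bool.not_false] at this <;>
      simp only [othF, sneg, Bool.not_true, Bool.not_false, Bool.false_eq_true, if_true, if_false,
        map_mul, map_add, map_sub, strans_cen_of_ne hq', this, strans_hbF] <;> ring
    have hs : slfF r s * strans s (slfF r (sneg s)) =
        Rpoly r s.1.1 (pol s) / (4 * sv s * (sv s - hbF m)) := by
      have a1 := strans_sv_sneg s
      have a2 := strans_pol_sneg s
      have a3 := Rpoly_neg r s.1.1 (pol s)
      rcases s with ⟨p, _ | _⟩ <;>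
      simp only [sneg, Bool.not_true, Bool.not_false] at a1 a2 <;>
      simp only [slfF, sneg, Bool.not_true, Bool.not_false, Bool.false_eq_true, if_true, if_false,
        map_div₀, map_one, map_neg, strans_two_mul, map_sub, strans_Rpoly, a1, a2, a3,
        strans_hbF] <;>
      rw [div_mul_div_comm] <;> congr 1 <;> ring
    rw [kco, kco, map_div₀, map_mul, map_mul, map_prod, map_prod, map_prod, kprod, sneg_fst,
      ← hn, ← hp, ← ho, div_mul_div_comm]
    calc _ = (slfF r s * strans s (slfF r (sneg s))) *
        ((∏ q ∈ nextIdx s.1.1, nxtF s q) * ∏ q ∈ nextIdx s.1.1, strans s (nxtF (sneg s) q)) *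
        ((∏ q ∈ prevIdx s.1.1, prvF s q) * ∏ q ∈ prevIdx s.1.1, strans s (prvF (sneg s) q)) /
        ((∏ q ∈ otherIdx s.1, othF s q) * ∏ q ∈ otherIdx s.1, strans s (othF (sneg s) q)) := by
          congr 1; ring
      _ = _ := by rw [hs, div_mul_eq_mul_div, div_mul_eq_mul_div, div_div]
  rw [sop_mul_sop, h1]
  ext x
  simp [strans_sneg]

end Exchange

/-! ### Laurent series in `u⁻¹` -/

section Laurent

variable {F : Type*} [Field F]

/-- The power `u^e`. -/
def upow (e : ℤ) : LaurentSeries F := HahnSeries.single (-e) 1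

theorem upow_add (e e' : ℤ) : (upow (e + e') : LaurentSeries F) = upow e * upow e' := by
  rw [upow, upow, upow, HahnSeries.single_mul_single, mul_one, neg_add]

theorem upow_zero : (upow 0 : LaurentSeries F) = 1 := by simp [upow]

theorem upow_ne_zero (e : ℤ) : (upow e : LaurentSeries F) ≠ 0 :=
  HahnSeries.single_ne_zero one_ne_zero

theorem upow_neg (e : ℤ) : (upow (-e) : LaurentSeries F) = (upow e)⁻¹ := by
  refine (inv_eq_of_mul_eq_one_left ?_).symm
  rw [← upow_add, neg_add_cancel, upow_zero]

/-- A power series in `u⁻¹` as a Laurent series. -/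
def lau : PowerSeries F →+* LaurentSeries F := HahnSeries.ofPowerSeries ℤ F

theorem lau_X : lau (PowerSeries.X : PowerSeries F) = upow (-1) := by
  rw [lau, HahnSeries.ofPowerSeries_X, upow, neg_neg]

theorem lau_X_pow (n : ℕ) : lau ((PowerSeries.X : PowerSeries F) ^ n) = upow (-(n : ℤ)) := by
  rw [lau, HahnSeries.ofPowerSeries_X_pow, upow, neg_neg]

theorem lau_C (a : F) : lau (PowerSeries.C a) = HahnSeries.C a :=
  HahnSeries.ofPowerSeries_C a

theorem lau_injective : Function.Injective (lau : PowerSeries F →+* LaurentSeries F) :=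
  HahnSeries.ofPowerSeries_injective

/-- Laurent series are indexed by powers of u⁻¹, so multiplication by u^e moves the coefficient from
index d to d - e. -/
theorem coeff_upow_mul_lau (e : ℤ) (φ : PowerSeries F) (d : ℕ) :
    (upow e * lau φ).coeff (d - e) = PowerSeries.coeff d φ := by
  have h := HahnSeries.coeff_single_mul_add (r := (1 : F)) (x := lau φ) (a := (d : ℤ)) (b := -e)
  rw [← sub_eq_add_neg, one_mul] at h
  rw [upow, h]
  exact HahnSeries.ofPowerSeries_apply_coeff φ d

theorem coeff_upow_mul_lau_of_lt {e a : ℤ} (φ : PowerSeries F) (h : a < -e) :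
    (upow e * lau φ).coeff a = 0 := by
  have h1 := HahnSeries.coeff_single_mul_add (r := (1 : F)) (x := lau φ) (a := a + e) (b := -e)
  rw [show a + e + -e = a by ring, one_mul] at h1
  rw [upow, h1, lau]
  rw [HahnSeries.ofPowerSeries_apply]
  refine HahnSeries.embDomain_of_notMem_range ?_
  rintro ⟨n, hn⟩
  simp at hn
  omega

theorem upow_one_sub_C (a : F) : upow 1 - HahnSeries.C a =
    upow 1 * lau (1 - PowerSeries.C a * PowerSeries.X) := by
  have h : (upow 1 * upow (-1) : LaurentSeries F) = 1 := by rw [← upow_add]; exact upow_zero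
  rw [map_sub, map_one, map_mul, lau_C, lau_X]
  linear_combination (HahnSeries.C a) * h

theorem upow_one_sub_C_ne_zero (a : F) : (upow 1 - HahnSeries.C a : LaurentSeries F) ≠ 0 := by
  rw [upow_one_sub_C]
  refine mul_ne_zero (upow_ne_zero 1) fun h => ?_
  have h2 : (1 - PowerSeries.C a * PowerSeries.X : PowerSeries F) = 0 :=
    lau_injective (by rw [h, map_zero])
  have h3 := congrArg PowerSeries.constantCoeff h2
  simp at h3

theorem inv_upow_one_sub_C (a : F) :
    (upow 1 - HahnSeries.C a : LaurentSeries F)⁻¹ = lau (poleSer a) := by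
  refine inv_eq_of_mul_eq_one_left ?_
  rw [upow_one_sub_C, poleSer, map_mul, lau_X]
  have h1 : (upow 1 * upow (-1) : LaurentSeries F) = 1 := by rw [← upow_add]; exact upow_zero
  have h2 : lau (1 - PowerSeries.C a * PowerSeries.X) * lau (geoSer a) = 1 := by
    rw [← map_mul, one_sub_mul_geoSer, map_one]
  calc _ = (upow 1 * upow (-1)) * (lau (1 - PowerSeries.C a * PowerSeries.X) * lau (geoSer a)) := by
        ring
    _ = 1 := by rw [h1, h2, one_mul]

theorem coeff_lau (φ : PowerSeries F) (d : ℕ) : (lau φ).coeff d = PowerSeries.coeff d φ :=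
  HahnSeries.ofPowerSeries_apply_coeff φ d

/-! #### Base change -/

/-- Application of a ring homomorphism to the coefficients. -/
def mapLau (f : F →+* F) : LaurentSeries F →+* LaurentSeries F where
  toFun x := x.map f
  map_one' := HahnSeries.map_one f.toMonoidWithZeroHom
  map_mul' _ _ := HahnSeries.map_mul (f : F →ₙ+* F)
  map_zero' := HahnSeries.map_zero (f : ZeroHom F F)
  map_add' _ _ := HahnSeries.map_add (f : F →+ F)

theorem mapLau_upow (f : F →+* F) (e : ℤ) : mapLau f (upow e) = upow e := by
  ext n
  change f ((upow e : LaurentSeries F).coeff n) = _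
  rw [upow, HahnSeries.coeff_single]; split_ifs <;> simp

theorem mapLau_C (f : F →+* F) (a : F) : mapLau f (HahnSeries.C a) = HahnSeries.C (f a) := by
  ext n
  change f ((HahnSeries.C a : LaurentSeries F).coeff n) = _
  rw [HahnSeries.C_apply, HahnSeries.C_apply, HahnSeries.coeff_single, HahnSeries.coeff_single]
  split_ifs <;> simp

theorem mapLau_lau (f : F →+* F) (φ : PowerSeries F) :
    mapLau f (lau φ) = lau (PowerSeries.map f φ) := by
  ext n
  change f ((lau φ).coeff n) = _
  rcases lt_or_ge n 0 with h | h
  · have h1 := coeff_upow_mul_lau_of_lt (e := 0) φ (a := n) (by simpa using h)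
    have h2 := coeff_upow_mul_lau_of_lt (e := 0) (PowerSeries.map f φ) (a := n) (by simpa using h)
    rw [upow_zero, one_mul] at h1 h2
    rw [h1, h2, map_zero]
  · obtain ⟨d, rfl⟩ := Int.eq_ofNat_of_zero_le h
    rw [coeff_lau, coeff_lau, PowerSeries.coeff_map]

/-! #### Principal parts -/

theorem coeff_principal (k : ℕ) (φ : PowerSeries F) {d : ℕ} (hd : d ≠ 0) :
    PowerSeries.coeff d (principal k φ) = (upow (k : ℤ) * lau φ).coeff d := by
  have h := coeff_upow_mul_lau (k : ℤ) φ (d + k)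
  rw [show (((d + k : ℕ) : ℤ) - k) = d by push_cast; ring] at h
  rw [h, principal, PowerSeries.coeff_mk, if_neg hd]

theorem coeff_zero_principal (k : ℕ) (φ : PowerSeries F) :
    PowerSeries.coeff 0 (principal k φ) = 0 := by
  simp [principal]

/-- A polynomial in `u` as a Laurent series in `u⁻¹`. -/
def polLau (p : F[X]) : LaurentSeries F := p.eval₂ HahnSeries.C (upow 1)

theorem upow_natCast (n : ℕ) : (upow n : LaurentSeries F) = upow 1 ^ n := by
  induction n with
  | zero => simp [upow_zero]
  | succ n ih => rw [Nat.cast_succ, upow_add, ih, pow_succ]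

theorem coeff_polLau (p : F[X]) {d : ℤ} (hd : 0 < d) : (polLau p).coeff d = 0 := by
  induction p using Polynomial.induction_on' with
  | add p q hp hq =>
    rw [polLau] at hp hq
    rw [polLau, Polynomial.eval₂_add, HahnSeries.coeff_add, hp, hq, add_zero]
  | monomial n a =>
    rw [polLau, Polynomial.eval₂_monomial, ← upow_natCast, HahnSeries.C_mul_eq_smul,
      HahnSeries.coeff_smul, upow, HahnSeries.coeff_single, if_neg (by omega), smul_zero]

/-- Partial fractions for a rational function of `w` with simple poles at the `b_i`. -/
theorem eq_quo_add_sum_of_mul_prod {ι : Type*} [Fintype ι] [DecidableEq ι] (b : ι → F)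
    (hb : Function.Injective b) (P : F[X]) (z w : LaurentSeries F)
    (hw : ∀ i, w - HahnSeries.C (b i) ≠ 0)
    (hz : z * ∏ i, (w - HahnSeries.C (b i)) = P.eval₂ HahnSeries.C w) :
    ∃ Q : F[X], z = Q.eval₂ HahnSeries.C w + ∑ i, HahnSeries.C
      (P.eval (b i) / ∏ j ∈ Finset.univ.erase i, (b i - b j)) * (w - HahnSeries.C (b i))⁻¹ := by
  obtain ⟨Q, ρ, hρ, hP⟩ := Polynomial.eq_quo_mul_prod_add_sum_rem_mul_prod (s := Finset.univ) P
    (g := fun i => Polynomial.X - Polynomial.C (b i)) (fun i _ => Polynomial.monic_X_sub_C _)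
    (fun i _ j _ hij => Polynomial.isCoprime_X_sub_C_of_isUnit_sub
      (isUnit_iff_ne_zero.2 (sub_ne_zero.2 (hb.ne hij))))
  have hρ' : ∀ i, ρ i = Polynomial.C ((ρ i).coeff 0) := fun i => by
    refine Polynomial.eq_C_of_degree_le_zero ?_
    have := hρ i (Finset.mem_univ i)
    rw [Polynomial.degree_X_sub_C] at this
    by_cases h0 : ρ i = 0
    · simp [h0]
    · rw [Polynomial.degree_eq_natDegree h0] at this ⊢
      exact_mod_cast Nat.le_of_lt_succ (by exact_mod_cast this)
  -- Evaluating the division identity at b_i kills every term except the i-th remainder, which is a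
  -- constant because the divisors are linear.
  have hval : ∀ i, P.eval (b i) / ∏ j ∈ Finset.univ.erase i, (b i - b j) = (ρ i).coeff 0 := by
    intro i
    have hne : ∏ j ∈ Finset.univ.erase i, (b i - b j) ≠ 0 :=
      Finset.prod_ne_zero_iff.2 fun j hj => sub_ne_zero.2 (hb.ne (Finset.ne_of_mem_erase hj).symm)
    rw [div_eq_iff hne]
    conv_lhs => rw [hP]
    rw [Polynomial.eval_add, Polynomial.eval_mul, Polynomial.eval_prod,
      Finset.prod_eq_zero (Finset.mem_univ i) (by simp), mul_zero, zero_add,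
      Polynomial.eval_finsetSum, Finset.sum_eq_single i]
    · rw [Polynomial.eval_mul, Polynomial.eval_prod]
      conv_lhs => rw [hρ' i]
      simp
    · intro j _ hj
      rw [Polynomial.eval_mul, Polynomial.eval_prod,
        Finset.prod_eq_zero (Finset.mem_erase.2 ⟨hj.symm, Finset.mem_univ i⟩) (by simp), mul_zero]
    · simp
  refine ⟨Q, ?_⟩
  have hD : ∏ i, (w - HahnSeries.C (b i)) ≠ 0 := Finset.prod_ne_zero_iff.2 fun i _ => hw i
  refine mul_right_cancel₀ hD ?_
  rw [hz, add_mul, Finset.sum_mul]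
  conv_lhs => rw [hP]
  rw [Polynomial.eval₂_add, Polynomial.eval₂_mul, Polynomial.eval₂_finsetProd,
    Polynomial.eval₂_finsetSum]
  congr 1
  · simp
  · refine Finset.sum_congr rfl fun i _ => ?_
    rw [hval, Polynomial.eval₂_mul, hρ' i, Polynomial.eval₂_C, Polynomial.eval₂_finsetProd,
      ← Finset.mul_prod_erase _ _ (Finset.mem_univ i), Polynomial.coeff_C_zero]
    simp only [Polynomial.eval₂_sub, Polynomial.eval₂_X, Polynomial.eval₂_C]
    have := hw i
    field_simp

section Symmetric

variable {ι : Type*} [Fintype ι] [DecidableEq ι] (y : ι → F)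

/-- The residue at `w = y_i²` of `P(w) / ∏ (w - y_j²)`. -/
def sqRes (P : F[X]) (i : ι) : F :=
  P.eval (y i ^ 2) / ∏ j ∈ Finset.univ.erase i, (y i ^ 2 - y j ^ 2)

theorem upow_sq_sub_C (a : F) : upow 1 ^ 2 - HahnSeries.C (a ^ 2) =
    (upow 1 - HahnSeries.C a) * (upow 1 - HahnSeries.C (-a)) := by
  rw [map_neg, map_pow]; ring

theorem upow_sq_sub_C_ne_zero (a : F) :
    (upow 1 ^ 2 - HahnSeries.C (a ^ 2) : LaurentSeries F) ≠ 0 := by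
  rw [upow_sq_sub_C]
  exact mul_ne_zero (upow_one_sub_C_ne_zero _) (upow_one_sub_C_ne_zero _)

theorem eval₂_sq_eq_polLau (Q : F[X]) :
    Q.eval₂ HahnSeries.C (upow 1 ^ 2) = polLau (Q.comp (Polynomial.X ^ 2)) := by
  rw [polLau, Polynomial.eval₂_comp]; simp

variable {y} (hy : ∀ i j, i ≠ j → y i ^ 2 ≠ y j ^ 2)
include hy

/-- The principal part of an even rational function with simple poles at the `±y_i`. -/
theorem principal_of_even (hy0 : ∀ i, 2 * y i ≠ 0) (P : F[X]) (k : ℕ) (φ : PowerSeries F)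
    (h : (upow k * lau φ) * ∏ i, (upow 1 ^ 2 - HahnSeries.C (y i ^ 2)) =
      P.eval₂ HahnSeries.C (upow 1 ^ 2)) :
    principal k φ = ∑ i, PowerSeries.C (sqRes y P i / (2 * y i)) *
      (poleSer (y i) - poleSer (-y i)) := by
  obtain ⟨Q, hQ⟩ := eq_quo_add_sum_of_mul_prod (fun i => y i ^ 2)
    (fun i j hij => by by_contra hne; exact hy i j hne hij) P _ _
    (fun i => upow_sq_sub_C_ne_zero (y i)) h
  have hs : ∀ i, (upow 1 ^ 2 - HahnSeries.C (y i ^ 2) : LaurentSeries F)⁻¹ =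
      HahnSeries.C (1 / (2 * y i)) * lau (poleSer (y i) - poleSer (-y i)) := by
    intro i
    have n1 := upow_one_sub_C_ne_zero (y i)
    have n2 := upow_one_sub_C_ne_zero (-y i)
    have hc : (HahnSeries.C (1 / (2 * y i)) : LaurentSeries F) * (2 * HahnSeries.C (y i)) = 1 := by
      rw [← map_ofNat HahnSeries.C 2, ← map_mul, ← map_mul, one_div_mul_cancel (hy0 i), map_one]
    rw [upow_sq_sub_C, map_sub, ← inv_upow_one_sub_C, ← inv_upow_one_sub_C, mul_inv]
    rw [map_neg] at *
    field_simp
    linear_combination -hc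
  ext d
  rcases eq_or_ne d 0 with rfl | hd
  · rw [coeff_zero_principal, map_sum]
    refine (Finset.sum_eq_zero fun i _ => ?_).symm
    rw [PowerSeries.coeff_C_mul, map_sub, coeff_poleSer, coeff_poleSer]; simp
  · rw [coeff_principal k φ hd, hQ, eval₂_sq_eq_polLau, HahnSeries.coeff_add,
      coeff_polLau _ (by exact_mod_cast Nat.pos_of_ne_zero hd), zero_add, ← coeff_lau, map_sum]
    congr 1
    refine Finset.sum_congr rfl fun i _ => ?_
    rw [hs, ← mul_assoc, ← map_mul, map_mul lau, lau_C, sqRes]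
    congr 2
    ring

/-- The principal part of an odd rational function with simple poles at the `±y_i`. -/
theorem principal_of_odd (h2 : (2 : F) ≠ 0) (P : F[X]) (k : ℕ) (φ : PowerSeries F)
    (z : LaurentSeries F) (hz : upow k * lau φ = upow 1 * z)
    (h : z * ∏ i, (upow 1 ^ 2 - HahnSeries.C (y i ^ 2)) = P.eval₂ HahnSeries.C (upow 1 ^ 2)) :
    principal k φ = ∑ i, PowerSeries.C (sqRes y P i / 2) *
      (poleSer (y i) + poleSer (-y i)) := by
  obtain ⟨Q, hQ⟩ := eq_quo_add_sum_of_mul_prod (fun i => y i ^ 2)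
    (fun i j hij => by by_contra hne; exact hy i j hne hij) P _ _
    (fun i => upow_sq_sub_C_ne_zero (y i)) h
  have hs : ∀ i, upow 1 * (upow 1 ^ 2 - HahnSeries.C (y i ^ 2) : LaurentSeries F)⁻¹ =
      HahnSeries.C (1 / 2) * lau (poleSer (y i) + poleSer (-y i)) := by
    intro i
    have n1 := upow_one_sub_C_ne_zero (y i)
    have n2 := upow_one_sub_C_ne_zero (-y i)
    have hc : (HahnSeries.C (1 / 2) : LaurentSeries F) * 2 = 1 := by
      rw [← map_ofNat HahnSeries.C 2, ← map_mul, one_div_mul_cancel h2, map_one]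
    rw [upow_sq_sub_C, map_add, ← inv_upow_one_sub_C, ← inv_upow_one_sub_C, mul_inv]
    rw [map_neg] at *
    field_simp
    linear_combination (-upow 1) * hc
  -- The extra factor u keeps the quotient a polynomial in u, hence invisible in the principal part.
  have hQ2 : upow 1 * polLau (Q.comp (Polynomial.X ^ 2)) =
      polLau (Polynomial.X * Q.comp (Polynomial.X ^ 2)) := by
    rw [polLau, polLau, Polynomial.eval₂_mul, Polynomial.eval₂_X]
  ext d
  rcases eq_or_ne d 0 with rfl | hd
  · rw [coeff_zero_principal, map_sum]
    refine (Finset.sum_eq_zero fun i _ => ?_).symm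
    rw [PowerSeries.coeff_C_mul, map_add, coeff_poleSer, coeff_poleSer]; simp
  · rw [coeff_principal k φ hd, hz, hQ, eval₂_sq_eq_polLau, mul_add, hQ2, HahnSeries.coeff_add,
      coeff_polLau _ (by exact_mod_cast Nat.pos_of_ne_zero hd), zero_add, ← coeff_lau, map_sum,
      Finset.mul_sum]
    congr 1
    refine Finset.sum_congr rfl fun i _ => ?_
    rw [mul_left_comm, hs, ← mul_assoc, ← map_mul, map_mul lau, lau_C, sqRes]
    congr 2
    ring

end Symmetric

/-! #### Monic series with coefficients in a subalgebra -/

variable [Algebra ℂ[X] F] (S : Subalgebra ℂ[X] F)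

/-- The series `u^e (1 + …)` with coefficients in `S`. -/
def IsMonicSer (e : ℤ) (f : LaurentSeries F) : Prop :=
  ∃ φ : PowerSeries S, PowerSeries.constantCoeff φ = 1 ∧
    f = upow e * lau (PowerSeries.map S.val.toRingHom φ)

variable {S}

theorem IsMonicSer.mul {e e' : ℤ} {f g : LaurentSeries F} (hf : IsMonicSer S e f)
    (hg : IsMonicSer S e' g) : IsMonicSer S (e + e') (f * g) := by
  obtain ⟨φ, h1, rfl⟩ := hf
  obtain ⟨ψ, h2, rfl⟩ := hg
  exact ⟨φ * ψ, by simp [h1, h2], by rw [map_mul, map_mul, upow_add]; ring⟩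

theorem IsMonicSer.one : IsMonicSer S 0 1 :=
  ⟨1, by simp, by rw [map_one, map_one, upow_zero, one_mul]⟩

theorem IsMonicSer.ne_zero {e : ℤ} {f : LaurentSeries F} (hf : IsMonicSer S e f) : f ≠ 0 := by
  obtain ⟨φ, h1, rfl⟩ := hf
  refine mul_ne_zero (upow_ne_zero e) fun h => ?_
  have h2 : PowerSeries.map S.val.toRingHom φ = 0 := lau_injective (by rw [h, map_zero])
  have h3 := congrArg PowerSeries.constantCoeff h2
  rw [← PowerSeries.coeff_zero_eq_constantCoeff_apply, PowerSeries.coeff_map,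
    PowerSeries.coeff_zero_eq_constantCoeff_apply, h1] at h3
  simp at h3

/-- A power series with constant term 1 is invertible over the subalgebra itself; so inverting
h_i(u) introduces no denominators. -/
theorem IsMonicSer.inv {e : ℤ} {f : LaurentSeries F} (hf : IsMonicSer S e f) :
    IsMonicSer S (-e) f⁻¹ := by
  obtain ⟨φ, h1, rfl⟩ := hf
  obtain ⟨ψ, hψ⟩ := isUnit_iff_exists_inv.1 (PowerSeries.isUnit_iff_constantCoeff.2
    (show IsUnit (PowerSeries.constantCoeff φ) by rw [h1]; exact isUnit_one))
  refine ⟨ψ, ?_, ?_⟩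
  · have := congrArg PowerSeries.constantCoeff hψ
    simpa [h1] using this
  · refine inv_eq_of_mul_eq_one_left ?_
    have h2 : lau (PowerSeries.map S.val.toRingHom ψ) *
        lau (PowerSeries.map S.val.toRingHom φ) = 1 := by
      rw [← map_mul, ← map_mul, mul_comm, hψ, map_one, map_one]
    have h3 : (upow (-e) * upow e : LaurentSeries F) = 1 := by
      rw [← upow_add, neg_add_cancel, upow_zero]
    calc _ = (upow (-e) * upow e) * (lau (PowerSeries.map S.val.toRingHom ψ) *
        lau (PowerSeries.map S.val.toRingHom φ)) := by ring
      _ = 1 := by rw [h2, h3, one_mul]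

theorem IsMonicSer.prod {ι : Type*} (s : Finset ι) {e : ι → ℤ} {f : ι → LaurentSeries F}
    (h : ∀ i ∈ s, IsMonicSer S (e i) (f i)) : IsMonicSer S (∑ i ∈ s, e i) (∏ i ∈ s, f i) := by
  classical
  induction s using Finset.induction_on with
  | empty => simpa using IsMonicSer.one
  | insert a s ha ih =>
    rw [Finset.sum_insert ha, Finset.prod_insert ha]
    exact (h a (by simp)).mul (ih fun i hi => h i (by simp [hi]))

theorem IsMonicSer.pow {e : ℤ} {f : LaurentSeries F} (hf : IsMonicSer S e f) (n : ℕ) :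
    IsMonicSer S (n * e) (f ^ n) := by
  have := IsMonicSer.prod (Finset.range n) (e := fun _ => e) (f := fun _ => f) fun _ _ => hf
  simpa using this

theorem IsMonicSer.zpow {e : ℤ} {f : LaurentSeries F} (hf : IsMonicSer S e f) (n : ℤ) :
    IsMonicSer S (n * e) (f ^ n) := by
  obtain ⟨k, rfl | rfl⟩ := n.eq_nat_or_neg
  · simpa using hf.pow k
  · rw [zpow_neg, zpow_natCast, neg_mul]; exact (hf.pow k).inv

theorem isMonicSer_upow_one_sub_C {a : F} (ha : a ∈ S) :
    IsMonicSer S 1 (upow 1 - HahnSeries.C a) := by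
  refine ⟨1 - PowerSeries.C ⟨a, ha⟩ * PowerSeries.X, by simp, ?_⟩
  rw [upow_one_sub_C]
  congr 2
  simp

/-! #### Shifts of Laurent series -/

variable (c : ℂ[X])

/-- `g(u) = f(u + c)`. -/
def IsShift (f g : LaurentSeries F) : Prop :=
  ∃ (e : ℤ) (φ : PowerSeries F), f = upow e * lau φ ∧ g = upow e * lau (shiftSeries e c φ)

variable {c}

theorem IsShift.mul {f g f' g' : LaurentSeries F} (h : IsShift c f g) (h' : IsShift c f' g') :
    IsShift c (f * f') (g * g') := by
  obtain ⟨e, φ, rfl, rfl⟩ := h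
  obtain ⟨e', φ', rfl, rfl⟩ := h'
  refine ⟨e + e', φ * φ', ?_, ?_⟩
  · rw [upow_add, map_mul]; ring
  · rw [upow_add, shiftSeries_mul, map_mul]; ring

theorem IsShift.one : IsShift c (1 : LaurentSeries F) 1 :=
  ⟨0, 1, by rw [map_one, upow_zero, mul_one],
    by rw [shiftSeries_zero_one, map_one, upow_zero, mul_one]⟩

theorem isShift_upow_one_sub_C (a : F) : IsShift c (upow 1 - HahnSeries.C a)
    (upow 1 - HahnSeries.C (a - algebraMap ℂ[X] F c)) :=
  ⟨1, 1 - PowerSeries.C a * PowerSeries.X, upow_one_sub_C a, by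
    rw [upow_one_sub_C, shiftSeries_lin]⟩

/-- The power series need not be invertible, so its order is first absorbed into the exponent of u.
Then the shift of ψ ψ⁻¹ = 1 with total exponent 0 shows that the shifts are inverse. -/
theorem IsShift.inv {f g : LaurentSeries F} (h : IsShift c f g) (hf : f ≠ 0) :
    IsShift c f⁻¹ g⁻¹ := by
  obtain ⟨e, φ, rfl, rfl⟩ := h
  have hφ : φ ≠ 0 := by rintro rfl; simp at hf
  obtain ⟨n, ψ, hψ, rfl⟩ : ∃ (n : ℕ) (ψ : PowerSeries F), PowerSeries.constantCoeff ψ ≠ 0 ∧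
      φ = PowerSeries.X ^ n * ψ := by
    refine ⟨φ.order.toNat, PowerSeries.divXPowOrder φ, ?_, ?_⟩
    · exact PowerSeries.constantCoeff_divXPowOrder_eq_zero_iff.not.2 hφ
    · exact (PowerSeries.X_pow_order_mul_divXPowOrder).symm
  have hu : ψ * ψ⁻¹ = 1 := PowerSeries.mul_inv_cancel _ hψ
  have hs : shiftSeries (e - n) c ψ * shiftSeries (-(e - n)) c ψ⁻¹ = 1 := by
    rw [← shiftSeries_mul, hu, add_neg_cancel, shiftSeries_zero_one]
  have hX : ∀ χ : PowerSeries F, upow e * lau (PowerSeries.X ^ n * χ) = upow (e - n) * lau χ := by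
    intro χ
    rw [map_mul, lau_X_pow, ← mul_assoc, ← upow_add, sub_eq_add_neg]
  have hinv : ∀ χ ω : PowerSeries F, χ * ω = 1 →
      (upow (e - n) * lau χ)⁻¹ = upow (-(e - n)) * lau ω := by
    intro χ ω h
    have h2 : lau χ * lau ω = 1 := by rw [← map_mul, h, map_one]
    rw [mul_inv, upow_neg, inv_eq_of_mul_eq_one_right h2]
  refine ⟨-(e - n), ψ⁻¹, ?_, ?_⟩
  · rw [hX]; exact hinv _ _ hu
  · rw [shiftSeries_X_pow_mul, hX]; exact hinv _ _ hs

theorem IsShift.prod {ι : Type*} (s : Finset ι) {f g : ι → LaurentSeries F}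
    (h : ∀ i ∈ s, IsShift c (f i) (g i)) : IsShift c (∏ i ∈ s, f i) (∏ i ∈ s, g i) := by
  classical
  induction s using Finset.induction_on with
  | empty => simpa using IsShift.one
  | insert a s ha ih =>
    rw [Finset.prod_insert ha, Finset.prod_insert ha]
    exact (h a (by simp)).mul (ih fun i hi => h i (by simp [hi]))

theorem IsShift.zpow {f g : LaurentSeries F} (h : IsShift c f g) (hf : f ≠ 0) (n : ℤ) :
    IsShift c (f ^ n) (g ^ n) := by
  have hp : ∀ k : ℕ, IsShift c (f ^ k) (g ^ k) := fun k => by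
    have := IsShift.prod (Finset.range k) (f := fun _ => f) (g := fun _ => g) fun _ _ => h
    simpa using this
  obtain ⟨k, rfl | rfl⟩ := n.eq_nat_or_neg
  · simpa using hp k
  · rw [zpow_neg, zpow_natCast, zpow_neg, zpow_natCast]; exact (hp k).inv (pow_ne_zero k hf)

/-- Well-definedness of the shift: two presentations u^e φ of one Laurent series differ by moving a
power of u⁻¹ between the two factors, which is compatible with `shiftSeries`. -/
theorem IsShift.eq_of_upow {e : ℤ} {φ : PowerSeries F} {g : LaurentSeries F}
    (h : IsShift c (upow e * lau φ) g) : g = upow e * lau (shiftSeries e c φ) := by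
  have key : ∀ (e e' : ℤ) (φ φ' : PowerSeries F), e ≤ e' →
      (upow e * lau φ : LaurentSeries F) = upow e' * lau φ' →
      (upow e * lau (shiftSeries e c φ) : LaurentSeries F) =
        upow e' * lau (shiftSeries e' c φ') := by
    intro e e' φ φ' hle heq
    obtain ⟨n, rfl⟩ := Int.le.dest hle
    have hX : ∀ χ : PowerSeries F,
        (upow e * lau χ : LaurentSeries F) = upow (e + n) * lau (PowerSeries.X ^ n * χ) := by
      intro χ
      rw [map_mul, lau_X_pow, ← mul_assoc, ← upow_add, add_neg_cancel_right]
    rw [hX] at heq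
    have := lau_injective (mul_left_cancel₀ (upow_ne_zero _) heq)
    rw [← this, shiftSeries_X_pow_mul, hX, add_sub_cancel_right]
  obtain ⟨e', φ', h1, rfl⟩ := h
  rcases le_total e e' with hle | hle
  · exact (key _ _ _ _ hle h1).symm
  · exact key _ _ _ _ hle h1.symm

end Laurent

/-! ### The images of `h_i(u)` and `z_j(u)` -/

section Images

variable {N : ℕ} {m : Fin N → ℕ} (lam : Fin (N + 1) → ℤ) {ℓ : Fin N → ℕ}
  (r : (j : Fin N) → Fin (ℓ j) → ℂ)

/-- `u - a`. -/
def ul (a : Fld m) : Ser m := upow 1 - HahnSeries.C a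

theorem ul_ne_zero (a : Fld m) : ul a ≠ 0 := upow_one_sub_C_ne_zero a

/-- A complex number as an element of the field of rational functions. -/
def cpx : ℂ →+* Fld m := (algebraMap ℂ[X] (Fld m)).comp Polynomial.C

theorem algebraMap_ser (a : ℂ[X]) : algebraMap ℂ[X] (Ser m) a = cst (algebraMap ℂ[X] (Fld m) a) := by
  rw [HahnSeries.algebraMap_apply', PowerSeries.algebraMap_apply, HahnSeries.ofPowerSeries_C]; rfl

/-- `h_i(u - d)` in factored form. -/
def hOff (d : Fld m) (i : Fin (N + 1)) : Ser m :=
  ul (((i : ℕ) : Fld m) / 2 * hbF m + d) ^ (-2 * lam 0) *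
    (∏ j ∈ Finset.univ.filter fun j : Fin N => (j : ℕ) < i, ∏ k,
      (ul ((((i : ℕ) : Fld m) - 1 - ((j : ℕ) : Fld m)) / 2 * hbF m + cpx (r j k) + d) *
       ul ((((i : ℕ) : Fld m) - 1 - ((j : ℕ) : Fld m)) / 2 * hbF m - cpx (r j k) + d))) *
    (∏ q ∈ Finset.univ.filter fun q : Idx m => (q.1 : ℕ) = i, (ul (cen q + d) * ul (-cen q + d))) *
    (∏ q ∈ Finset.univ.filter fun q : Idx m => (q.1 : ℕ) + 1 = i,
      (ul (gam q + d) * ul (-gam q - hbF m + d)))⁻¹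

theorem uSer_sub_cst (a : Fld m) : uSer m - cst a = ul a := rfl

theorem Rpoly_ul (j : Fin N) (a : Fld m) :
    Rpoly r j (ul a) = ∏ k, (ul (a + cpx (r j k)) * ul (a - cpx (r j k))) := by
  rw [Rpoly]
  refine Finset.prod_congr rfl fun k _ => ?_
  have h : algebraMap ℂ[X] (Ser m) (Polynomial.C (r j k)) = HahnSeries.C (cpx (r j k)) :=
    algebraMap_ser _
  rw [h, ul, ul, ul, map_add, map_sub]
  ring

theorem uSer_sq_sub_cst (a : Fld m) : uSer m ^ 2 - cst (a ^ 2) = ul a * ul (-a) :=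
  upow_sq_sub_C a

theorem uSer_add_cst (a b : Fld m) : uSer m + cst a + cst b = ul (-a - b) := by
  have h : (HahnSeries.C (-a - b) : Ser m) = -HahnSeries.C a - HahnSeries.C b := by
    rw [map_sub, map_neg]
  rw [ul, h, sub_sub_eq_add_sub, sub_neg_eq_add]
  exact add_right_comm _ _ _

theorem hImage_eq_hOff (i : Fin (N + 1)) : hImage lam r i = hOff (m := m) lam r 0 i := by
  rw [hImage, hOff, div_eq_mul_inv]
  simp only [add_zero, uSer_sub_cst, Rpoly_ul, uSer_sq_sub_cst, uSer_add_cst, cen]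

theorem isShift_ul (a d d' : Fld m) (c : ℂ[X]) (h : d' = d - algebraMap ℂ[X] (Fld m) c) :
    IsShift c (ul (a + d)) (ul (a + d')) := by
  have := isShift_upow_one_sub_C (c := c) (a + d)
  rwa [show a + d - algebraMap ℂ[X] (Fld m) c = a + d' by rw [h]; ring] at this

theorem isShift_hOff (d d' : Fld m) (c : ℂ[X]) (h : d' = d - algebraMap ℂ[X] (Fld m) c)
    (i : Fin (N + 1)) : IsShift c (hOff lam r d i) (hOff lam r d' i) := by
  refine IsShift.mul (IsShift.mul (IsShift.mul ?_ ?_) ?_) ?_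
  · exact (isShift_ul _ _ _ _ h).zpow (ul_ne_zero _) _
  · exact IsShift.prod _ fun j _ => IsShift.prod _ fun k _ =>
      (isShift_ul _ _ _ _ h).mul (isShift_ul _ _ _ _ h)
  · exact IsShift.prod _ fun q _ => (isShift_ul _ _ _ _ h).mul (isShift_ul _ _ _ _ h)
  · refine (IsShift.prod _ fun q _ => (isShift_ul _ _ _ _ h).mul (isShift_ul _ _ _ _ h)).inv ?_
    exact Finset.prod_ne_zero_iff.2 fun q _ => mul_ne_zero (ul_ne_zero _) (ul_ne_zero _)

variable (m) in
/-- The polynomial functions of `ħ` and the `γ_p`. -/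
def polySub : Subalgebra ℂ[X] (Fld m) := Algebra.adjoin ℂ[X] (Set.range gam)

theorem gam_mem (p : Idx m) : gam p ∈ polySub m := Algebra.subset_adjoin ⟨p, rfl⟩

theorem cpx_mem (a : ℂ) : (cpx a : Fld m) ∈ polySub m := Subalgebra.algebraMap_mem _ _

theorem cpx_ratCast (q : ℚ) : (cpx (q : ℂ) : Fld m) = q := by
  rw [map_ratCast]

theorem ratCast_mul_hbF_mem (q : ℚ) : ((q : Fld m) * hbF m) ∈ polySub m := by
  rw [← cpx_ratCast]
  exact mul_mem (cpx_mem _) (Subalgebra.algebraMap_mem _ _)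

theorem cen_mem (p : Idx m) : cen p ∈ polySub m := by
  have := ratCast_mul_hbF_mem (m := m) (1 / 2)
  push_cast at this
  rw [cen]
  convert add_mem (gam_mem p) this using 2
  ring

theorem isMonicSer_ul {a : Fld m} (ha : a ∈ polySub m) : IsMonicSer (polySub m) 1 (ul a) :=
  isMonicSer_upow_one_sub_C ha

theorem prod_filter_node {M : Type*} [CommMonoid M] (j : Fin N) (f : Idx m → M) :
    ∏ q ∈ Finset.univ.filter (fun q : Idx m => q.1 = j), f q = ∏ k, f ⟨j, k⟩ := by
  have h : Finset.univ.filter (fun q : Idx m => q.1 = j) =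
      Finset.univ.map (Function.Embedding.sigmaMk j) := by
    ext ⟨i, k⟩
    simp only [Finset.mem_filter, Finset.mem_univ, true_and, Finset.mem_map,
      Function.Embedding.sigmaMk_apply]
    constructor
    · rintro rfl; exact ⟨k, rfl⟩
    · rintro ⟨a, ha⟩; exact (congrArg Sigma.fst ha).symm
  rw [h, Finset.prod_map]
  rfl

end Images

/-! ### Degree, coefficients and shifts of the image of h_i(u) -/

section HSeries

variable {N : ℕ} {m : Fin N → ℕ} {lam : Fin (N + 1) → ℤ} {ℓ : Fin N → ℕ}
  (r : (j : Fin N) → Fin (ℓ j) → ℂ)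

theorem sum_filter_rootPairing (lam : Fin (N + 1) → ℤ) (i : Fin (N + 1)) :
    ∑ j ∈ Finset.univ.filter (fun j : Fin N => (j : ℕ) < i), rootPairing lam j =
      lam 0 - lam i := by
  induction i using Fin.induction with
  | zero => simp
  | succ i ih =>
    have h : Finset.univ.filter (fun j : Fin N => (j : ℕ) < i.succ) =
        insert i (Finset.univ.filter (fun j : Fin N => (j : ℕ) < i.castSucc)) := by
      ext j
      simp only [Finset.mem_filter, Finset.mem_univ, true_and, Finset.mem_insert, Fin.val_succ,
        Fin.val_castSucc, Fin.ext_iff]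
      omega
    rw [h, Finset.sum_insert (by simp), ih, rootPairing]
    ring

/-- Comparing the i-th coordinates of λ - μ = ∑ m_j α_j expresses the difference of the numbers of
variables at the two nodes around i. -/
theorem weight_eq {μ lam : Fin (N + 1) → ℤ}
    (hm : lam - μ = ∑ j, (m j : ℤ) • simpleCoroot j) (i : Fin (N + 1)) :
    (∑ _q ∈ Finset.univ.filter (fun q : Idx m => (q.1 : ℕ) = i), (1 : ℤ)) -
      ∑ _q ∈ Finset.univ.filter (fun q : Idx m => (q.1 : ℕ) + 1 = i), (1 : ℤ) = lam i - μ i := by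
  have h := congrFun hm i
  rw [Pi.sub_apply, Finset.sum_apply] at h
  rw [h, Finset.sum_filter, Finset.sum_filter, Fintype.sum_sigma, Fintype.sum_sigma,
    ← Finset.sum_sub_distrib]
  refine Finset.sum_congr rfl fun j _ => ?_
  have h1 : ((j : ℕ) = i) ↔ i = j.castSucc := by rw [Fin.ext_iff, Fin.val_castSucc]; tauto
  have h2 : ((j : ℕ) + 1 = i) ↔ i = j.succ := by rw [Fin.ext_iff, Fin.val_succ]; tauto
  simp only [h1, h2, simpleCoroot, Pi.smul_apply, Pi.sub_apply, Pi.single_apply, smul_eq_mul]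
  simp
  split_ifs <;> simp

theorem isMonicSer_hOff {μ : Fin (N + 1) → ℤ}
    (hm : lam - μ = ∑ j, (m j : ℤ) • simpleCoroot j)
    (hℓ : ∀ j, (ℓ j : ℤ) = rootPairing lam j) (i : Fin (N + 1)) :
    IsMonicSer (polySub m) (-2 * μ i) (hOff (m := m) lam r 0 i) := by
  have hmem : ∀ q : ℚ, (q : Fld m) * hbF m + 0 ∈ polySub m := fun q => by
    rw [add_zero]; exact ratCast_mul_hbF_mem q
  -- The degree in u, split according to the four groups of linear factors. The R_j telescope to
  -- 2(ε_1(λ) - ε_i(λ)) and the variables contribute 2(ε_i(λ) - ε_i(μ)).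
  have he : -2 * μ i = (-2 * lam 0) * 1 +
      (∑ j ∈ Finset.univ.filter (fun j : Fin N => (j : ℕ) < i), ∑ _k : Fin (ℓ j), (1 + 1)) +
      (∑ q ∈ Finset.univ.filter (fun q : Idx m => (q.1 : ℕ) = i), (1 + 1)) +
      -(∑ q ∈ Finset.univ.filter (fun q : Idx m => (q.1 : ℕ) + 1 = i), (1 + 1)) := by
    have h1 := weight_eq hm i
    have h2 := sum_filter_rootPairing lam i
    simp only [Finset.sum_add_distrib] at *
    have h3 : ∑ j ∈ Finset.univ.filter (fun j : Fin N => (j : ℕ) < i), ∑ _k : Fin (ℓ j), (1 : ℤ) =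
        ∑ j ∈ Finset.univ.filter (fun j : Fin N => (j : ℕ) < i), rootPairing lam j := by
      refine Finset.sum_congr rfl fun j _ => ?_
      rw [← hℓ]; simp
    rw [h3]
    linarith
  rw [he]
  refine IsMonicSer.mul (IsMonicSer.mul (IsMonicSer.mul ?_ ?_) ?_) ?_
  · refine IsMonicSer.zpow (isMonicSer_ul ?_) _
    convert hmem ((i : ℕ) / 2 : ℚ) using 3
    push_cast; ring
  · refine IsMonicSer.prod _ fun j _ => IsMonicSer.prod _ fun k _ =>
      IsMonicSer.mul (isMonicSer_ul ?_) (isMonicSer_ul ?_)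
    · convert add_mem (hmem ((((i : ℕ) - 1 - (j : ℕ)) / 2 : ℚ))) (cpx_mem (r j k)) using 1
      push_cast; ring
    · convert sub_mem (hmem ((((i : ℕ) - 1 - (j : ℕ)) / 2 : ℚ))) (cpx_mem (r j k)) using 1
      push_cast; ring
  · refine IsMonicSer.prod _ fun q _ =>
      IsMonicSer.mul (isMonicSer_ul ?_) (isMonicSer_ul ?_)
    · rw [add_zero]; exact cen_mem q
    · rw [add_zero]; exact neg_mem (cen_mem q)
  · refine IsMonicSer.inv (IsMonicSer.prod _ fun q _ =>
      IsMonicSer.mul (isMonicSer_ul ?_) (isMonicSer_ul ?_))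
    · rw [add_zero]; exact gam_mem q
    · have := hmem 1
      rw [add_zero, Rat.cast_one, one_mul] at this
      rw [add_zero]; exact sub_mem (neg_mem (gam_mem q)) this

/-! #### Action of the shifts of the variables -/

/-- The shift of the variables on Laurent series. -/
def slau (s : SIdx m) : Ser m →+* Ser m := mapLau ((strans s : Fld m →ₐ[ℂ[X]] Fld m) : Fld m →+* Fld m)

theorem slau_C (s : SIdx m) (a : Fld m) : slau s (HahnSeries.C a) = HahnSeries.C (strans s a) :=
  mapLau_C _ a

theorem slau_upow (s : SIdx m) (e : ℤ) : slau s (upow e) = upow e := mapLau_upow _ e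

theorem slau_lau (s : SIdx m) (φ : PowerSeries (Fld m)) : slau s (lau φ) =
    lau (PowerSeries.map ((strans s : Fld m →ₐ[ℂ[X]] Fld m) : Fld m →+* Fld m) φ) :=
  mapLau_lau _ φ

theorem slau_ul (s : SIdx m) (a : Fld m) : slau s (ul a) = ul (strans s a) := by
  rw [ul, map_sub, slau_C, slau_upow, ul]

theorem strans_cpx (s : SIdx m) (a : ℂ) : strans s (cpx a) = cpx a := (strans s).commutes _

theorem gam_eq_cen_sub (q : Idx m) : gam q = cen q - hbF m / 2 := by rw [cen]; ring

theorem slau_const (s : SIdx m) (i : Fin (N + 1)) :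
    slau s (ul (((i : ℕ) : Fld m) / 2 * hbF m + 0) ^ (-2 * lam 0) *
    (∏ j ∈ Finset.univ.filter fun j : Fin N => (j : ℕ) < i, ∏ k,
      (ul ((((i : ℕ) : Fld m) - 1 - ((j : ℕ) : Fld m)) / 2 * hbF m + cpx (r j k) + 0) *
       ul ((((i : ℕ) : Fld m) - 1 - ((j : ℕ) : Fld m)) / 2 * hbF m - cpx (r j k) + 0)))) =
    ul (((i : ℕ) : Fld m) / 2 * hbF m + 0) ^ (-2 * lam 0) *
    (∏ j ∈ Finset.univ.filter fun j : Fin N => (j : ℕ) < i, ∏ k,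
      (ul ((((i : ℕ) : Fld m) - 1 - ((j : ℕ) : Fld m)) / 2 * hbF m + cpx (r j k) + 0) *
       ul ((((i : ℕ) : Fld m) - 1 - ((j : ℕ) : Fld m)) / 2 * hbF m - cpx (r j k) + 0))) := by
  simp only [map_mul, map_zpow₀, map_prod, slau_ul, map_add, map_sub, map_div₀, strans_hbF,
    map_natCast, map_ofNat, map_one, map_zero, strans_cpx]

theorem slau_prod_of_forall {S : Finset (Idx m)} {f : Idx m → Ser m} (s : SIdx m)
    (h : ∀ q ∈ S, slau s (f q) = f q) : slau s (∏ q ∈ S, f q) = ∏ q ∈ S, f q := by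
  rw [map_prod]; exact Finset.prod_congr rfl h

theorem slau_prod_of_mem {S : Finset (Idx m)} {f : Idx m → Ser m} (s : SIdx m)
    (hS : s.1 ∈ S) (h : ∀ q ≠ s.1, slau s (f q) = f q) :
    slau s (∏ q ∈ S, f q) * f s.1 = (∏ q ∈ S, f q) * slau s (f s.1) := by
  rw [map_prod, ← Finset.mul_prod_erase S _ hS, ← Finset.mul_prod_erase S f hS,
    Finset.prod_congr rfl fun q hq => h q (Finset.ne_of_mem_erase hq)]
  ring

theorem slau_num_of_ne {s : SIdx m} {q : Idx m} (h : q ≠ s.1) :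
    slau s (ul (cen q + 0) * ul (-cen q + 0)) = ul (cen q + 0) * ul (-cen q + 0) := by
  rw [map_mul, slau_ul, slau_ul, add_zero, add_zero, map_neg, strans_cen_of_ne h]

theorem slau_den_of_ne {s : SIdx m} {q : Idx m} (h : q ≠ s.1) :
    slau s (ul (gam q + 0) * ul (-gam q - hbF m + 0)) =
      ul (gam q + 0) * ul (-gam q - hbF m + 0) := by
  rw [map_mul, slau_ul, slau_ul, add_zero, add_zero, map_sub, map_neg, gam_eq_cen_sub, map_sub,
    strans_cen_of_ne h, strans_hbF, strans_half]

theorem slau_hOff_far (s : SIdx m) (i : Fin (N + 1)) (h1 : (s.1.1 : ℕ) ≠ i)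
    (h2 : (s.1.1 : ℕ) + 1 ≠ i) : slau s (hOff lam r 0 i) = hOff lam r 0 i := by
  rw [hOff, map_mul, map_mul, slau_const, map_inv₀,
    slau_prod_of_forall s fun q hq => slau_num_of_ne (by
      rintro rfl; exact h1 (by simpa using hq)),
    slau_prod_of_forall s fun q hq => slau_den_of_ne (by
      rintro rfl; exact h2 (by simpa using hq))]

/-- At its own node a variable occurs in h_i(u) only through the numerator factor u² - w², which
becomes u² - (w - ħ)². -/
theorem slau_hOff_same (s : SIdx m) (i : Fin (N + 1)) (h : (s.1.1 : ℕ) = i) :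
    slau s (hOff lam r 0 i) * (ul (sv s) * ul (-sv s)) =
      hOff lam r 0 i * (ul (sv s - hbF m) * ul (-(sv s - hbF m))) := by
  have hp := slau_prod_of_mem (S := Finset.univ.filter fun q : Idx m => (q.1 : ℕ) = i)
    (f := fun q => ul (cen q + 0) * ul (-cen q + 0)) s (by simpa using h)
    fun _ hq => slau_num_of_ne hq
  -- The factor is even in c, so it may be written with the signed variable.
  have e1 : ul (cen s.1 + 0) * ul (-cen s.1 + 0) = ul (sv s) * ul (-sv s) := by
    rw [add_zero, add_zero, cen_eq]
    split_ifs
    · rfl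
    · rw [neg_neg, mul_comm]
  have e2 : slau s (ul (sv s) * ul (-sv s)) = ul (sv s - hbF m) * ul (-(sv s - hbF m)) := by
    rw [map_mul, slau_ul, slau_ul, map_neg, strans_sv_self]
  simp only [e1, e2] at hp
  rw [hOff, map_mul, map_mul, slau_const, map_inv₀,
    slau_prod_of_forall s fun q hq => slau_den_of_ne (by
      rintro rfl
      have : (s.1.1 : ℕ) + 1 = i := by simpa using hq
      omega)]
  rw [mul_right_comm _ _ (ul (sv s) * ul (-sv s)), mul_assoc _ _ (ul (sv s) * ul (-sv s)), hp,
    ← mul_assoc, mul_right_comm]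

/-- For the following index the variable occurs only in the denominator (u - a)(u + a + ħ), and the
shift replaces a by a - ħ. -/
theorem slau_hOff_succ (s : SIdx m) (i : Fin (N + 1)) (h : (s.1.1 : ℕ) + 1 = i) :
    slau s (hOff lam r 0 i) * (ul (pol s - hbF m) * ul (-pol s)) =
      hOff lam r 0 i * (ul (pol s) * ul (-pol s - hbF m)) := by
  have hp := slau_prod_of_mem (S := Finset.univ.filter fun q : Idx m => (q.1 : ℕ) + 1 = i)
    (f := fun q => ul (gam q + 0) * ul (-gam q - hbF m + 0)) s (by simpa using h)
    fun _ hq => slau_den_of_ne hq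
  have e1 : ul (gam s.1 + 0) * ul (-gam s.1 - hbF m + 0) = ul (pol s) * ul (-pol s - hbF m) := by
    rw [add_zero, add_zero, gam_eq_cen_sub, cen_eq, pol]
    split_ifs
    · rfl
    · rw [mul_comm]; congr 2 <;> ring
  have e2 : slau s (ul (pol s) * ul (-pol s - hbF m)) = ul (pol s - hbF m) * ul (-pol s) := by
    rw [map_mul, slau_ul, slau_ul, map_sub, map_neg, strans_pol_self, strans_hbF]
    congr 2; ring
  simp only [e1, e2] at hp
  rw [hOff, map_mul, map_mul, slau_const, map_inv₀,
    slau_prod_of_forall s fun q hq => slau_num_of_ne (by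
      rintro rfl
      have : (s.1.1 : ℕ) = i := by simpa using hq
      omega)]
  set D := ∏ q ∈ Finset.univ.filter fun q : Idx m => (q.1 : ℕ) + 1 = i,
    (ul (gam q + 0) * ul (-gam q - hbF m + 0)) with hD
  have n1 : D ≠ 0 := Finset.prod_ne_zero_iff.2 fun q _ => mul_ne_zero (ul_ne_zero _) (ul_ne_zero _)
  have n2 : slau s D ≠ 0 := (map_ne_zero_iff _ (slau s).injective).2 n1
  rw [mul_assoc, mul_assoc (_ * _) D⁻¹]
  congr 1
  rw [inv_mul_eq_div, inv_mul_eq_div, div_eq_div_iff n2 n1]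
  linear_combination -hp

end HSeries

/-! ### The image of z_j(u) as a rational function of u², and its residues -/

section ZSeries

variable {N : ℕ} {m : Fin N → ℕ} {lam : Fin (N + 1) → ℤ} {ℓ : Fin N → ℕ}
  (r : (j : Fin N) → Fin (ℓ j) → ℂ)

/-- The signed variables at the node `j`. -/
def nsv (j : Fin N) (κ : Fin (m j) × Bool) : SIdx m := (⟨j, κ.1⟩, κ.2)

/-- The poles at the node `j`. -/
def npol (j : Fin N) (κ : Fin (m j) × Bool) : Fld m := pol (nsv j κ)

theorem nsv_injective (j : Fin N) : Function.Injective (nsv (m := m) j) := by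
  rintro ⟨k, b⟩ ⟨k', b'⟩ h
  simp only [nsv, Prod.mk.injEq, Sigma.mk.injEq, heq_eq_eq, true_and] at h
  rw [h.1, h.2]

theorem npol_sq_ne (j : Fin N) (κ κ' : Fin (m j) × Bool) (h : κ ≠ κ') :
    npol j κ ^ 2 ≠ npol j κ' ^ 2 :=
  sub_ne_zero.1 (pol_sq_ne fun e => h (nsv_injective j e).symm)

/-- The numerator of `z_j(u)`, as a polynomial in `u²`. -/
def zNum (j : Fin N) (S : Finset (Idx m)) : (Fld m)[X] :=
  (∏ k, (Polynomial.X - Polynomial.C (cpx (r j k) ^ 2))) *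
    ∏ q ∈ S, (Polynomial.X - Polynomial.C (cen q ^ 2))

/-- The image of `z_j(u)`, with numerator formed by the variables in `S`. -/
def zLau (j : Fin N) (S : Finset (Idx m)) : Ser m :=
  (zNum r j S).eval₂ HahnSeries.C (upow 1 ^ 2) /
    ∏ κ, (upow 1 ^ 2 - HahnSeries.C (npol j κ ^ 2))

theorem eval₂_zNum (j : Fin N) (S : Finset (Idx m)) :
    (zNum r j S).eval₂ HahnSeries.C (upow 1 ^ 2) =
      (∏ k, (ul (cpx (r j k)) * ul (-cpx (r j k)))) * ∏ q ∈ S, (ul (cen q) * ul (-cen q)) := by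
  simp only [zNum, Polynomial.eval₂_mul, Polynomial.eval₂_finsetProd, Polynomial.eval₂_sub,
    Polynomial.eval₂_X, Polynomial.eval₂_C, upow_sq_sub_C]
  rfl

theorem prod_npol_ne_zero (j : Fin N) :
    ∏ κ, (upow 1 ^ 2 - HahnSeries.C (npol (m := m) j κ ^ 2)) ≠ 0 :=
  Finset.prod_ne_zero_iff.2 fun _ _ => upow_sq_sub_C_ne_zero _

theorem zLau_mul_prod (j : Fin N) (S : Finset (Idx m)) :
    zLau r j S * ∏ κ, (upow 1 ^ 2 - HahnSeries.C (npol j κ ^ 2)) =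
      (zNum r j S).eval₂ HahnSeries.C (upow 1 ^ 2) :=
  div_mul_cancel₀ _ (prod_npol_ne_zero j)

/-- The variables at the nodes adjacent to `j`. -/
def adjIdx (j : Fin N) : Finset (Idx m) := nextIdx j ∪ prevIdx j

theorem disjoint_nextIdx_prevIdx (j : Fin N) : Disjoint (nextIdx (m := m) j) (prevIdx j) := by
  rw [Finset.disjoint_left]
  intro q h1 h2
  have := mem_nextIdx.1 h1
  have := mem_prevIdx.1 h2
  omega

theorem prod_npol_eq (j : Fin N) : ∏ κ, (upow 1 ^ 2 - HahnSeries.C (npol (m := m) j κ ^ 2)) =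
    (∏ q ∈ Finset.univ.filter (fun q : Idx m => q.1 = j),
      (ul (cen q + hbF m / 2) * ul (-cen q + hbF m / 2))) *
    ∏ q ∈ Finset.univ.filter (fun q : Idx m => q.1 = j),
      (ul (gam q + 0) * ul (-gam q - hbF m + 0)) := by
  rw [← Finset.prod_mul_distrib, prod_filter_node, Fintype.prod_prod_type]
  refine Finset.prod_congr rfl fun k _ => ?_
  rw [Fintype.prod_bool, upow_sq_sub_C, upow_sq_sub_C]
  have h1 : npol j (k, true) = gam ⟨j, k⟩ := by simp [npol, nsv, pol, sv, cen]
  have h2 : npol j (k, false) = -gam ⟨j, k⟩ - hbF m := by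
    simp [npol, nsv, pol, sv, cen]; ring
  rw [h1, h2, add_zero, add_zero, cen, show gam (⟨j, k⟩ : Idx m) + hbF m / 2 + hbF m / 2 =
    -(-gam ⟨j, k⟩ - hbF m) by ring, show -(gam (⟨j, k⟩ : Idx m) + hbF m / 2) + hbF m / 2 =
    -gam ⟨j, k⟩ by ring]
  simp only [ul]
  ring

/-- The quotient h_{j+1}(u) / h_j(u - ħ/2) telescopes: of the R's only R_j(u) survives, and the half
shift turns the old denominator into ∏ (u² - c²) over the previous node. The old numerator and the
new denominator at node j combine into (u² - γ²)(u² - (γ + ħ)²), the product over the squares of the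
poles. -/
theorem hOff_succ_eq (j : Fin N) :
    hOff lam r 0 j.succ = hOff lam r (hbF m / 2) j.castSucc * zLau r j (adjIdx j) := by
  have hA : ul ((((j.succ : Fin (N + 1)) : ℕ) : Fld m) / 2 * hbF m + 0) =
      ul ((((j.castSucc : Fin (N + 1)) : ℕ) : Fld m) / 2 * hbF m + hbF m / 2) := by
    refine congrArg ul ?_
    rw [Fin.val_succ, Fin.val_castSucc]; push_cast; ring
  have hf : Finset.univ.filter (fun i : Fin N => (i : ℕ) < (j.succ : Fin (N + 1))) =
      insert j (Finset.univ.filter (fun i : Fin N => (i : ℕ) < (j.castSucc : Fin (N + 1)))) := by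
    ext i
    simp only [Finset.mem_filter, Finset.mem_univ, true_and, Finset.mem_insert, Fin.val_succ,
      Fin.val_castSucc, Fin.ext_iff]
    omega
  have hR : (∏ i ∈ Finset.univ.filter fun i : Fin N => (i : ℕ) < (j.succ : Fin (N + 1)), ∏ k,
      (ul (((((j.succ : Fin (N + 1)) : ℕ) : Fld m) - 1 - ((i : ℕ) : Fld m)) / 2 * hbF m +
          cpx (r i k) + 0) *
       ul (((((j.succ : Fin (N + 1)) : ℕ) : Fld m) - 1 - ((i : ℕ) : Fld m)) / 2 * hbF m -
          cpx (r i k) + 0))) = (∏ k, (ul (cpx (r j k)) * ul (-cpx (r j k)))) *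
      ∏ i ∈ Finset.univ.filter fun i : Fin N => (i : ℕ) < (j.castSucc : Fin (N + 1)), ∏ k,
      (ul (((((j.castSucc : Fin (N + 1)) : ℕ) : Fld m) - 1 - ((i : ℕ) : Fld m)) / 2 * hbF m +
          cpx (r i k) + hbF m / 2) *
       ul (((((j.castSucc : Fin (N + 1)) : ℕ) : Fld m) - 1 - ((i : ℕ) : Fld m)) / 2 * hbF m -
          cpx (r i k) + hbF m / 2)) := by
    rw [hf, Finset.prod_insert (by simp)]
    refine congrArg₂ (· * ·) ?_ ?_
    · refine Finset.prod_congr rfl fun k _ => ?_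
      rw [Fin.val_succ]
      refine congrArg₂ (· * ·) (congrArg ul ?_) (congrArg ul ?_) <;> push_cast <;> ring
    · refine Finset.prod_congr rfl fun i _ => Finset.prod_congr rfl fun k _ => ?_
      rw [Fin.val_succ, Fin.val_castSucc]
      refine congrArg₂ (· * ·) (congrArg ul ?_) (congrArg ul ?_) <;> push_cast <;> ring
  have hQ : ∏ q ∈ Finset.univ.filter (fun q : Idx m => (q.1 : ℕ) = (j.succ : Fin (N + 1))),
      (ul (cen q + 0) * ul (-cen q + 0)) = ∏ q ∈ nextIdx j, (ul (cen q) * ul (-cen q)) := by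
    simp only [add_zero]; rfl
  have hD : ∏ q ∈ Finset.univ.filter (fun q : Idx m => (q.1 : ℕ) + 1 =
      (j.castSucc : Fin (N + 1))), (ul (gam q + hbF m / 2) * ul (-gam q - hbF m + hbF m / 2)) =
      ∏ q ∈ prevIdx j, (ul (cen q) * ul (-cen q)) := by
    refine Finset.prod_congr rfl fun q _ => ?_
    rw [cen]
    refine congrArg₂ (· * ·) rfl (congrArg ul ?_)
    ring
  have hf1 : Finset.univ.filter (fun q : Idx m => (q.1 : ℕ) = (j.castSucc : Fin (N + 1))) =
      Finset.univ.filter (fun q : Idx m => q.1 = j) := by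
    ext q; simp [Fin.ext_iff]
  have hf2 : Finset.univ.filter (fun q : Idx m => (q.1 : ℕ) + 1 = (j.succ : Fin (N + 1))) =
      Finset.univ.filter (fun q : Idx m => q.1 = j) := by
    ext q; simp [Fin.ext_iff]
  have hP : ∏ q ∈ prevIdx j, (ul (cen q) * ul (-cen (m := m) q)) ≠ 0 :=
    Finset.prod_ne_zero_iff.2 fun q _ => mul_ne_zero (ul_ne_zero _) (ul_ne_zero _)
  have hne := prod_npol_ne_zero (m := m) j
  rw [prod_npol_eq] at hne
  obtain ⟨n1, n2⟩ := mul_ne_zero_iff.1 hne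
  rw [hOff, hOff, hR, hQ, hD, hf1, hf2, hA, zLau, eval₂_zNum, prod_npol_eq, adjIdx,
    Finset.prod_union (disjoint_nextIdx_prevIdx j)]
  generalize ∏ q ∈ prevIdx j, (ul (cen q) * ul (-cen (m := m) q)) = a1 at *
  generalize ∏ q ∈ nextIdx j, (ul (cen q) * ul (-cen (m := m) q)) = a2 at *
  generalize ∏ q ∈ Finset.univ.filter (fun q : Idx m => q.1 = j),
    (ul (gam q + 0) * ul (-gam q - hbF m + 0)) = a3 at *
  generalize ∏ q ∈ Finset.univ.filter (fun q : Idx m => q.1 = j),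
    (ul (cen q + hbF m / 2) * ul (-cen q + hbF m / 2)) = a4 at *
  generalize ∏ k, (ul (cpx (r j k)) * ul (-cpx (m := m) (r j k))) = a5 at *
  generalize ul ((((j.castSucc : Fin (N + 1)) : ℕ) : Fld m) / 2 * hbF m + hbF m / 2)
    ^ (-2 * lam 0) = a6 at *
  generalize (∏ i ∈ Finset.univ.filter fun i : Fin N => (i : ℕ) < (j.castSucc : Fin (N + 1)), ∏ k,
      (ul (((((j.castSucc : Fin (N + 1)) : ℕ) : Fld m) - 1 - ((i : ℕ) : Fld m)) / 2 * hbF m +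
          cpx (r i k) + hbF m / 2) *
       ul (((((j.castSucc : Fin (N + 1)) : ℕ) : Fld m) - 1 - ((i : ℕ) : Fld m)) / 2 * hbF m -
          cpx (r i k) + hbF m / 2))) = a7 at *
  field_simp

theorem zLau_insert (j : Fin N) {S : Finset (Idx m)} {q : Idx m} (hq : q ∈ S) :
    zLau r j S = zLau r j (S.erase q) * (upow 1 ^ 2 - HahnSeries.C (cen q ^ 2)) := by
  rw [zLau, zLau, eval₂_zNum, eval₂_zNum, ← Finset.mul_prod_erase S _ hq, upow_sq_sub_C]
  simp only [ul]
  ring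

theorem slau_zLau (j : Fin N) {S : Finset (Idx m)} (s : SIdx m) (hj : s.1.1 ≠ j)
    (hS : s.1 ∉ S) : slau s (zLau r j S) = zLau r j S := by
  have hk : ∀ κ : Fin (m j) × Bool, (nsv j κ).1 ≠ s.1 := fun κ e => hj (by rw [← e]; rfl)
  have h1 : slau s (∏ q ∈ S, (ul (cen q) * ul (-cen q))) =
      ∏ q ∈ S, (ul (cen q) * ul (-cen q)) :=
    slau_prod_of_forall s fun q hq => by
      rw [map_mul, slau_ul, slau_ul, map_neg, strans_cen_of_ne]
      rintro rfl; exact hS hq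
  rw [zLau, map_div₀, eval₂_zNum, map_mul, h1, map_prod, map_prod]
  simp only [map_mul, slau_ul, map_neg, strans_cpx, map_sub, map_pow, slau_upow, slau_C, npol,
    strans_pol_of_ne (hk _)]

/-- An adjacent variable enters only through its factor u² - w². Erasing it from `S` isolates the
part of z_j(u) that commutes with the shift. -/
theorem slau_zLau_of_mem (j : Fin N) {S : Finset (Idx m)} (s : SIdx m) (hj : s.1.1 ≠ j)
    (hS : s.1 ∈ S) : slau s (zLau r j S) = zLau r j (S.erase s.1) *
      (upow 1 ^ 2 - HahnSeries.C ((sv s - hbF m) ^ 2)) := by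
  rw [zLau_insert r j hS, map_mul, slau_zLau r j s hj (by simp)]
  congr 1
  have : cen s.1 ^ 2 = sv s ^ 2 := by rw [cen_eq]; split_ifs <;> ring
  rw [this, map_sub, map_pow, slau_upow, slau_C, map_pow, strans_sv_self]

/-- The residue at `u² = y²` of `z_j(u)`, for `y` the pole `κ`. -/
def zRes (j : Fin N) (S : Finset (Idx m)) (κ : Fin (m j) × Bool) : Fld m :=
  sqRes (npol j) (zNum r j S) κ

theorem zRes_insert (j : Fin N) {S : Finset (Idx m)} {s : SIdx m} (hs : s.1 ∈ S)
    (κ : Fin (m j) × Bool) :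
    zRes r j S κ = zRes r j (S.erase s.1) κ * (npol j κ ^ 2 - sv s ^ 2) := by
  have : cen s.1 ^ 2 = sv s ^ 2 := by rw [cen_eq]; split_ifs <;> ring
  rw [zRes, sqRes, zNum, ← Finset.mul_prod_erase S _ hs, zRes, sqRes, zNum, ← this]
  simp only [Polynomial.eval_mul, Polynomial.eval_sub, Polynomial.eval_X, Polynomial.eval_C]
  ring

/-- The signed variables at a node other than κ are its opposite and, for each other variable, both
signs. -/
theorem prod_erase_node (j : Fin N) (κ : Fin (m j) × Bool) (g : SIdx m → Fld m) :
    ∏ κ' ∈ Finset.univ.erase κ, g (nsv j κ') = g (sneg (nsv j κ)) *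
      ∏ q ∈ otherIdx (nsv j κ).1, (g (q, true) * g (q, false)) := by
  obtain ⟨k, b⟩ := κ
  have h1 : (Finset.univ.erase (k, b) : Finset (Fin (m j) × Bool)) =
      insert (k, !b) ((Finset.univ.erase k) ×ˢ Finset.univ) := by
    ext ⟨k', b'⟩
    simp only [Finset.mem_erase, Finset.mem_univ, and_true, Finset.mem_insert,
      Finset.mem_product, ne_eq, Prod.mk.injEq]
    cases b <;> cases b' <;> simp <;> tauto
  have h2 : otherIdx (nsv j (k, b)).1 =
      (Finset.univ.erase k).map (Function.Embedding.sigmaMk (β := fun j => Fin (m j)) j) := by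
    ext ⟨i, l⟩
    simp only [mem_otherIdx, nsv, Finset.mem_map, Finset.mem_erase, Finset.mem_univ, and_true,
      Function.Embedding.sigmaMk_apply]
    constructor
    · rintro ⟨h, h'⟩
      subst h
      exact ⟨l, fun e => h' (by rw [e]), rfl⟩
    · rintro ⟨a, ha, h⟩
      obtain ⟨rfl, h'⟩ := Sigma.mk.inj h
      cases h'
      exact ⟨rfl, fun e => ha (by simpa using e)⟩
  rw [h1, Finset.prod_insert (by simp), Finset.prod_product, h2, Finset.prod_map]
  congr 1
  refine Finset.prod_congr rfl fun l _ => ?_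
  rw [Fintype.prod_bool]
  rfl

/-- This is where ϰ ϰ' and z_j(u) meet. In the residue the opposite pole contributes a² - (a⁻)² =
-2ħ w, while 2a - ħ = 2(w - ħ) cancels the same factor in the denominator 4 w (w - ħ) of ϰ ϰ'. -/
theorem kprod_eq (j : Fin N) (κ : Fin (m j) × Bool) :
    (2 * npol j κ - hbF m) * kprod r (nsv j κ) = -(hbF m * zRes r j (adjIdx j) κ) := by
  set s := nsv j κ with hs
  have hj : s.1.1 = j := rfl
  have e1 : (zNum r j (adjIdx j)).eval (npol j κ ^ 2) = Rpoly r j (pol s) *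
      (∏ q ∈ nextIdx j, (pol s ^ 2 - cen q ^ 2)) * ∏ q ∈ prevIdx j, (pol s ^ 2 - cen q ^ 2) := by
    rw [zNum, adjIdx, Finset.prod_union (disjoint_nextIdx_prevIdx j), Polynomial.eval_mul,
      Polynomial.eval_mul, Polynomial.eval_prod, Polynomial.eval_prod, Polynomial.eval_prod,
      ← mul_assoc]
    simp only [Polynomial.eval_sub, Polynomial.eval_X, Polynomial.eval_C]
    rfl
  have e2 : ∏ κ' ∈ Finset.univ.erase κ, (npol j κ ^ 2 - npol j κ' ^ 2) =
      (-2 * hbF m * sv s) * ∏ q ∈ otherIdx s.1,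
      ((sv s - cen q) * (sv s + cen q - hbF m) * ((sv s + cen q) * (sv s - cen q - hbF m))) := by
    have := prod_erase_node j κ fun t => pol s ^ 2 - pol t ^ 2
    refine Eq.trans this ?_
    congr 1
    · rw [pol_sneg, pol]; ring
    · refine Finset.prod_congr rfl fun q _ => ?_
      simp only [pol, sv_mk_true]
      have : sv ((q, false) : SIdx m) = -cen q := by simp [sv]
      rw [this]; ring
  have n1 := sv_ne_zero s
  have n2 := sv_sub_hbF_ne_zero s
  have n3 : hbF m ≠ 0 := hbF_ne_zero
  have n4 : ∏ q ∈ otherIdx s.1, ((sv s - cen q) * (sv s + cen q - hbF m) *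
      ((sv s + cen q) * (sv s - cen q - hbF m))) ≠ 0 := by
    refine Finset.prod_ne_zero_iff.2 fun q hq => ?_
    have h := (mem_otherIdx.1 hq).2
    have a1 := sv_sub_cen_add_ne_zero h 0
    have a2 := sv_add_cen_add_ne_zero h (-1)
    have a3 := sv_add_cen_add_ne_zero h 0
    have a4 := sv_sub_cen_add_ne_zero h (-1)
    push_cast at a1 a2 a3 a4
    convert mul_ne_zero (mul_ne_zero a1 a2) (mul_ne_zero a3 a4) using 1
    ring
  rw [zRes, sqRes, e1, e2, kprod, hj]
  have h3 : npol j κ = sv s - hbF m / 2 := rfl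
  rw [h3]
  generalize ∏ q ∈ otherIdx s.1, ((sv s - cen q) * (sv s + cen q - hbF m) *
      ((sv s + cen q) * (sv s - cen q - hbF m))) = a1 at *
  generalize ∏ q ∈ nextIdx j, (pol s ^ 2 - cen q ^ 2) = a2 at *
  generalize ∏ q ∈ prevIdx j, (pol s ^ 2 - cen q ^ 2) = a3 at *
  generalize Rpoly r j (pol s) = a4 at *
  field_simp
  ring

end ZSeries

/-- The substitution `u ↦ -u`. -/
def negLau (F : Type*) [Field F] : LaurentSeries F →+* LaurentSeries F :=
  IsFractionRing.lift (A := PowerSeries F) (g := lau.comp (PowerSeries.rescale (-1 : F)))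
    (lau_injective.comp (Function.LeftInverse.injective (g := PowerSeries.rescale (-1 : F))
      fun f => by rw [PowerSeries.rescale_rescale]; simp))

section NegLau

variable {F : Type*} [Field F]

theorem negLau_lau (φ : PowerSeries F) :
    negLau F (lau φ) = lau (PowerSeries.rescale (-1) φ) :=
  IsFractionRing.lift_algebraMap _ φ

theorem negLau_C (a : F) : negLau F (HahnSeries.C a) = HahnSeries.C a := by
  rw [← lau_C, negLau_lau]
  congr 1
  ext d
  rw [PowerSeries.coeff_rescale, PowerSeries.coeff_C]
  split_ifs with h <;> simp [h]

theorem negLau_upow_one : negLau F (upow 1) = -upow 1 := by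
  have h : negLau F (upow (-1)) = -upow (-1) := by
    rw [← lau_X, negLau_lau, PowerSeries.rescale_X]
    simp
  rw [show (1 : ℤ) = -(-1) by norm_num, upow_neg, map_inv₀, h, inv_neg]

theorem negLau_upow_natCast_of_even {k : ℕ} (hk : Even k) :
    negLau F (upow (k : ℤ)) = upow (k : ℤ) := by
  rw [upow_natCast, map_pow, negLau_upow_one, hk.neg_pow]

end NegLau

/-! ### Power series images of h_i, h̃_i and z_j -/

section PowerSeriesImages

variable {N : ℕ} {m : Fin N → ℕ} {lam : Fin (N + 1) → ℤ} {ℓ : Fin N → ℕ}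
  (r : (j : Fin N) → Fin (ℓ j) → ℂ) (μ : Fin (N + 1) → ℤ)

variable (m lam) in
/-- The image of `u^{2 ε_i(μ)} h_i(u)`. -/
def hPS (i : Fin (N + 1)) : PowerSeries (Fld m) :=
  PowerSeries.mk fun d => (hOff lam r 0 i).coeff (d - -2 * μ i)

variable (m lam) in
/-- The image of `u^{-2 ε_i(μ)} h̃_i(u)`. -/
def htPS (i : Fin (N + 1)) : PowerSeries (Fld m) :=
  PowerSeries.mk fun d => (hOff lam r 0 i)⁻¹.coeff (d - 2 * μ i)

theorem IsMonicSer.eq_mk {F : Type*} [Field F] [Algebra ℂ[X] F] {S : Subalgebra ℂ[X] F} {e : ℤ}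
    {f : LaurentSeries F} (h : IsMonicSer S e f) :
    f = upow e * lau (PowerSeries.mk fun d => f.coeff (d - e)) := by
  obtain ⟨φ, -, rfl⟩ := h
  congr 2
  ext d
  rw [PowerSeries.coeff_mk, coeff_upow_mul_lau]

theorem IsMonicSer.coeff_mem {F : Type*} [Field F] [Algebra ℂ[X] F] {S : Subalgebra ℂ[X] F}
    {e : ℤ} {f : LaurentSeries F} (h : IsMonicSer S e f) (d : ℕ) : f.coeff (d - e) ∈ S := by
  obtain ⟨φ, -, rfl⟩ := h
  rw [coeff_upow_mul_lau, PowerSeries.coeff_map]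
  exact (PowerSeries.coeff d φ).2

theorem IsMonicSer.coeff_zero {F : Type*} [Field F] [Algebra ℂ[X] F] {S : Subalgebra ℂ[X] F}
    {e : ℤ} {f : LaurentSeries F} (h : IsMonicSer S e f) : f.coeff ((0 : ℕ) - e) = 1 := by
  obtain ⟨φ, h1, rfl⟩ := h
  rw [coeff_upow_mul_lau, PowerSeries.coeff_map, PowerSeries.coeff_zero_eq_constantCoeff_apply, h1]
  exact map_one _

section

variable {μ} (hm : lam - μ = ∑ j, (m j : ℤ) • simpleCoroot j)
  (hℓ : ∀ j, (ℓ j : ℤ) = rootPairing lam j)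
include hm hℓ

theorem isMonicSer_inv_hOff (i : Fin (N + 1)) :
    IsMonicSer (polySub m) (2 * μ i) (hOff (m := m) lam r 0 i)⁻¹ := by
  have := (isMonicSer_hOff r hm hℓ i).inv
  rwa [neg_mul, neg_neg] at this

theorem hOff_eq (i : Fin (N + 1)) :
    hOff lam r 0 i = upow (-2 * μ i) * lau (hPS m lam r μ i) :=
  (isMonicSer_hOff r hm hℓ i).eq_mk

theorem inv_hOff_eq (i : Fin (N + 1)) :
    (hOff lam r 0 i)⁻¹ = upow (2 * μ i) * lau (htPS m lam r μ i) :=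
  (isMonicSer_inv_hOff r hm hℓ i).eq_mk

theorem coeff_zero_hPS (i : Fin (N + 1)) : PowerSeries.coeff 0 (hPS m lam r μ i) = 1 := by
  rw [hPS, PowerSeries.coeff_mk]
  exact (isMonicSer_hOff r hm hℓ i).coeff_zero

theorem coeff_zero_htPS (i : Fin (N + 1)) : PowerSeries.coeff 0 (htPS m lam r μ i) = 1 := by
  rw [htPS, PowerSeries.coeff_mk]
  exact (isMonicSer_inv_hOff r hm hℓ i).coeff_zero

theorem coeff_hPS_mem (i : Fin (N + 1)) (d : ℕ) :
    PowerSeries.coeff d (hPS m lam r μ i) ∈ polySub m := by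
  rw [hPS, PowerSeries.coeff_mk]
  exact (isMonicSer_hOff r hm hℓ i).coeff_mem d

theorem coeff_htPS_mem (i : Fin (N + 1)) (d : ℕ) :
    PowerSeries.coeff d (htPS m lam r μ i) ∈ polySub m := by
  rw [htPS, PowerSeries.coeff_mk]
  exact (isMonicSer_inv_hOff r hm hℓ i).coeff_mem d

theorem hPS_mul_htPS (i : Fin (N + 1)) : hPS m lam r μ i * htPS m lam r μ i = 1 := by
  apply lau_injective
  have h := mul_inv_cancel₀ (isMonicSer_hOff r hm hℓ i).ne_zero
  rw [inv_hOff_eq r hm hℓ] at h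
  nth_rewrite 1 [hOff_eq r hm hℓ] at h
  rw [mul_mul_mul_comm, ← upow_add, neg_mul, neg_add_cancel, upow_zero, one_mul] at h
  rw [map_mul, h, map_one]

end

variable (m lam) in
/-- The image of `u^{-2 α_j(μ)} z_j(u)`. -/
def zPS (j : Fin N) : PowerSeries (Fld m) :=
  shiftSeries (2 * μ j.castSucc) (chb (-1 / 2)) (htPS m lam r μ j.castSucc) * hPS m lam r μ j.succ

theorem algebraMap_chb (c : ℂ) : algebraMap ℂ[X] (Fld m) (chb c) = cpx c * hbF m := by
  rw [chb, map_mul]; rfl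

theorem algebraMap_chb_half : algebraMap ℂ[X] (Fld m) (chb (1 / 2)) = hbF m / 2 := by
  rw [algebraMap_chb]
  have := cpx_ratCast (m := m) (1 / 2)
  push_cast at this
  rw [this]
  ring

theorem algebraMap_chb_neg_half : algebraMap ℂ[X] (Fld m) (chb (-1 / 2)) = -(hbF m / 2) := by
  rw [algebraMap_chb]
  have := cpx_ratCast (m := m) (-1 / 2)
  push_cast at this
  rw [this]
  ring

/-- `hOff_succ_eq` in power series form, h̃_j(u - ħ/2) being the inverse of h_j(u - ħ/2). Dominance
of μ makes the exponent 2α_j(μ) a natural number, so that `toNat` loses nothing. -/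
theorem upow_mul_lau_zPS {μ : Fin (N + 1) → ℤ} (hm : lam - μ = ∑ j, (m j : ℤ) • simpleCoroot j)
    (hℓ : ∀ j, (ℓ j : ℤ) = rootPairing lam j) (hμ : IsDominantCoweight μ) (j : Fin N) :
    upow ((2 * rootPairing μ j).toNat : ℤ) * lau (zPS m lam r μ j) = zLau r j (adjIdx j) := by
  have h1 := (isShift_hOff (m := m) lam r 0 (hbF m / 2) (chb (-1 / 2))
    (by rw [algebraMap_chb_neg_half]; ring) j.castSucc).inv (isMonicSer_hOff r hm hℓ _).ne_zero
  rw [inv_hOff_eq r hm hℓ] at h1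
  have h2 := h1.eq_of_upow
  have h3 : hOff (m := m) lam r (hbF m / 2) j.castSucc ≠ 0 := fun h => by
    have h4 := hOff_succ_eq (m := m) (lam := lam) r j
    rw [h, zero_mul] at h4
    exact (isMonicSer_hOff (m := m) r hm hℓ _).ne_zero h4
  have h5 : ((2 * rootPairing μ j).toNat : ℤ) = 2 * μ j.castSucc + -2 * μ j.succ := by
    rw [Int.toNat_of_nonneg (mul_nonneg zero_le_two (hμ.2 j)), rootPairing]; ring
  rw [h5, upow_add, zPS, map_mul, mul_mul_mul_comm, ← h2, ← hOff_eq r hm hℓ, hOff_succ_eq,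
    inv_mul_cancel_left₀ h3]

/-- The rational function depends only on u² and the prefactor is an even power of u; the
substitution u ↦ -u therefore fixes both. -/
theorem negSeries_zPS {μ : Fin (N + 1) → ℤ} (hm : lam - μ = ∑ j, (m j : ℤ) • simpleCoroot j)
    (hℓ : ∀ j, (ℓ j : ℤ) = rootPairing lam j) (hμ : IsDominantCoweight μ) (j : Fin N) :
    negSeries (zPS m lam r μ j) = zPS m lam r μ j := by
  have h := congrArg (negLau (Fld m)) (upow_mul_lau_zPS r hm hℓ hμ j)
  have hk : Even (2 * rootPairing μ j).toNat := by
    rw [Int.toNat_mul (by norm_num) (hμ.2 j)]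
    exact even_two_mul _
  have h2 : negLau (Fld m) (upow 1 ^ 2) = upow 1 ^ 2 := by
    rw [map_pow, negLau_upow_one, neg_sq]
  rw [map_mul, negLau_upow_natCast_of_even hk, negLau_lau, zLau, map_div₀, map_prod,
    Polynomial.hom_eval₂, h2, RingHom.ext (f := (negLau (Fld m)).comp HahnSeries.C)
      (g := HahnSeries.C) negLau_C] at h
  simp only [map_sub, h2, negLau_C] at h
  rw [negSeries_eq_rescale]
  apply lau_injective
  exact mul_left_cancel₀ (upow_ne_zero _) (h.trans (upow_mul_lau_zPS r hm hℓ hμ j).symm)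

theorem two_mul_npol_ne_zero (j : Fin N) (κ : Fin (m j) × Bool) : 2 * npol j κ ≠ 0 :=
  mul_ne_zero two_ne_zero (pol_ne_zero _)

theorem principal_zPS {μ : Fin (N + 1) → ℤ} (hm : lam - μ = ∑ j, (m j : ℤ) • simpleCoroot j)
    (hℓ : ∀ j, (ℓ j : ℤ) = rootPairing lam j) (hμ : IsDominantCoweight μ) (j : Fin N) :
    principal (2 * rootPairing μ j).toNat (zPS m lam r μ j) =
      ∑ κ, PowerSeries.C (zRes r j (adjIdx j) κ / (2 * npol j κ)) *
        (poleSer (npol j κ) - poleSer (-npol j κ)) := by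
  refine principal_of_even (npol_sq_ne j) (two_mul_npol_ne_zero j) _ _ _ ?_
  rw [upow_mul_lau_zPS r hm hℓ hμ, zLau_mul_prod]

/-- The automorphism `strans s` applied to the coefficients of a series. -/
def spow (s : SIdx m) : PowerSeries (Fld m) →+* PowerSeries (Fld m) :=
  PowerSeries.map ((strans s : Fld m →ₐ[ℂ[X]] Fld m) : Fld m →+* Fld m)

theorem lau_spow (s : SIdx m) (φ : PowerSeries (Fld m)) : lau (spow s φ) = slau s (lau φ) :=
  (slau_lau s φ).symm

theorem spow_poleSer (s : SIdx m) (a : Fld m) :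
    spow s (poleSer a) = poleSer (strans s a) := map_poleSer _ _

theorem spow_principal (s : SIdx m) (k : ℕ) (φ : PowerSeries (Fld m)) :
    spow s (principal k φ) = principal k (spow s φ) := by
  ext d
  simp only [spow, principal, PowerSeries.coeff_map, PowerSeries.coeff_mk]
  split_ifs
  · exact map_zero _
  · rfl

theorem lau_one_add_pole (c a : Fld m) :
    lau (1 + PowerSeries.C c * poleSer a) * ul a = ul (a - c) := by
  have h : lau (poleSer a) * ul a = 1 := by
    rw [← inv_upow_one_sub_C]; exact inv_mul_cancel₀ (ul_ne_zero a)
  rw [map_add, map_one, map_mul, lau_C, add_mul, mul_assoc, h, ul, ul, map_sub]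
  ring

section

variable {μ} (hm : lam - μ = ∑ j, (m j : ℤ) • simpleCoroot j)
  (hℓ : ∀ j, (ℓ j : ℤ) = rootPairing lam j)
include hm hℓ

theorem spow_hPS_far (s : SIdx m) (i : Fin (N + 1)) (h1 : (s.1.1 : ℕ) ≠ i)
    (h2 : (s.1.1 : ℕ) + 1 ≠ i) : spow s (hPS m lam r μ i) = hPS m lam r μ i := by
  apply lau_injective
  apply mul_left_cancel₀ (upow_ne_zero (-2 * μ i))
  have h := slau_hOff_far (lam := lam) r s i h1 h2
  rw [hOff_eq r hm hℓ, map_mul, slau_upow] at h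
  rw [lau_spow, h]

/-- Each bracket is a quotient of linear factors, 1 - ħ/(u - w + ħ) = (u - w)/(u - w + ħ), so the
lemma is `slau_hOff_same` written with the poles that occur in the relation of h and b. -/
theorem spow_hPS_same (s : SIdx m) (i : Fin (N + 1)) (h : (s.1.1 : ℕ) = i) :
    spow s (hPS m lam r μ i) * (1 - PowerSeries.C (hbF m) * poleSer (sv s - hbF m)) =
      hPS m lam r μ i * (1 - PowerSeries.C (hbF m) * poleSer (-sv s)) := by
  have h0 := slau_hOff_same (lam := lam) r s i h
  rw [hOff_eq r hm hℓ, map_mul, slau_upow] at h0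
  apply lau_injective
  apply mul_left_cancel₀ (upow_ne_zero (-2 * μ i))
  apply mul_right_cancel₀ (mul_ne_zero (ul_ne_zero (sv s - hbF m)) (ul_ne_zero (-sv s)))
  have e1 := lau_one_add_pole (-hbF m) (sv s - hbF m)
  have e2 := lau_one_add_pole (-hbF m) (-sv s)
  rw [map_neg, neg_mul, ← sub_eq_add_neg] at e1 e2
  rw [show sv s - hbF m - -hbF m = sv s by ring] at e1
  rw [show -sv s - -hbF m = -(sv s - hbF m) by ring] at e2
  rw [map_mul, map_mul, lau_spow]
  calc _ = upow (-2 * μ i) * slau s (lau (hPS m lam r μ i)) *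
        ((lau (1 - PowerSeries.C (hbF m) * poleSer (sv s - hbF m)) * ul (sv s - hbF m)) *
        ul (-sv s)) := by ring
    _ = _ := by rw [e1, h0, ← e2]; ring

theorem spow_hPS_succ (s : SIdx m) (i : Fin (N + 1)) (h : (s.1.1 : ℕ) + 1 = i) :
    spow s (hPS m lam r μ i) * (1 + PowerSeries.C (hbF m) * poleSer (pol s)) =
      hPS m lam r μ i * (1 + PowerSeries.C (hbF m) * poleSer (-pol s)) := by
  have h0 := slau_hOff_succ (lam := lam) r s i h
  rw [hOff_eq r hm hℓ, map_mul, slau_upow] at h0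
  apply lau_injective
  apply mul_left_cancel₀ (upow_ne_zero (-2 * μ i))
  apply mul_right_cancel₀ (mul_ne_zero (ul_ne_zero (pol s)) (ul_ne_zero (-pol s)))
  have e1 := lau_one_add_pole (hbF m) (pol s)
  have e2 := lau_one_add_pole (hbF m) (-pol s)
  rw [map_mul, map_mul, lau_spow]
  calc _ = upow (-2 * μ i) * slau s (lau (hPS m lam r μ i)) *
        ((lau (1 + PowerSeries.C (hbF m) * poleSer (pol s)) * ul (pol s)) *
        ul (-pol s)) := by ring
    _ = _ := by rw [e1, h0, ← e2]; ring

end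

theorem evenGeom_mul : (evenGeom : PowerSeries (Fld m)) *
    (1 - PowerSeries.C (hbF m ^ 2 / 4) * PowerSeries.X ^ 2) = 1 := by
  ext d
  have hq : PowerSeries.coeff d ((evenGeom : PowerSeries (Fld m)) *
      (1 - PowerSeries.C (hbF m ^ 2 / 4) * PowerSeries.X ^ 2)) =
      PowerSeries.coeff d (evenGeom : PowerSeries (Fld m)) - (hbF m ^ 2 / 4) *
      PowerSeries.coeff d ((evenGeom : PowerSeries (Fld m)) * PowerSeries.X ^ 2) := by
    rw [mul_sub, mul_one, map_sub, mul_left_comm, PowerSeries.coeff_C_mul]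
  rw [hq, PowerSeries.coeff_mul_X_pow']
  simp only [evenGeom, PowerSeries.coeff_mk, map_pow, algebraMap_chb_half, PowerSeries.coeff_one]
  obtain _ | _ | d := d
  · simp
  · simp
  · have h3 : Even (d + 1 + 1) ↔ Even d := by
      rw [Nat.even_add_one, Nat.even_add_one, not_not]
    simp only [h3, le_add_iff_nonneg_left, zero_le, if_true]
    rw [if_neg (Nat.succ_ne_zero _)]
    by_cases h : Even d
    · rw [if_pos h, show d + 1 + 1 - 2 = d from rfl, if_pos h]; ring
    · rw [if_neg h, show d + 1 + 1 - 2 = d from rfl, if_neg h]; ring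

theorem spow_evenGeom (s : SIdx m) : spow s evenGeom = evenGeom := by
  ext d
  simp only [spow, evenGeom, PowerSeries.coeff_map, PowerSeries.coeff_mk]
  split_ifs
  · exact (strans s).commutes _
  · exact map_zero _

variable (m lam) in
/-- The image of the principal part of `4 u z_j(u) / (4 u² - ħ²)`. -/
def wPS (j : Fin N) : PowerSeries (Fld m) :=
  principal (2 * rootPairing μ j).toNat (PowerSeries.X * (evenGeom * zPS m lam r μ j))

theorem principal_add {F : Type*} [CommRing F] (k : ℕ) (φ ψ : PowerSeries F) :
    principal k (φ + ψ) = principal k φ + principal k ψ := by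
  ext d
  simp only [principal, map_add, PowerSeries.coeff_mk]
  split_ifs <;> simp

theorem principal_C_mul {F : Type*} [CommRing F] (k : ℕ) (a : F) (φ : PowerSeries F) :
    principal k (PowerSeries.C a * φ) = PowerSeries.C a * principal k φ := by
  ext d
  simp only [principal, PowerSeries.coeff_C_mul, PowerSeries.coeff_mk]
  split_ifs <;> simp

/-- Up to the common part W of z_j(u), the bracket is u/(u² - ħ²/4) times a combination of u² - w²
and u² - (w - ħ)². That combination is a multiple of u² - ħ²/4, so no pole at u = ±ħ/2 survives and
the result is u W times a constant, whose principal part is given by `principal_of_odd`. -/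
theorem wPS_bracket {μ : Fin (N + 1) → ℤ} (hm : lam - μ = ∑ j, (m j : ℤ) • simpleCoroot j)
    (hℓ : ∀ j, (ℓ j : ℤ) = rootPairing lam j) (hμ : IsDominantCoweight μ) (j : Fin N)
    (s : SIdx m) (hs : s.1 ∈ adjIdx j) :
    PowerSeries.C (hbF m) * (PowerSeries.C (pol s - hbF m) * wPS m lam r μ j -
      PowerSeries.C (pol s + hbF m) * spow s (wPS m lam r μ j)) =
    ∑ κ, PowerSeries.C (-(hbF m ^ 2 * zRes r j ((adjIdx j).erase s.1) κ)) *
      (poleSer (npol j κ) + poleSer (-npol j κ)) := by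
  set Z := zPS m lam r μ j with hZ
  set k := (2 * rootPairing μ j).toNat with hk
  set E : PowerSeries (Fld m) := evenGeom with hE
  have hj : s.1.1 ≠ j := by
    intro h
    rcases Finset.mem_union.1 hs with h1 | h1
    · have := mem_nextIdx.1 h1; rw [h] at this; omega
    · have := mem_prevIdx.1 h1; rw [h] at this; omega
  have hz := upow_mul_lau_zPS (m := m) r hm hℓ hμ j
  have hz' := congrArg (slau s) hz
  rw [map_mul, slau_upow, ← lau_spow, slau_zLau_of_mem r j s hj hs] at hz'
  rw [zLau_insert r j hs] at hz
  set W := zLau r j ((adjIdx j).erase s.1) with hW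
  have hc : cen s.1 ^ 2 = sv s ^ 2 := by rw [cen_eq]; split_ifs <;> ring
  rw [hc] at hz
  have hL : PowerSeries.C (hbF m) * (PowerSeries.C (pol s - hbF m) * wPS m lam r μ j -
      PowerSeries.C (pol s + hbF m) * spow s (wPS m lam r μ j)) =
      principal k (PowerSeries.X * (E * (PowerSeries.C (hbF m * (pol s - hbF m)) * Z +
        PowerSeries.C (-(hbF m * (pol s + hbF m))) * spow s Z))) := by
    have : PowerSeries.X * (E * (PowerSeries.C (hbF m * (pol s - hbF m)) * Z +
        PowerSeries.C (-(hbF m * (pol s + hbF m))) * spow s Z)) =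
        PowerSeries.C (hbF m * (pol s - hbF m)) * (PowerSeries.X * (E * Z)) +
        PowerSeries.C (-(hbF m * (pol s + hbF m))) * (PowerSeries.X * (E * spow s Z)) := by
      ring
    rw [this, principal_add, principal_C_mul, principal_C_mul, wPS, spow_principal, map_mul,
      map_mul, spow_evenGeom, spow, PowerSeries.map_X, map_neg, map_mul, map_mul]
    ring
  have hEl : upow (-1) * lau E * (upow 1 ^ 2 - HahnSeries.C (hbF m ^ 2 / 4)) = upow 1 := by
    have h1 := congrArg lau (evenGeom_mul (m := m))
    rw [map_mul, map_sub, map_mul, map_one, lau_C, lau_X_pow] at h1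
    have h2 : (upow 1 * upow (-1) : Ser m) = 1 := by rw [← upow_add]; exact upow_zero
    have h3 : (upow (-((2 : ℕ) : ℤ)) : Ser m) = upow (-1) ^ 2 := by
      rw [sq, ← upow_add]; rfl
    rw [h3, ← hE] at h1
    linear_combination (upow 1) * h1 + (lau E * upow 1 +
      lau E * HahnSeries.C (hbF m ^ 2 / 4) * upow (-1)) * h2
  have e2 : (upow 1 ^ 2 - HahnSeries.C (hbF m ^ 2 / 4) : Ser m) ≠ 0 := by
    rw [show hbF m ^ 2 / 4 = (hbF m / 2) ^ 2 by ring]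
    exact upow_sq_sub_C_ne_zero _
  have hodd := principal_of_odd (npol_sq_ne (m := m) j) two_ne_zero
    (Polynomial.C (-2 * hbF m ^ 2) * zNum r j ((adjIdx j).erase s.1)) k
    (PowerSeries.X * (E * (PowerSeries.C (hbF m * (pol s - hbF m)) * Z +
        PowerSeries.C (-(hbF m * (pol s + hbF m))) * spow s Z)))
    (HahnSeries.C (-2 * hbF m ^ 2) * W) ?_ ?_
  · rw [hL, hodd]
    refine Finset.sum_congr rfl fun κ _ => ?_
    congr 2
    rw [zRes, sqRes, sqRes, Polynomial.eval_mul, Polynomial.eval_C]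
    ring
  · apply mul_right_cancel₀ e2
    have hlau : ∀ a b : Fld m, lau (PowerSeries.X * (E * (PowerSeries.C a * Z +
        PowerSeries.C b * spow s Z))) = upow (-1) * (lau E * (HahnSeries.C a * lau Z +
        HahnSeries.C b * lau (spow s Z))) := fun a b => by
      rw [map_mul, map_mul, map_add, map_mul, map_mul, lau_C, lau_C, lau_X]
    rw [hlau]
    have : upow (k : ℤ) * (upow (-1) * (lau E * (HahnSeries.C (hbF m * (pol s - hbF m)) * lau Z +
        HahnSeries.C (-(hbF m * (pol s + hbF m))) * lau (spow s Z)))) *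
        (upow 1 ^ 2 - HahnSeries.C (hbF m ^ 2 / 4)) =
        (upow (-1) * lau E * (upow 1 ^ 2 - HahnSeries.C (hbF m ^ 2 / 4))) *
        (HahnSeries.C (hbF m * (pol s - hbF m)) * (upow (k : ℤ) * lau Z) +
        HahnSeries.C (-(hbF m * (pol s + hbF m))) * (upow (k : ℤ) * lau (spow s Z))) := by ring
    -- What remains is ħ ((w - 3ħ/2)(u² - w²) - (w + ħ/2)(u² - (w - ħ)²)) = -2ħ² (u² - ħ²/4).
    rw [this, hEl, hz, hz', pol]
    have h2 : (2 : Ser m) * HahnSeries.C (hbF m / 2) = HahnSeries.C (hbF m) := by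
      rw [show (2 : Ser m) = HahnSeries.C 2 from (map_ofNat HahnSeries.C 2).symm, ← map_mul]
      congr 1; ring
    rw [show hbF m ^ 2 / 4 = (hbF m / 2) ^ 2 by ring]
    simp only [map_mul, map_sub, map_add, map_neg, map_pow, map_ofNat, ← h2]
    ring
  · rw [mul_assoc, zLau_mul_prod, Polynomial.eval₂_mul, Polynomial.eval₂_C]

theorem zPS_coeff_mem {μ : Fin (N + 1) → ℤ} (hm : lam - μ = ∑ j, (m j : ℤ) • simpleCoroot j)
    (hℓ : ∀ j, (ℓ j : ℤ) = rootPairing lam j) (j : Fin N) (d : ℕ) :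
    PowerSeries.coeff d (zPS m lam r μ j) ∈ polySub m := by
  rw [zPS, PowerSeries.coeff_mul]
  refine sum_mem fun p _ => mul_mem ?_ (coeff_hPS_mem r hm hℓ _ _)
  rw [coeff_shiftSeries]
  refine sum_mem fun k _ => zsmul_mem (Subalgebra.smul_mem _ (coeff_htPS_mem r hm hℓ _ _) _) _

end PowerSeriesImages

/-! ### Functoriality of the defining relations -/

section Functoriality

variable {A B : Type*} [Ring A] [Algebra ℂ[X] A] [Ring B] [Algebra ℂ[X] B] (f : A →ₐ[ℂ[X]] B)

theorem map_shiftSeries (e : ℤ) (c : ℂ[X]) (φ : PowerSeries A) :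
    PowerSeries.map (f : A →+* B) (shiftSeries e c φ) =
      shiftSeries e c (PowerSeries.map (f : A →+* B) φ) := by
  ext d
  simp [shiftSeries]

theorem map_negSeries (φ : PowerSeries A) :
    PowerSeries.map (f : A →+* B) (negSeries φ) = negSeries (PowerSeries.map (f : A →+* B) φ) := by
  ext d
  simp [negSeries]

theorem map_principal (k : ℕ) (φ : PowerSeries A) :
    PowerSeries.map (f : A →+* B) (principal k φ) =
      principal k (PowerSeries.map (f : A →+* B) φ) := by
  ext d
  simp only [principal, PowerSeries.coeff_map, PowerSeries.coeff_mk]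
  split_ifs <;> simp

theorem map_evenGeom : PowerSeries.map (f : A →+* B) evenGeom = evenGeom := by
  ext d
  simp only [evenGeom, PowerSeries.coeff_map, PowerSeries.coeff_mk]
  split_ifs
  · exact f.commutes _
  · exact map_zero _

theorem map_comm {R S : Type*} [Ring R] [Ring S] (h : R →+* S) (a b : R) :
    h (comm a b) = comm (h a) (h b) := by simp [comm]

theorem map_smul_mvPowerSeries (c : ℂ[X]) (φ : MvPowerSeries (Fin 3) A) :
    MvPowerSeries.map (f : A →+* B) (c • φ) = c • MvPowerSeries.map (f : A →+* B) φ := by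
  ext d
  simp

variable {N : ℕ} (μ : Fin (N + 1) → ℤ) (g : Gen N → A)

theorem map_hSer (i : Fin (N + 1)) :
    PowerSeries.map (f : A →+* B) (hSer g i) = hSer (f ∘ g) i := by
  ext d
  simp only [hSer, PowerSeries.coeff_map, PowerSeries.coeff_mk]
  split_ifs <;> simp

theorem map_htSer (i : Fin (N + 1)) :
    PowerSeries.map (f : A →+* B) (htSer g i) = htSer (f ∘ g) i := by
  ext d
  simp only [htSer, PowerSeries.coeff_map, PowerSeries.coeff_mk]
  split_ifs <;> simp

theorem map_bSer (i : Fin N) :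
    PowerSeries.map (f : A →+* B) (bSer g i) = bSer (f ∘ g) i := by
  ext d
  simp only [bSer, PowerSeries.coeff_map, PowerSeries.coeff_mk]
  split_ifs <;> simp

theorem map_zSer (j : Fin N) :
    PowerSeries.map (f : A →+* B) (zSer μ g j) = zSer μ (f ∘ g) j := by
  rw [zSer, map_mul, map_shiftSeries, map_htSer, map_hSer, zSer]

theorem map_zPrin (j : Fin N) :
    PowerSeries.map (f : A →+* B) (zPrin μ g j) = zPrin μ (f ∘ g) j := by
  rw [zPrin, map_principal, map_zSer, zPrin]

theorem map_wPrin (j : Fin N) :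
    PowerSeries.map (f : A →+* B) (wPrin μ g j) = wPrin μ (f ∘ g) j := by
  rw [wPrin, map_principal, map_mul, map_mul, map_zSer, map_evenGeom, PowerSeries.map_X, wPrin]

theorem map_xv (s : Fin 3) : MvPowerSeries.map (f : A →+* B) (xv s) = xv s :=
  MvPowerSeries.map_X _ _

theorem map_relHH (i k : Fin (N + 1)) :
    MvPowerSeries.map (f : A →+* B) (relHH g i k) = relHH (f ∘ g) i k := by
  simp only [relHH, map_comm, ← inVar_map, map_hSer]

theorem map_relHB (i : Fin (N + 1)) (j : Fin N) :
    MvPowerSeries.map (f : A →+* B) (relHB g i j) = relHB (f ∘ g) i j := by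
  simp only [relHB]
  split_ifs <;>
  simp only [map_sub, map_add, map_mul, map_smul_mvPowerSeries, map_comm, ← inVar_map, map_hSer,
    map_bSer, map_xv, map_shiftSeries, map_negSeries]

theorem map_relBBfar (i j : Fin N) :
    MvPowerSeries.map (f : A →+* B) (relBBfar g i j) = relBBfar (f ∘ g) i j := by
  simp only [relBBfar, map_comm, ← inVar_map, map_bSer]

theorem map_relBB (i : Fin N) :
    MvPowerSeries.map (f : A →+* B) (relBB μ g i) = relBB μ (f ∘ g) i := by
  simp only [relBB, map_sub, map_add, map_mul, map_pow, map_smul_mvPowerSeries, map_comm,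
    ← inVar_map, map_zPrin, map_bSer, map_xv]

theorem map_relBBnext (i j : Fin N) :
    MvPowerSeries.map (f : A →+* B) (relBBnext g i j) = relBBnext (f ∘ g) i j := by
  simp only [relBBnext, map_sub, map_add, map_mul, map_neg, map_smul_mvPowerSeries, map_comm,
    ← inVar_map, map_bSer, map_xv, MvPowerSeries.map_C]
  rfl

theorem map_serreRHS (i j : Fin N) (s : Fin 3) :
    MvPowerSeries.map (f : A →+* B) (serreRHS μ g i j s) = serreRHS μ (f ∘ g) i j s := by
  simp only [serreRHS, map_sub, map_add, map_mul, map_smul_mvPowerSeries, ← inVar_map, map_wPrin,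
    map_bSer, map_principal]

theorem map_relSerre (i j : Fin N) :
    MvPowerSeries.map (f : A →+* B) (relSerre μ g i j) = relSerre μ (f ∘ g) i j := by
  simp only [relSerre, map_sub, map_add, map_mul, map_comm, ← inVar_map, map_bSer, map_xv,
    map_serreRHS]

/-- All series in the relations are built functorially from the generators, so relators in the free
algebra may be tested on their images. -/
theorem IsRelator.map {g : Gen N → A} {c : A} (h : IsRelator μ g c) :
    IsRelator μ (f ∘ g) (f c) := by
  have hp : ∀ (φ : PowerSeries A) (ψ : PowerSeries B) (d : ℕ),
      PowerSeries.map (f : A →+* B) φ = ψ → f (PowerSeries.coeff d φ) = PowerSeries.coeff d ψ := by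
    rintro φ ψ d rfl
    rw [PowerSeries.coeff_map]; rfl
  have hq : ∀ (φ : MvPowerSeries (Fin 3) A) (ψ : MvPowerSeries (Fin 3) B) (d : Fin 3 →₀ ℕ),
      MvPowerSeries.map (f : A →+* B) φ = ψ →
        f (MvPowerSeries.coeff d φ) = MvPowerSeries.coeff d ψ := by
    rintro φ ψ d rfl
    rw [MvPowerSeries.coeff_map]; rfl
  cases h with
  | inv_right i d =>
    rw [hp _ (hSer (f ∘ g) i * htSer (f ∘ g) i - 1) d
      (by rw [map_sub, map_mul, map_hSer, map_htSer, map_one])]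
    exact .inv_right i d
  | inv_left i d =>
    rw [hp _ (htSer (f ∘ g) i * hSer (f ∘ g) i - 1) d
      (by rw [map_sub, map_mul, map_hSer, map_htSer, map_one])]
    exact .inv_left i d
  | z_even j d =>
    rw [hp _ (zSer μ (f ∘ g) j - negSeries (zSer μ (f ∘ g) j)) d
      (by rw [map_sub, map_negSeries, map_zSer])]
    exact .z_even j d
  | hh i k d => rw [hq _ _ d (map_relHH f g i k)]; exact .hh i k d
  | hb i j d => rw [hq _ _ d (map_relHB f g i j)]; exact .hb i j d
  | bb_far i j h d => rw [hq _ _ d (map_relBBfar f g i j)]; exact .bb_far i j h d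
  | bb i d => rw [hq _ _ d (map_relBB f μ g i)]; exact .bb i d
  | bb_next i j h d => rw [hq _ _ d (map_relBBnext f g i j)]; exact .bb_next i j h d
  | serre i j h d => rw [hq _ _ d (map_relSerre f μ g i j)]; exact .serre i j h d

/-- A map of the generators to an algebra without `ħ`-torsion extends to the shifted twisted
Yangian if it satisfies the defining relations. -/
theorem lift_eq_of_rel (hB : ∀ b : B, hb • b = 0 → b = 0) (g : Gen N → B)
    (hg : ∀ c, IsRelator μ g c → c = 0) {x y : FreeAlgebra ℂ[X] (Gen N)} (h : Rel μ x y) :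
    FreeAlgebra.lift ℂ[X] g x = FreeAlgebra.lift ℂ[X] g y := by
  obtain ⟨k, hk⟩ := h
  have h1 : TwoSidedIdeal.span {c | IsRelator μ (FreeAlgebra.ι ℂ[X] : Gen N → _) c} ≤
      TwoSidedIdeal.ker (FreeAlgebra.lift ℂ[X] g) := by
    rw [TwoSidedIdeal.span_le]
    intro c hc
    rw [SetLike.mem_coe, TwoSidedIdeal.mem_ker]
    apply hg
    have := IsRelator.map (FreeAlgebra.lift ℂ[X] g) μ hc
    rwa [show (FreeAlgebra.lift ℂ[X] g : FreeAlgebra ℂ[X] (Gen N) → B) ∘ FreeAlgebra.ι ℂ[X] = g from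
      FreeAlgebra.ι_comp_lift g] at this
  have h2 := (TwoSidedIdeal.mem_ker _).1 (h1 hk)
  rw [map_smul] at h2
  have h3 : ∀ k : ℕ, ∀ b : B, hb ^ k • b = 0 → b = 0 := by
    intro k
    induction k with
    | zero => intro b hb; simpa using hb
    | succ k ih => intro b h; rw [pow_succ', mul_smul] at h; exact ih b (hB _ h)
  have h4 := h3 k _ h2
  rwa [map_sub, sub_eq_zero] at h4

end Functoriality

/-! ### Series of difference operators -/

section OpSeries

variable {N : ℕ} {m : Fin N → ℕ} {lam : Fin (N + 1) → ℤ} {ℓ : Fin N → ℕ}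
  (r : (j : Fin N) → Fin (ℓ j) → ℂ)

/-- Multiplication operators, as an algebra homomorphism. -/
def mulAlg (m : Fin N → ℕ) : Fld m →ₐ[ℂ[X]] Op m := Algebra.lmul ℂ[X] (Fld m)

theorem mulAlg_apply (f : Fld m) : mulAlg m f = mulOp f := rfl

/-- Series of multiplication operators. -/
def serHom (m : Fin N → ℕ) : MvPowerSeries (Fin 3) (Fld m) →+* MvPowerSeries (Fin 3) (Op m) :=
  MvPowerSeries.map (mulAlg m : Fld m →+* Op m)

theorem coeff_serHom (F : MvPowerSeries (Fin 3) (Fld m)) (d : Fin 3 →₀ ℕ) :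
    MvPowerSeries.coeff d (serHom m F) = mulOp (MvPowerSeries.coeff d F) := rfl

/-- Series of operators as a module over series of functions, by left multiplication. -/
instance serModule : Module (MvPowerSeries (Fin 3) (Fld m)) (MvPowerSeries (Fin 3) (Op m)) :=
  Module.compHom _ (serHom m)

theorem ser_smul_def (F : MvPowerSeries (Fin 3) (Fld m)) (z : MvPowerSeries (Fin 3) (Op m)) :
    F • z = serHom m F * z := rfl

instance : IsScalarTower (MvPowerSeries (Fin 3) (Fld m)) (MvPowerSeries (Fin 3) (Op m))
    (MvPowerSeries (Fin 3) (Op m)) :=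
  ⟨fun F a b => by simp only [ser_smul_def, smul_eq_mul, mul_assoc]⟩

theorem smul_op_eq (c : ℂ[X]) (x : Op m) : c • x = mulOp (algebraMap ℂ[X] (Fld m) c) * x := by
  refine LinearMap.ext fun f => ?_
  rw [LinearMap.smul_apply, Module.End.mul_apply, mulOp_apply, Algebra.smul_def]

theorem smul_ser_eq (c : ℂ[X]) (z : MvPowerSeries (Fin 3) (Op m)) :
    c • z = serHom m (MvPowerSeries.C (algebraMap ℂ[X] (Fld m) c)) * z := by
  rw [serHom, MvPowerSeries.map_C]
  ext1 d
  rw [MvPowerSeries.coeff_C_mul]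
  exact smul_op_eq c (MvPowerSeries.coeff d z)

theorem hb_smul_ser (z : MvPowerSeries (Fin 3) (Op m)) :
    hb • z = serHom m (MvPowerSeries.C (hbF m)) * z := smul_ser_eq _ _

theorem chb_half_smul_ser (z : MvPowerSeries (Fin 3) (Op m)) :
    chb (1 / 2) • z = serHom m (MvPowerSeries.C (hbF m / 2)) * z := by
  rw [smul_ser_eq, algebraMap_chb_half]

theorem xv_eq (s : Fin 3) : (xv s : MvPowerSeries (Fin 3) (Op m)) =
    serHom m (MvPowerSeries.X s) := (MvPowerSeries.map_X _ _).symm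

theorem inVar_map_mulAlg (s : Fin 3) (φ : PowerSeries (Fld m)) :
    inVar s (PowerSeries.map (mulAlg m : Fld m →+* Op m) φ) = serHom m (inVar s φ) :=
  inVar_map _ _ _

/-- The automorphism `strans s` applied to the coefficients of a series. -/
def smv (s : SIdx m) : MvPowerSeries (Fin 3) (Fld m) →+* MvPowerSeries (Fin 3) (Fld m) :=
  MvPowerSeries.map ((strans s : Fld m →ₐ[ℂ[X]] Fld m) : Fld m →+* Fld m)

theorem smv_inVar (s : SIdx m) (t : Fin 3) (φ : PowerSeries (Fld m)) :
    smv s (inVar t φ) = inVar t (spow s φ) := (inVar_map _ _ _).symm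

theorem smv_C (s : SIdx m) (f : Fld m) :
    smv s (MvPowerSeries.C f) = MvPowerSeries.C (strans s f) := MvPowerSeries.map_C _ _

/-- The operator `sop r s` as a constant series. -/
def csop (s : SIdx m) : MvPowerSeries (Fin 3) (Op m) := MvPowerSeries.C (sop r s)

/-- The normal ordering rule: a series of functions passes through an operator by applying the shift
to each coefficient. -/
theorem csop_mul_serHom (s : SIdx m) (F : MvPowerSeries (Fin 3) (Fld m)) :
    csop r s * serHom m F = serHom m (smv s F) * csop r s := by
  ext1 d
  rw [csop, MvPowerSeries.coeff_C_mul, MvPowerSeries.coeff_mul_C, coeff_serHom, coeff_serHom,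
    sop_mul_mulOp]
  rfl

theorem csop_smul (s : SIdx m) (F : MvPowerSeries (Fin 3) (Fld m))
    (z : MvPowerSeries (Fin 3) (Op m)) :
    csop r s * (F • z) = smv s F • (csop r s * z) := by
  rw [ser_smul_def, ser_smul_def, ← mul_assoc, csop_mul_serHom, mul_assoc]

theorem C_smul_csop_mul (f : Fld m) (s t : SIdx m) :
    (MvPowerSeries.C f : MvPowerSeries (Fin 3) (Fld m)) • (csop r s * csop r t) =
      MvPowerSeries.C (mulOp f * (sop r s * sop r t)) := by
  rw [ser_smul_def, serHom, MvPowerSeries.map_C, csop, csop, ← map_mul, ← map_mul]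
  rfl

/-- The series `∑_κ f_κ(u) ϰ_κ` of operators at the node `j`. -/
def opSer (j : Fin N) (φ : Fin (m j) × Bool → PowerSeries (Fld m)) : PowerSeries (Op m) :=
  PowerSeries.mk fun d => ∑ κ, mulOp (PowerSeries.coeff d (φ κ)) * sop r (nsv j κ)

theorem inVar_opSer (s : Fin 3) (j : Fin N) (φ : Fin (m j) × Bool → PowerSeries (Fld m)) :
    inVar s (opSer r j φ) = ∑ κ, inVar s (φ κ) • csop r (nsv j κ) := by
  ext1 d
  have h : ∀ κ, MvPowerSeries.coeff d (inVar s (φ κ) • csop r (nsv j κ)) =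
      mulOp (if d = Finsupp.single s (d s) then PowerSeries.coeff (d s) (φ κ) else 0) *
        sop r (nsv j κ) := fun κ => by
    rw [ser_smul_def, csop, MvPowerSeries.coeff_mul_C]; rfl
  rw [map_sum, Finset.sum_congr rfl fun κ _ => h κ]
  change (if d = Finsupp.single s (d s) then PowerSeries.coeff (d s) (opSer r j φ) else 0) = _
  split_ifs
  · rw [opSer, PowerSeries.coeff_mk]
  · refine (Finset.sum_eq_zero fun κ _ => ?_).symm
    rw [← mulAlg_apply, map_zero, zero_mul]

theorem shiftSeries_opSer (e : ℤ) (c : ℂ[X]) (j : Fin N)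
    (φ : Fin (m j) × Bool → PowerSeries (Fld m)) :
    shiftSeries e c (opSer r j φ) = opSer r j fun κ => shiftSeries e c (φ κ) := by
  ext1 d
  simp only [opSer, shiftSeries, PowerSeries.coeff_mk, Finset.smul_sum, ← mulAlg_apply, map_sum,
    map_zsmul, map_smul, Finset.sum_mul, smul_mul_assoc]
  exact Finset.sum_comm

theorem negSeries_opSer (j : Fin N) (φ : Fin (m j) × Bool → PowerSeries (Fld m)) :
    negSeries (opSer r j φ) = opSer r j fun κ => negSeries (φ κ) := by
  ext1 d
  simp only [opSer, negSeries, PowerSeries.coeff_mk, Finset.smul_sum, ← mulAlg_apply,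
    map_zsmul, smul_mul_assoc]

theorem principal_opSer (k : ℕ) (j : Fin N) (φ : Fin (m j) × Bool → PowerSeries (Fld m)) :
    principal k (opSer r j φ) = opSer r j fun κ => principal k (φ κ) := by
  ext1 d
  simp only [opSer, principal, PowerSeries.coeff_mk]
  split_ifs
  · refine (Finset.sum_eq_zero fun κ _ => ?_).symm
    rw [← mulAlg_apply, map_zero, zero_mul]
  · rfl

theorem bImage_eq (j : Fin N) (d : ℕ) : (bImage r j d : Op m) =
    PowerSeries.coeff d (opSer r j fun κ => poleSer (npol j κ)) := by
  have h1 : ∀ k, npol j (k, true) = gam (⟨j, k⟩ : Idx m) := fun k => by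
    simp [npol, nsv, pol, sv, cen]
  have h2 : ∀ k, npol j (k, false) = -gam (⟨j, k⟩ : Idx m) - hbF m := fun k => by
    simp [npol, nsv, pol, sv, cen]; ring
  rw [opSer, PowerSeries.coeff_mk, Fintype.sum_prod_type, bImage]
  refine Finset.sum_congr rfl fun k _ => ?_
  rw [Fintype.sum_bool, h1, h2, uSer_sub_cst, uSer_add_cst, ul, ul, inv_upow_one_sub_C,
    inv_upow_one_sub_C, coeff_lau, coeff_lau, nsv, nsv, sop_true, sop_false]

variable (μ : Fin (N + 1) → ℤ)

variable (m lam) in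
/-- The images of the generators of the shifted twisted Yangian. -/
def genOp : Gen N → Op m
  | .h i k => mulOp ((hbF m)⁻¹ * PowerSeries.coeff (k + 1) (hPS m lam r μ i))
  | .ht i k => mulOp ((hbF m)⁻¹ * PowerSeries.coeff (k + 1) (htPS m lam r μ i))
  | .b j k => mulOp (hbF m)⁻¹ * bImage r j (k + 1)

theorem hb_smul_mulOp_inv_mul (x : Op m) : hb • (mulOp (hbF m)⁻¹ * x) = x := by
  have : mulOp (hbF m * (hbF m)⁻¹) * x = x := by
    rw [mul_inv_cancel₀ hbF_ne_zero, ← mulAlg_apply, map_one, one_mul]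
  rw [smul_op_eq, ← mul_assoc, ← mulOp_mul]
  exact this

theorem hb_smul_mulOp (f : Fld m) : hb • mulOp ((hbF m)⁻¹ * f) = mulOp f := by
  rw [mulOp_mul, hb_smul_mulOp_inv_mul]

theorem bSer_genOp (j : Fin N) :
    bSer (genOp m lam r μ) j = opSer r j fun κ => poleSer (npol j κ) := by
  ext1 d
  rw [bSer, PowerSeries.coeff_mk, ← bImage_eq]
  split_ifs with hd
  · subst hd
    rw [bImage_eq, opSer, PowerSeries.coeff_mk]
    refine (Finset.sum_eq_zero fun κ _ => ?_).symm
    rw [coeff_poleSer, if_pos rfl, ← mulAlg_apply, map_zero, zero_mul]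
  · obtain ⟨d, rfl⟩ := Nat.exists_eq_succ_of_ne_zero hd
    exact hb_smul_mulOp_inv_mul _

theorem inVar_bSer_genOp (s : Fin 3) (j : Fin N) : inVar s (bSer (genOp m lam r μ) j) =
    ∑ κ, inVar s (poleSer (npol j κ)) • csop r (nsv j κ) := by
  rw [bSer_genOp, inVar_opSer]

variable {μ} (hm : lam - μ = ∑ j, (m j : ℤ) • simpleCoroot j)
  (hℓ : ∀ j, (ℓ j : ℤ) = rootPairing lam j)
include hm hℓ

theorem hSer_genOp (i : Fin (N + 1)) : hSer (genOp m lam r μ) i =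
    PowerSeries.map (mulAlg m : Fld m →+* Op m) (hPS m lam r μ i) := by
  ext1 d
  rw [hSer, PowerSeries.coeff_mk, PowerSeries.coeff_map]
  split_ifs with hd
  · subst hd
    rw [coeff_zero_hPS r hm hℓ, map_one]
  · obtain ⟨d, rfl⟩ := Nat.exists_eq_succ_of_ne_zero hd
    exact hb_smul_mulOp _

theorem htSer_genOp (i : Fin (N + 1)) : htSer (genOp m lam r μ) i =
    PowerSeries.map (mulAlg m : Fld m →+* Op m) (htPS m lam r μ i) := by
  ext1 d
  rw [htSer, PowerSeries.coeff_mk, PowerSeries.coeff_map]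
  split_ifs with hd
  · subst hd
    rw [coeff_zero_htPS r hm hℓ, map_one]
  · obtain ⟨d, rfl⟩ := Nat.exists_eq_succ_of_ne_zero hd
    exact hb_smul_mulOp _

theorem zSer_genOp (j : Fin N) : zSer μ (genOp m lam r μ) j =
    PowerSeries.map (mulAlg m : Fld m →+* Op m) (zPS m lam r μ j) := by
  rw [zSer, htSer_genOp r hm hℓ, hSer_genOp r hm hℓ, ← map_shiftSeries, ← map_mul]
  rfl

theorem zPrin_genOp (j : Fin N) : zPrin μ (genOp m lam r μ) j =
    PowerSeries.map (mulAlg m : Fld m →+* Op m)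
      (principal (2 * rootPairing μ j).toNat (zPS m lam r μ j)) := by
  rw [zPrin, zSer_genOp r hm hℓ, map_principal]

theorem wPrin_genOp (j : Fin N) : wPrin μ (genOp m lam r μ) j =
    PowerSeries.map (mulAlg m : Fld m →+* Op m) (wPS m lam r μ j) := by
  rw [wPrin, zSer_genOp r hm hℓ, wPS, map_principal, map_mul, map_mul, PowerSeries.map_X,
    map_evenGeom]

end OpSeries

/-! ### The relations between the difference operators -/

section OpRelations

variable {N : ℕ} {m : Fin N → ℕ} {lam : Fin (N + 1) → ℤ} {ℓ : Fin N → ℕ}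
  (r : (j : Fin N) → Fin (ℓ j) → ℂ)

theorem one_sub_mul_inVar_poleSer (s : Fin 3) (a : Fld m) :
    (1 - MvPowerSeries.C a * MvPowerSeries.X s) * inVar s (poleSer a) =
      (MvPowerSeries.X s : MvPowerSeries (Fin 3) (Fld m)) := by
  rw [inVar_poleSer, mul_left_comm, one_sub_mul_inVar_geoSer, mul_one]

theorem smv_inVar_poleSer_of_ne (s : SIdx m) (t : Fin 3) (j : Fin N) (κ : Fin (m j) × Bool)
    (h : s.1.1 ≠ j) : smv s (inVar t (poleSer (npol j κ))) = inVar t (poleSer (npol j κ)) := by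
  rw [smv_inVar, spow_poleSer, npol, strans_pol_of_ne fun e => h (by rw [← e]; rfl)]

/-- The commutation data of the operators at the node `j`. -/
def opNode (j : Fin N) : NodeData (MvPowerSeries (Fin 3) (Fld m)) (MvPowerSeries (Fin 3) (Op m))
    (Fin (m j) × Bool) where
  k κ := csop r (nsv j κ)
  neg κ := (κ.1, !κ.2)
  a κ := MvPowerSeries.C (npol j κ)
  a' κ κ' := MvPowerSeries.C (strans (nsv j κ) (npol j κ'))
  h := MvPowerSeries.C (hbF m)
  q κ := MvPowerSeries.C (kprod r (nsv j κ))
  res κ := MvPowerSeries.C (zRes r j (adjIdx j) κ / (2 * npol j κ))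
  neg_neg κ := by simp
  a'_self κ := by rw [npol, strans_pol_self, map_sub]
  a'_neg κ := by rw [← map_neg]; exact congrArg _ (strans_pol_sneg _)
  a'_other κ κ' h h' := by
    rw [npol, strans_pol_of_ne]
    exact fst_ne_of_ne (fun e => h (nsv_injective j e)) fun e => h' (nsv_injective j e)
  k_mul_neg κ := by
    rw [ser_smul_def, mul_one, serHom, MvPowerSeries.map_C, csop, csop, ← map_mul]
    exact congrArg _ (sop_mul_sop_sneg r (nsv j κ))
  q_res κ := by
    have h := congrArg (MvPowerSeries.C (σ := Fin 3)) (kprod_eq r j κ)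
    -- `zRes` is the residue in the variable u²; the residue in u at the pole a is obtained on
    -- dividing by 2a.
    have h2 : zRes r j (adjIdx j) κ =
        2 * npol j κ * (zRes r j (adjIdx j) κ / (2 * npol j κ)) :=
      (mul_div_cancel₀ _ (two_mul_npol_ne_zero j κ)).symm
    rw [h2] at h
    simp only [map_mul, map_sub, map_neg, map_ofNat] at h
    rw [h]
    ring
  exchange κ κ' h h' := by
    have := sop_same r (s := nsv j κ) (t := nsv j κ')
      (fst_ne_of_ne (fun e => h (nsv_injective j e)) fun e => h' (nsv_injective j e)) rfl
    rw [← map_sub, ← map_add, ← map_sub, ← map_add, C_smul_csop_mul, C_smul_csop_mul, ← map_add,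
      npol, npol, this, ← add_mul, ← mulAlg_apply, ← mulAlg_apply, ← map_add]
    rw [show -(pol (nsv j κ) - pol (nsv j κ') + hbF m) +
      (pol (nsv j κ) - pol (nsv j κ') + hbF m) = 0 by ring, map_zero, zero_mul, map_zero]

variable (μ : Fin (N + 1) → ℤ)

theorem relBBfar_genOp (i j : Fin N) (hij : (i : ℕ) + 1 < j ∨ (j : ℕ) + 1 < i) :
    relBBfar (genOp m lam r μ) i j = 0 := by
  have hne : i ≠ j := by rintro rfl; omega
  have hc : ∀ κ κ', csop r (nsv (m := m) i κ) * csop r (nsv j κ') =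
      csop r (nsv j κ') * csop r (nsv i κ) := fun κ κ' => by
    rw [csop, csop, ← map_mul, ← map_mul, sop_far r (s := nsv i κ) (t := nsv j κ') hne]
    · change (j : ℕ) ≠ i + 1; omega
    · change (j : ℕ) + 1 ≠ i; omega
  rw [relBBfar, comm, inVar_bSer_genOp, inVar_bSer_genOp, sub_eq_zero, Finset.sum_mul_sum,
    Finset.sum_mul_sum, Finset.sum_comm]
  refine Finset.sum_congr rfl fun κ' _ => Finset.sum_congr rfl fun κ _ => ?_
  rw [smul_mul_assoc, smul_mul_assoc, csop_smul, csop_smul, hc,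
    smv_inVar_poleSer_of_ne _ _ _ _ hne, smv_inVar_poleSer_of_ne _ _ _ _ hne.symm, smul_smul,
    smul_smul, mul_comm]

theorem hb_smul_C_genOp_b (j : Fin N) : (hb • MvPowerSeries.C (genOp m lam r μ (.b j 0)) :
    MvPowerSeries (Fin 3) (Op m)) = ∑ κ, csop r (nsv j κ) := by
  have h : (hb • MvPowerSeries.C (genOp m lam r μ (.b j 0)) : MvPowerSeries (Fin 3) (Op m)) =
      MvPowerSeries.C (hb • genOp m lam r μ (.b j 0)) := by
    rw [hb_smul_ser, serHom, MvPowerSeries.map_C, ← map_mul, smul_op_eq]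
    rfl
  rw [h, genOp, hb_smul_mulOp_inv_mul, bImage_eq, opSer, PowerSeries.coeff_mk, map_sum]
  refine Finset.sum_congr rfl fun κ _ => ?_
  rw [coeff_poleSer, zero_add, if_neg one_ne_zero, pow_zero, ← mulAlg_apply, map_one, one_mul, csop]

theorem relBBnext_genOp (i j : Fin N) (hij : (j : ℕ) = i + 1) :
    relBBnext (genOp m lam r μ) i j = 0 := by
  have hne : i ≠ j := by rintro rfl; omega
  have h := relBBnext_of_exchange (MvPowerSeries.X 0) (MvPowerSeries.X 1)
    (MvPowerSeries.C (hbF m / 2)) (fun κ => csop r (nsv i κ)) (fun κ => csop r (nsv j κ))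
    (fun κ => MvPowerSeries.C (npol i κ)) (fun κ => inVar 0 (poleSer (npol i κ)))
    (fun κ => MvPowerSeries.C (npol j κ)) (fun κ => inVar 1 (poleSer (npol j κ)))
    (fun κ => one_sub_mul_inVar_poleSer 0 _) (fun κ => one_sub_mul_inVar_poleSer 1 _)
    (fun κ κ' z => by rw [csop_smul, smv_inVar_poleSer_of_ne _ _ _ _ hne])
    (fun κ κ' z => by rw [csop_smul, smv_inVar_poleSer_of_ne _ _ _ _ hne.symm])
    (fun κ κ' => by
      have := sop_adj r (s := nsv i κ) (t := nsv j κ') (Or.inl hij)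
      rw [← map_sub, ← map_add, ← map_sub, C_smul_csop_mul, C_smul_csop_mul, npol, npol, pol, pol,
        show sv (nsv i κ) - hbF m / 2 - (sv (nsv j κ') - hbF m / 2) =
          sv (nsv i κ) - sv (nsv j κ') by ring, this])
  -- ħ is central since the operators are linear over ℂ[ħ]; it may be moved into the commutator,
  -- where ħ b^{(0)} is the sum of the operators of the node.
  have hcomm : ∀ a b : MvPowerSeries (Fin 3) (Op m), hb • comm a b = comm (hb • a) b :=
    fun a b => by
      have hb : serHom m (MvPowerSeries.C (hbF m)) * b =
          b * serHom m (MvPowerSeries.C (hbF m)) := by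
        rw [serHom, MvPowerSeries.map_C]
        ext1 d
        rw [MvPowerSeries.coeff_C_mul, MvPowerSeries.coeff_mul_C]
        refine LinearMap.ext fun f => ?_
        have := (MvPowerSeries.coeff d b).map_smul TwistedYangian.hb f
        rw [Algebra.smul_def, Algebra.smul_def] at this
        exact this.symm
      rw [comm, comm, smul_sub, hb_smul_ser, hb_smul_ser, hb_smul_ser, mul_assoc, ← mul_assoc b,
        ← hb, mul_assoc]
  rw [relBBnext]
  simp only [hcomm, hb_smul_C_genOp_b, chb_half_smul_ser, inVar_bSer_genOp, xv_eq]
  simpa only [ser_smul_def, map_sub, map_mul] using h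

variable {μ} (hm : lam - μ = ∑ j, (m j : ℤ) • simpleCoroot j)
  (hℓ : ∀ j, (ℓ j : ℤ) = rootPairing lam j)
include hm hℓ

theorem inVar_hSer_genOp (s : Fin 3) (i : Fin (N + 1)) : inVar s (hSer (genOp m lam r μ) i) =
    serHom m (inVar s (hPS m lam r μ i)) := by
  rw [hSer_genOp r hm hℓ, inVar_map_mulAlg]

theorem relHH_genOp (i k : Fin (N + 1)) : relHH (genOp m lam r μ) i k = 0 := by
  rw [relHH, inVar_hSer_genOp r hm hℓ, inVar_hSer_genOp r hm hℓ, comm, ← map_mul, ← map_mul,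
    mul_comm, sub_self]

theorem relHB_genOp_same (j : Fin N) : relHB (genOp m lam r μ) j.castSucc j = 0 := by
  have h := relHB_same_of_exchange (MvPowerSeries.X 0) (MvPowerSeries.X 1)
    (MvPowerSeries.C (hbF m)) (MvPowerSeries.C (hbF m / 2)) (inVar 0 (hPS m lam r μ j.castSucc))
    (fun κ => csop r (nsv j κ)) (fun κ => MvPowerSeries.C (npol j κ))
    (fun κ => inVar 0 (poleSer (npol j κ - hbF m / 2)))
    (fun κ => inVar 0 (-poleSer (-(npol j κ + hbF m / 2))))
    (fun κ => inVar 1 (poleSer (npol j κ)))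
    (fun κ => inVar 0 (spow (nsv j κ) (hPS m lam r μ j.castSucc)))
    (fun κ => by rw [← map_sub]; exact one_sub_mul_inVar_poleSer 0 _)
    (fun κ => by
      have := one_sub_mul_inVar_poleSer 0 (-(npol j κ + hbF m / 2))
      rw [map_neg, neg_mul, sub_neg_eq_add] at this
      rw [← map_add, ← inVarHom_apply, map_neg, mul_neg, inVarHom_apply, this])
    (fun κ => one_sub_mul_inVar_poleSer 1 _)
    (fun κ z => by rw [csop_smul, smv_inVar])
    (fun κ => by
      have := congrArg (inVarHom 0) (spow_hPS_same r hm hℓ (nsv j κ) j.castSucc rfl)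
      simp only [map_mul, map_sub, map_one, inVarHom_C] at this
      simp only [inVarHom_apply] at this
      rw [npol, pol, show sv (nsv j κ) - hbF m / 2 - hbF m / 2 = sv (nsv j κ) - hbF m by ring,
        show sv (nsv j κ) - hbF m / 2 + hbF m / 2 = sv (nsv j κ) by ring, this, ← inVarHom_apply,
        ← inVarHom_apply, ← inVarHom_apply, map_neg]
      ring)
  have e1 : ∀ κ, shiftSeries 0 (chb (1 / 2)) (poleSer (npol j κ)) =
      poleSer (npol j κ - hbF m / 2) := fun κ => by
    rw [shiftSeries_poleSer, algebraMap_chb_half]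
  have e2 : ∀ κ, negSeries (shiftSeries 0 (chb (-1 / 2)) (poleSer (npol j κ))) =
      -poleSer (-(npol j κ + hbF m / 2)) := fun κ => by
    rw [shiftSeries_poleSer, algebraMap_chb_neg_half, negSeries_poleSer, sub_neg_eq_add]
  rw [relHB, if_pos rfl]
  simp only [inVar_hSer_genOp r hm hℓ, bSer_genOp, shiftSeries_opSer, negSeries_opSer, inVar_opSer,
    e1, e2, xv_eq, chb_half_smul_ser, hb_smul_ser]
  simpa only [ser_smul_def, map_sub, map_mul, map_add, mul_one] using h

theorem relHB_genOp_succ (j : Fin N) : relHB (genOp m lam r μ) j.succ j = 0 := by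
  have h := relHB_succ_of_exchange (MvPowerSeries.X 0) (MvPowerSeries.X 1)
    (MvPowerSeries.C (hbF m)) (inVar 0 (hPS m lam r μ j.succ))
    (fun κ => csop r (nsv j κ)) (fun κ => MvPowerSeries.C (npol j κ))
    (fun κ => inVar 0 (poleSer (npol j κ)))
    (fun κ => inVar 0 (-poleSer (-npol j κ)))
    (fun κ => inVar 1 (poleSer (npol j κ)))
    (fun κ => inVar 0 (spow (nsv j κ) (hPS m lam r μ j.succ)))
    (fun κ => one_sub_mul_inVar_poleSer 0 _)
    (fun κ => by
      have := one_sub_mul_inVar_poleSer 0 (-npol j κ)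
      rw [map_neg, neg_mul, sub_neg_eq_add] at this
      rw [← inVarHom_apply, map_neg, mul_neg, inVarHom_apply, this])
    (fun κ => one_sub_mul_inVar_poleSer 1 _)
    (fun κ z => by rw [csop_smul, smv_inVar])
    (fun κ => by
      have := congrArg (inVarHom 0) (spow_hPS_succ r hm hℓ (nsv j κ) j.succ rfl)
      simp only [map_mul, map_add, map_one, inVarHom_C] at this
      simp only [inVarHom_apply] at this
      rw [npol, this, ← inVarHom_apply, ← inVarHom_apply, ← inVarHom_apply, map_neg]
      ring)
  rw [relHB, if_neg (fun e => by simp [Fin.ext_iff] at e), if_pos rfl]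
  simp only [inVar_hSer_genOp r hm hℓ, bSer_genOp, negSeries_opSer, inVar_opSer,
    negSeries_poleSer, xv_eq, hb_smul_ser]
  simpa only [ser_smul_def, map_sub, map_mul, map_add, mul_one] using h

theorem relHB_genOp (i : Fin (N + 1)) (j : Fin N) : relHB (genOp m lam r μ) i j = 0 := by
  by_cases h1 : i = j.castSucc
  · subst h1; exact relHB_genOp_same r hm hℓ j
  by_cases h2 : i = j.succ
  · subst h2; exact relHB_genOp_succ r hm hℓ j
  rw [relHB, if_neg h1, if_neg h2, comm, inVar_hSer_genOp r hm hℓ, inVar_bSer_genOp, sub_eq_zero,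
    Finset.mul_sum, Finset.sum_mul]
  refine Finset.sum_congr rfl fun κ _ => ?_
  have h3 : spow (nsv j κ) (hPS m lam r μ i) = hPS m lam r μ i :=
    spow_hPS_far r hm hℓ _ _ (fun e => h1 (Fin.ext e.symm)) fun e => h2 (Fin.ext e.symm)
  rw [ser_smul_def, mul_assoc, csop_mul_serHom, smv_inVar, h3, ← mul_assoc, ← mul_assoc, ← map_mul,
    ← map_mul, mul_comm]

variable (hμ : IsDominantCoweight μ)
include hμ

theorem relBB_genOp (i : Fin N) : relBB μ (genOp m lam r μ) i = 0 := by
  have hc : ∀ (t : Fin 3) (κ κ' : Fin (m i) × Bool) (z : MvPowerSeries (Fin 3) (Op m)),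
      (opNode r i).k κ * ((MvPowerSeries.X t * inVar t (geoSer (npol i κ'))) • z) =
        (MvPowerSeries.X t * inVar t (geoSer (strans (nsv i κ) (npol i κ')))) •
          ((opNode r i).k κ * z) := fun t κ κ' z => by
    rw [← inVar_poleSer, ← inVar_poleSer, ← spow_poleSer, ← smv_inVar]
    exact csop_smul r _ _ _
  have h := relBB_of_nodeData (opNode r i) (MvPowerSeries.X 0) (MvPowerSeries.X 1)
    (fun κ => inVar 0 (geoSer (npol i κ))) (fun κ => inVar 1 (geoSer (npol i κ)))
    (fun κ κ' => inVar 0 (geoSer (strans (nsv i κ) (npol i κ'))))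
    (fun κ κ' => inVar 1 (geoSer (strans (nsv i κ) (npol i κ'))))
    (fun κ => one_sub_mul_inVar_geoSer 0 _) (fun κ => one_sub_mul_inVar_geoSer 1 _)
    (fun κ κ' => one_sub_mul_inVar_geoSer 0 _) (fun κ κ' => one_sub_mul_inVar_geoSer 1 _)
    (hc 0) (hc 1)
  have hz : ∀ t : Fin 3, inVar t (zPrin μ (genOp m lam r μ) i) =
      serHom m (∑ κ, (opNode r i).res κ * (MvPowerSeries.X t * inVar t (geoSer (npol i κ)) -
        MvPowerSeries.X t *
          inVar t (geoSer (strans (nsv i κ) (npol i ((opNode r i).neg κ)))))) := fun t => by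
    rw [zPrin_genOp r hm hℓ, inVar_map_mulAlg, principal_zPS r hm hℓ hμ, ← inVarHom_apply, map_sum]
    congr 1
    refine Finset.sum_congr rfl fun κ _ => ?_
    -- Transport through an operator takes the opposite pole to -a, so the two poles of the abstract
    -- formula are the ±a of the partial fractions of z.
    have hn : strans (nsv i κ) (npol i ((opNode r i).neg κ)) = -npol i κ := strans_pol_sneg _
    rw [map_mul, inVarHom_C, map_sub, inVarHom_apply, inVarHom_apply, hn, inVar_poleSer,
      inVar_poleSer]
    rfl
  rw [relBB]
  simp only [hz, inVar_bSer_genOp, inVar_poleSer, xv_eq, hb_smul_ser]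
  simp only [ser_smul_def, map_sub, map_mul, map_add, mul_one] at h ⊢
  exact h

/-- Moving z_i to the left of each operator of b_j replaces it by its shift, which leaves the
bracket computed in `wPS_bracket`. -/
theorem serreRHS_genOp (i j : Fin N) (hij : (j : ℕ) = i + 1 ∨ (i : ℕ) = j + 1) (t : Fin 3) :
    serreRHS μ (genOp m lam r μ) i j t =
      ∑ τ, (inVar 2 (poleSer (npol j τ)) * ∑ κ, MvPowerSeries.C
        (-(hbF m ^ 2 * zRes r i ((adjIdx i).erase (nsv j τ).1) κ)) *
          (inVar t (poleSer (npol i κ)) + inVar t (poleSer (-npol i κ)))) • csop r (nsv j τ) := by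
  -- The principal part of t/(t - a) is a/(t - a): inside the bracket the factor t is replaced by
  -- the pole.
  have hp : ∀ a : Fld m, principal 1 (poleSer a) = PowerSeries.C a * poleSer a := fun a => by
    ext d
    rw [principal, PowerSeries.coeff_mk, PowerSeries.coeff_C_mul, coeff_poleSer, coeff_poleSer]
    obtain _ | d := d
    · simp
    · simp [pow_succ']
  rw [serreRHS]
  simp only [wPrin_genOp r hm hℓ, inVar_map_mulAlg, bSer_genOp, principal_opSer, inVar_opSer, hp,
    hb_smul_ser]
  rw [Finset.mul_sum, ← Finset.sum_sub_distrib, ← Finset.sum_add_distrib, Finset.mul_sum,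
    Finset.sum_mul, ← Finset.sum_sub_distrib, Finset.mul_sum]
  refine Finset.sum_congr rfl fun τ _ => ?_
  have hadj : (nsv j τ).1 ∈ adjIdx i := by
    rw [adjIdx, Finset.mem_union, mem_nextIdx, mem_prevIdx]
    change (j : ℕ) = i + 1 ∨ (j : ℕ) + 1 = i
    omega
  have hw := congrArg (inVarHom t) (wPS_bracket r hm hℓ hμ i (nsv j τ) hadj)
  rw [map_sum] at hw
  simp only [map_mul, map_sub, map_add, inVarHom_C] at hw
  simp only [inVarHom_apply] at hw
  rw [← hw, ← inVarHom_apply 2, map_mul, inVarHom_C, inVarHom_apply, ser_smul_def, ser_smul_def,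
    ser_smul_def]
  set p := inVar 2 (poleSer (npol j τ))
  set w := inVar t (wPS m lam r μ i)
  set w' := inVar t (spow (nsv j τ) (wPS m lam r μ i))
  have hcw : csop r (nsv j τ) * serHom m w = serHom m w' * csop r (nsv j τ) := by
    rw [csop_mul_serHom, smv_inVar]
  have e : (serHom m (MvPowerSeries.C (npol j τ) * p) * csop r (nsv j τ) +
      serHom m (MvPowerSeries.C (hbF m)) * (serHom m p * csop r (nsv j τ))) * serHom m w =
      serHom m ((MvPowerSeries.C (npol j τ) * p + MvPowerSeries.C (hbF m) * p) * w') *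
        csop r (nsv j τ) := by
    rw [← mul_assoc, ← map_mul, ← add_mul, mul_assoc, hcw, ← mul_assoc, ← map_add, ← map_mul]
  rw [e, ← mul_assoc (serHom m (MvPowerSeries.C (hbF m))) (serHom m p), ← map_mul, ← sub_mul,
    ← map_sub, ← mul_assoc, ← map_mul, ← sub_mul, ← map_sub, ← mul_assoc, ← map_mul]
  congr 2
  simp only [npol]
  ring

theorem relSerre_genOp (i j : Fin N) (hij : (j : ℕ) = i + 1 ∨ (i : ℕ) = j + 1) :
    relSerre μ (genOp m lam r μ) i j = 0 := by
  have hne : i ≠ j := by rintro rfl; omega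
  have hne1 : ∀ κ τ, (nsv (m := m) j τ).1 ≠ (nsv i κ).1 := fun κ τ e =>
    hne (congrArg Sigma.fst e).symm
  have hc : ∀ (t : Fin 3) (κ κ' : Fin (m i) × Bool) (z : MvPowerSeries (Fin 3) (Op m)),
      (opNode r i).k κ * ((MvPowerSeries.X t * inVar t (geoSer (npol i κ'))) • z) =
        (MvPowerSeries.X t * inVar t (geoSer (strans (nsv i κ) (npol i κ')))) •
          ((opNode r i).k κ * z) := fun t κ κ' z => by
    rw [← inVar_poleSer, ← inVar_poleSer, ← spow_poleSer, ← smv_inVar]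
    exact csop_smul r _ _ _
  have hc' : ∀ (t : Fin 3) (κ : Fin (m i) × Bool) (τ : Fin (m j) × Bool)
      (z : MvPowerSeries (Fin 3) (Op m)),
      csop r (nsv j τ) * ((MvPowerSeries.X t * inVar t (geoSer (npol i κ))) • z) =
        (MvPowerSeries.X t * inVar t (geoSer (npol i κ))) • (csop r (nsv j τ) * z) :=
    fun t κ τ z => by
      rw [← inVar_poleSer, csop_smul, smv_inVar_poleSer_of_ne _ _ _ _ hne.symm]
  have hd0 : ∀ κ τ, npol (m := m) i κ - sv (nsv j τ) ≠ 0 := fun κ τ =>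
    pol_sub_sv_ne_zero (hne1 κ τ)
  have hst : ∀ κ τ, strans (nsv i κ) (sv (nsv (m := m) j τ)) = sv (nsv j τ) := fun κ τ =>
    strans_sv_of_ne (hne1 κ τ)
  have hd0' : ∀ κ κ' τ, strans (nsv i κ) (npol (m := m) i κ') - sv (nsv j τ) ≠ 0 :=
    fun κ κ' τ => by
      rw [← hst κ τ, ← map_sub]
      exact (map_ne_zero_iff _ (strans (nsv i κ)).injective).2 (hd0 κ' τ)
  have h := relSerre_of_nodeData (opNode r i) (MvPowerSeries.X 0) (MvPowerSeries.X 1)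
    (fun κ => inVar 0 (geoSer (npol i κ))) (fun κ => inVar 1 (geoSer (npol i κ)))
    (fun κ κ' => inVar 0 (geoSer (strans (nsv i κ) (npol i κ'))))
    (fun κ κ' => inVar 1 (geoSer (strans (nsv i κ) (npol i κ'))))
    (fun τ => csop r (nsv j τ)) (fun τ => inVar 2 (poleSer (npol j τ)))
    (fun τ => MvPowerSeries.C (sv (nsv j τ)))
    (fun κ τ => MvPowerSeries.C (npol i κ - sv (nsv j τ))⁻¹)
    (fun κ κ' τ => MvPowerSeries.C (strans (nsv i κ) (npol i κ') - sv (nsv j τ))⁻¹)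
    (fun κ => one_sub_mul_inVar_geoSer 0 _) (fun κ => one_sub_mul_inVar_geoSer 1 _)
    (fun κ κ' => one_sub_mul_inVar_geoSer 0 _) (fun κ κ' => one_sub_mul_inVar_geoSer 1 _)
    (fun κ τ => by
      change (MvPowerSeries.C (npol i κ) - _) * _ = _
      rw [← map_sub, ← map_mul, mul_inv_cancel₀ (hd0 κ τ), map_one])
    (fun κ κ' τ => by
      change (MvPowerSeries.C (strans (nsv i κ) (npol i κ')) - _) * _ = _
      rw [← map_sub, ← map_mul, mul_inv_cancel₀ (hd0' κ κ' τ), map_one])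
    (hc 0) (hc 1)
    (fun κ τ z => (csop_smul r _ _ _).trans (by rw [smv_inVar_poleSer_of_ne _ _ _ _ hne]; rfl))
    (hc' 0) (hc' 1)
    (fun κ τ => by
      change csop r (nsv j τ) * csop r (nsv i κ) = (1 + MvPowerSeries.C (hbF m) * _) •
        (csop r (nsv i κ) * csop r (nsv j τ))
      have hadj := sop_adj r (s := nsv i κ) (t := nsv j τ) (by
        change (j : ℕ) = i + 1 ∨ (i : ℕ) = j + 1; exact hij)
      rw [← map_mul, ← map_one (MvPowerSeries.C (σ := Fin 3) (R := Fld m)), ← map_add,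
        C_smul_csop_mul, csop, csop, ← map_mul]
      congr 1
      have h0 := hd0 κ τ
      -- The exchange factor of adjacent operators is (a - w + ħ)/(a - w), with a the pole at node i
      -- and w the signed variable at node j.
      have h1 : 1 + hbF m * (npol i κ - sv (nsv j τ))⁻¹ =
          (npol i κ - sv (nsv j τ))⁻¹ * (sv (nsv i κ) - sv (nsv j τ) + hbF m / 2) := by
        have : sv (nsv i κ) = npol i κ + hbF m / 2 := by rw [npol, pol]; ring
        rw [this]
        field_simp
        ring
      rw [h1, mulOp_mul, mul_assoc, hadj, ← mul_assoc, ← mulOp_mul,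
        show sv (nsv i κ) - sv (nsv j τ) - hbF m / 2 = npol i κ - sv (nsv j τ) by
          rw [npol, pol]; ring,
        inv_mul_cancel₀ h0, ← mulAlg_apply, map_one, one_mul])
    (fun κ κ' τ z => by
      refine (csop_smul r _ _ _).trans ?_
      congr 1
      change smv (nsv i κ) (1 + MvPowerSeries.C (hbF m) * _) = 1 + MvPowerSeries.C (hbF m) * _
      rw [map_add, map_one, map_mul, smv_C, smv_C, strans_hbF, map_inv₀, map_sub, hst])
  have hR : ∀ t : Fin 3, serreRHS μ (genOp m lam r μ) i j t =
      ∑ τ, (inVar 2 (poleSer (npol j τ)) * ∑ κ, 2 * (opNode r i).h ^ 2 * (opNode r i).res κ *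
        (opNode r i).a κ * (MvPowerSeries.C (npol i κ - sv (nsv j τ))⁻¹ *
          MvPowerSeries.C (strans (nsv i κ) (npol i ((opNode r i).neg κ)) - sv (nsv j τ))⁻¹) *
        (MvPowerSeries.X t * inVar t (geoSer (npol i κ)) +
          MvPowerSeries.X t *
            inVar t (geoSer (strans (nsv i κ) (npol i ((opNode r i).neg κ)))))) •
      csop r (nsv j τ) := fun t => by
    rw [serreRHS_genOp r hm hℓ hμ i j hij]
    refine Finset.sum_congr rfl fun τ _ => ?_
    congr 2
    refine Finset.sum_congr rfl fun κ _ => ?_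
    have hn : strans (nsv i κ) (npol i ((opNode r i).neg κ)) = -npol i κ := strans_pol_sneg _
    rw [hn, inVar_poleSer, inVar_poleSer]
    congr 1
    change _ = 2 * MvPowerSeries.C (hbF m) ^ 2 *
      MvPowerSeries.C (zRes r i (adjIdx i) κ / (2 * npol i κ)) * MvPowerSeries.C (npol i κ) * _
    have hadj : (nsv j τ).1 ∈ adjIdx i := by
      rw [adjIdx, Finset.mem_union, mem_nextIdx, mem_prevIdx]
      change (j : ℕ) = i + 1 ∨ (j : ℕ) + 1 = i
      omega
    have h2 : (2 : MvPowerSeries (Fin 3) (Fld m)) = MvPowerSeries.C 2 :=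
      (map_ofNat MvPowerSeries.C 2).symm
    rw [h2]
    simp only [← map_mul, ← map_pow]
    congr 1
    -- The restored factor a² - w² cancels the product (a - w)(-a - w) of the two denominators, up
    -- to the sign on the left.
    rw [zRes_insert r i hadj]
    have h0 := hd0 κ τ
    have h1 : -npol i κ - sv (nsv (m := m) j τ) ≠ 0 := hn ▸ hd0' κ ((opNode r i).neg κ) τ
    have h3 : npol (m := m) i κ ≠ 0 := pol_ne_zero _
    field_simp
    ring
  rw [relSerre]
  simp only [hR, inVar_bSer_genOp, xv_eq]
  simp only [inVar_poleSer] at h ⊢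
  simp only [ser_smul_def, map_mul, map_add] at h ⊢
  exact h

theorem eq_zero_of_isRelator_genOp {c : Op m} (h : IsRelator μ (genOp m lam r μ) c) : c = 0 := by
  cases h with
  | inv_right i d =>
    rw [hSer_genOp r hm hℓ, htSer_genOp r hm hℓ, ← map_mul, hPS_mul_htPS r hm hℓ, map_one, sub_self,
      map_zero]
  | inv_left i d =>
    rw [hSer_genOp r hm hℓ, htSer_genOp r hm hℓ, ← map_mul, mul_comm, hPS_mul_htPS r hm hℓ, map_one,
      sub_self, map_zero]
  | z_even j d =>
    rw [zSer_genOp r hm hℓ, ← map_negSeries, negSeries_zPS r hm hℓ hμ, sub_self, map_zero]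
  | hh i k d => rw [relHH_genOp r hm hℓ, map_zero]
  | hb i j d => rw [relHB_genOp r hm hℓ, map_zero]
  | bb_far i j hij d => rw [relBBfar_genOp r μ i j hij, map_zero]
  | bb i d => rw [relBB_genOp r hm hℓ hμ, map_zero]
  | bb_next i j hij d => rw [relBBnext_genOp r μ i j hij, map_zero]
  | serre i j hij d => rw [relSerre_genOp r hm hℓ hμ i j hij, map_zero]

end OpRelations

/-! ### The algebra of difference operators and its representation -/

section DiffAlgebra

variable {N : ℕ} {m : Fin N → ℕ}

theorem eq_zero_of_hb_smul {x : Op m} (h : hb • x = 0) : x = 0 := by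
  refine LinearMap.ext fun f => ?_
  have h1 := LinearMap.congr_fun h f
  rw [LinearMap.smul_apply, Algebra.smul_def, LinearMap.zero_apply] at h1
  exact (mul_eq_zero.1 h1).resolve_left hbF_ne_zero

theorem hb_smul_injective {x y : Op m} (h : hb • x = hb • y) : x = y :=
  sub_eq_zero.1 (eq_zero_of_hb_smul (by rw [smul_sub, h, sub_self]))

theorem gam_mem_Pol (p : Idx m) : gam p ∈ Pol m :=
  Algebra.subset_adjoin (Or.inl (Or.inl ⟨p, rfl⟩))

theorem inv_sq_sub_sq_mem_Pol {p q : Idx m} (h : p.1 = q.1) (h' : p ≠ q) (r s : ℤ) :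
    ((gam p + r * hbF m) ^ 2 - (gam q + s * hbF m) ^ 2)⁻¹ ∈ Pol m :=
  Algebra.subset_adjoin (Or.inl (Or.inr ⟨p, q, r, s, h, h', rfl⟩))

theorem inv_add_half_mem_Pol (p : Idx m) (r : ℤ) :
    (gam p + (r / 2 : Fld m) * hbF m)⁻¹ ∈ Pol m :=
  Algebra.subset_adjoin (Or.inr ⟨p, r, rfl⟩)

theorem polySub_le_Pol : polySub m ≤ Pol m :=
  Algebra.adjoin_le (by rintro _ ⟨p, rfl⟩; exact gam_mem_Pol p)

theorem Pol_le_PolLoc : Pol m ≤ PolLoc m := Algebra.adjoin_mono (Set.subset_insert _ _)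

theorem DiffAlg_le_DiffAlgLoc : DiffAlg m ≤ DiffAlgLoc m :=
  Algebra.adjoin_mono (Set.subset_insert _ _)

theorem mulOp_mem_DiffAlg {f : Fld m} (hf : f ∈ Pol m) : mulOp f ∈ DiffAlg m := by
  have h : Pol m ≤ (DiffAlg m).comap (mulAlg m) :=
    Algebra.adjoin_le fun g hg => Algebra.subset_adjoin (Or.inl ⟨g, hg, rfl⟩)
  exact h hf

theorem betaOp_mem_DiffAlg (p : Idx m) : betaOp p 1 ∈ DiffAlg m :=
  Algebra.subset_adjoin (Or.inr ⟨p, Or.inl rfl⟩)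

theorem betaOp_neg_mem_DiffAlg (p : Idx m) : betaOp p (-1) ∈ DiffAlg m :=
  Algebra.subset_adjoin (Or.inr ⟨p, Or.inr rfl⟩)

theorem hbF_mem_Pol : hbF m ∈ Pol m := Subalgebra.algebraMap_mem _ _

theorem cen_mem_Pol (p : Idx m) : gam p + hbF m / 2 ∈ Pol m := polySub_le_Pol (cen_mem p)

theorem inv_two_mem_Pol : (2 : Fld m)⁻¹ ∈ Pol m := by
  have h := cpx_ratCast (m := m) (1 / 2)
  have h2 : (2 : Fld m)⁻¹ = cpx ((1 / 2 : ℚ) : ℂ) := by rw [h]; push_cast; ring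
  rw [h2]
  exact polySub_le_Pol (cpx_mem _)

theorem kap_mem_DiffAlg (p : Idx m) : kap p ∈ DiffAlg m := by
  refine mul_mem (mulOp_mem_DiffAlg ?_) (betaOp_neg_mem_DiffAlg p)
  have h1 := inv_add_half_mem_Pol p (-1)
  rw [show gam p + (((-1 : ℤ) : Fld m) / 2) * hbF m = gam p - hbF m / 2 by push_cast; ring] at h1
  rw [div_eq_mul_inv, mul_inv, mul_inv]
  refine mul_mem (mul_mem (prod_mem fun q _ => ?_) (prod_mem fun q _ => ?_))
    (mul_mem (mul_mem inv_two_mem_Pol h1) ?_)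
  · exact sub_mem (pow_mem (gam_mem_Pol p) _) (pow_mem (cen_mem_Pol q) _)
  · rw [add_assoc]; exact add_mem (gam_mem_Pol p) (cen_mem_Pol q)
  · rw [← Finset.prod_inv_distrib]
    refine prod_mem fun q hq => ?_
    have h := mem_otherIdx.1 hq
    have := inv_sq_sub_sq_mem_Pol h.1.symm h.2.symm 0 0
    simpa using this

theorem kap'_mem_DiffAlg {ℓ : Fin N → ℕ} (r : (j : Fin N) → Fin (ℓ j) → ℂ) (p : Idx m) :
    kap' r p ∈ DiffAlg m := by
  refine mul_mem (mulOp_mem_DiffAlg ?_) (betaOp_mem_DiffAlg p)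
  have h1 := inv_add_half_mem_Pol p 3
  push_cast at h1
  have h2 : gam p + hbF m ∈ Pol m := add_mem (gam_mem_Pol p) hbF_mem_Pol
  rw [div_eq_mul_inv, mul_inv, mul_inv]
  refine mul_mem (mul_mem (prod_mem fun k _ => ?_) (prod_mem fun q _ => ?_))
    (mul_mem (mul_mem inv_two_mem_Pol h1) ?_)
  · exact sub_mem (pow_mem h2 _) (pow_mem (Subalgebra.algebraMap_mem _ _) _)
  · exact sub_mem h2 (cen_mem_Pol q)
  · rw [← Finset.prod_inv_distrib]
    refine prod_mem fun q hq => ?_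
    have h := mem_otherIdx.1 hq
    have := inv_sq_sub_sq_mem_Pol h.1.symm h.2.symm 1 1
    simpa using this

theorem sop_mem_DiffAlg {ℓ : Fin N → ℕ} (r : (j : Fin N) → Fin (ℓ j) → ℂ) (s : SIdx m) :
    sop r s ∈ DiffAlg m := by
  obtain ⟨p, b⟩ := s
  cases b
  · rw [sop_false]; exact kap'_mem_DiffAlg r p
  · rw [sop_true]; exact kap_mem_DiffAlg p

theorem sv_mem_Pol (s : SIdx m) : sv s ∈ Pol m := by
  rw [sv]
  split_ifs
  · exact cen_mem_Pol _
  · exact neg_mem (cen_mem_Pol _)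

theorem bImage_mem_DiffAlg {ℓ : Fin N → ℕ} (r : (j : Fin N) → Fin (ℓ j) → ℂ) (j : Fin N) (d : ℕ) :
    bImage r j d ∈ DiffAlg m := by
  rw [bImage_eq, opSer, PowerSeries.coeff_mk]
  refine sum_mem fun κ _ => mul_mem (mulOp_mem_DiffAlg ?_) (sop_mem_DiffAlg r _)
  rw [coeff_poleSer]
  split_ifs
  · exact zero_mem _
  · refine pow_mem (sub_mem (sv_mem_Pol _) ?_) _
    rw [div_eq_mul_inv]
    exact mul_mem hbF_mem_Pol inv_two_mem_Pol

/-- The denominators were localized at all integral (respectively half-integral) multiples of ħ, a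
family that integral shifts permute. -/
theorem shift_polGens_mem (a : Idx m → ℤ) {f : Fld m} (hf : f ∈ polGens m) :
    shift a f ∈ Pol m := by
  rcases hf with (⟨p, rfl⟩ | ⟨p, q, r, s, h, h', rfl⟩) | ⟨p, r, rfl⟩
  · rw [shift_gam]
    exact add_mem (gam_mem_Pol p) (mul_mem (intCast_mem _ _) hbF_mem_Pol)
  · have := inv_sq_sub_sq_mem_Pol h h' (a p + r) (a q + s)
    rw [map_inv₀, map_sub, map_pow, map_pow, map_add, map_add, map_mul, map_mul, map_intCast,
      map_intCast, shift_gam, shift_gam, shift_hbF, add_assoc, ← add_mul, add_assoc, ← add_mul]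
    exact_mod_cast this
  · have := inv_add_half_mem_Pol p (2 * a p + r)
    rw [map_inv₀, map_add, map_mul, map_div₀, map_intCast, map_ofNat, shift_gam, shift_hbF]
    convert this using 2
    push_cast
    ring

theorem shift_mem_Pol (a : Idx m → ℤ) {f : Fld m} (hf : f ∈ Pol m) : shift a f ∈ Pol m := by
  have h : Pol m ≤ (Pol m).comap (shift a : Fld m →ₐ[ℂ[X]] Fld m) :=
    Algebra.adjoin_le fun g hg => shift_polGens_mem a hg
  exact h hf

theorem shift_mem_PolLoc (a : Idx m → ℤ) {f : Fld m} (hf : f ∈ PolLoc m) :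
    shift a f ∈ PolLoc m := by
  have h : PolLoc m ≤ (PolLoc m).comap (shift a : Fld m →ₐ[ℂ[X]] Fld m) := by
    refine Algebra.adjoin_le fun g hg => ?_
    rcases hg with rfl | hg
    · have : shift a (hbF m)⁻¹ ∈ PolLoc m := by
        rw [map_inv₀, shift_hbF]
        exact Algebra.subset_adjoin (Set.mem_insert _ _)
      exact this
    · exact Pol_le_PolLoc (shift_polGens_mem a hg)
  exact h hf

/-- The operators preserving a subalgebra. -/
def stab (S : Subalgebra ℂ[X] (Fld m)) : Subalgebra ℂ[X] (Op m) where
  carrier := {x | ∀ f ∈ S, x f ∈ S}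
  mul_mem' hx hy f hf := hx _ (hy f hf)
  add_mem' hx hy f hf := add_mem (hx f hf) (hy f hf)
  algebraMap_mem' c _ hf := S.smul_mem hf c

theorem DiffAlg_le_stab : DiffAlg m ≤ stab (Pol m) := by
  refine Algebra.adjoin_le ?_
  rintro _ (⟨f, hf, rfl⟩ | ⟨p, rfl | rfl⟩) g hg
  · exact mul_mem (Algebra.subset_adjoin hf) hg
  · exact shift_mem_Pol _ hg
  · exact shift_mem_Pol _ hg

theorem DiffAlgLoc_le_stab : DiffAlgLoc m ≤ stab (PolLoc m) := by
  refine Algebra.adjoin_le ?_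
  rintro _ (rfl | ⟨f, hf, rfl⟩ | ⟨p, rfl | rfl⟩) g hg
  · exact mul_mem (Algebra.subset_adjoin (Set.mem_insert _ _)) hg
  · exact mul_mem (Algebra.subset_adjoin (Set.mem_insert_of_mem _ hf)) hg
  · exact shift_mem_PolLoc _ hg
  · exact shift_mem_PolLoc _ hg

/-! ### Commutators of difference operators are divisible by `ħ` -/

/-- The difference of inverses is σ(f)⁻¹ - f⁻¹ = -(σ(f) - f) σ(f)⁻¹ f⁻¹, so divisibility by ħ passes
from f to f⁻¹. -/
theorem shift_sub_self_of_inv (a : Idx m → ℤ) {f : Fld m} (hf' : f⁻¹ ∈ Pol m)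
    (h : ∃ w ∈ Pol m, shift a f - f = hbF m * w) :
    ∃ w ∈ Pol m, shift a f⁻¹ - f⁻¹ = hbF m * w := by
  obtain ⟨w, hw, he⟩ := h
  refine ⟨-(w * (shift a f⁻¹ * f⁻¹)), neg_mem (mul_mem hw (mul_mem (shift_mem_Pol a hf') hf')), ?_⟩
  by_cases h0 : f = 0
  · simp [h0]
  have h1 : shift a f ≠ 0 := (map_ne_zero_iff _ (shift a).injective).2 h0
  have h2 : shift a f = f + hbF m * w := by rw [← he]; ring
  rw [map_inv₀]
  field_simp
  rw [h2]
  ring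

/-- The functions `f` whose differences `f(γ + a ħ) - f(γ)` are divisible by `ħ`. -/
def shiftDvd (a : Idx m → ℤ) : Subalgebra ℂ[X] (Fld m) where
  carrier := {f | f ∈ Pol m ∧ ∃ w ∈ Pol m, shift a f - f = hbF m * w}
  mul_mem' := by
    rintro f g ⟨hf, w, hw, e⟩ ⟨hg, w', hw', e'⟩
    refine ⟨mul_mem hf hg, w * shift a g + f * w',
      add_mem (mul_mem hw (shift_mem_Pol a hg)) (mul_mem hf hw'), ?_⟩
    rw [map_mul]
    linear_combination (shift a g) * e + f * e'
  add_mem' := by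
    rintro f g ⟨hf, w, hw, e⟩ ⟨hg, w', hw', e'⟩
    refine ⟨add_mem hf hg, w + w', add_mem hw hw', ?_⟩
    rw [map_add]
    linear_combination e + e'
  algebraMap_mem' c := by
    refine ⟨Subalgebra.algebraMap_mem _ _, 0, zero_mem _, ?_⟩
    rw [AlgEquiv.commutes, sub_self, mul_zero]

theorem Pol_le_shiftDvd (a : Idx m → ℤ) : Pol m ≤ shiftDvd a := by
  have hg : ∀ p : Idx m, gam p ∈ shiftDvd a := fun p => by
    refine ⟨gam_mem_Pol p, (a p : Fld m), intCast_mem _ _, ?_⟩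
    rw [shift_gam]; ring
  have hh : hbF m ∈ shiftDvd a := Subalgebra.algebraMap_mem _ _
  have h2 : (2 : Fld m)⁻¹ ∈ shiftDvd a := by
    refine ⟨inv_two_mem_Pol, 0, zero_mem _, ?_⟩
    rw [map_inv₀, map_ofNat, sub_self, mul_zero]
  refine Algebra.adjoin_le ?_
  rintro f hf
  have hfP : f ∈ Pol m := Algebra.subset_adjoin hf
  rcases hf with (⟨p, rfl⟩ | ⟨p, q, r, s, h, h', rfl⟩) | ⟨p, r, rfl⟩
  · exact hg p
  · have h3 : (gam p + r * hbF m) ^ 2 - (gam q + s * hbF m) ^ 2 ∈ shiftDvd a :=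
      sub_mem (pow_mem (add_mem (hg p) (mul_mem (intCast_mem _ _) hh)) _)
        (pow_mem (add_mem (hg q) (mul_mem (intCast_mem _ _) hh)) _)
    exact ⟨hfP, shift_sub_self_of_inv a hfP h3.2⟩
  · have h3 : gam p + (r / 2 : Fld m) * hbF m ∈ shiftDvd a := by
      rw [div_eq_mul_inv]
      exact add_mem (hg p) (mul_mem (mul_mem (intCast_mem _ _) h2) hh)
    exact ⟨hfP, shift_sub_self_of_inv a hfP h3.2⟩

/-- The commutator is a derivation in each argument, so divisibility by ħ need only be checked on
generators. -/
theorem comm_mem_of_adjoin {R : Type*} [Ring R] [Algebra ℂ[X] R] {s : Set R}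
    (h : ∀ x ∈ s, ∀ y ∈ s, ∃ w ∈ Algebra.adjoin ℂ[X] s, comm x y = hb • w) {x y : R}
    (hx : x ∈ Algebra.adjoin ℂ[X] s) (hy : y ∈ Algebra.adjoin ℂ[X] s) :
    ∃ w ∈ Algebra.adjoin ℂ[X] s, comm x y = hb • w := by
  induction hx using Algebra.adjoin_induction with
  | mem x hx =>
    induction hy using Algebra.adjoin_induction with
    | mem y hy => exact h x hx y hy
    | algebraMap c =>
      exact ⟨0, zero_mem _, by rw [comm, ← Algebra.commutes, sub_self, smul_zero]⟩
    | add y z hy hz e e' =>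
      obtain ⟨w, hw, e⟩ := e
      obtain ⟨w', hw', e'⟩ := e'
      refine ⟨w + w', add_mem hw hw', ?_⟩
      rw [smul_add, ← e, ← e']
      simp only [comm]; noncomm_ring
    | mul y z hy hz e e' =>
      obtain ⟨w, hw, e⟩ := e
      obtain ⟨w', hw', e'⟩ := e'
      refine ⟨w * z + y * w', add_mem (mul_mem hw hz) (mul_mem hy hw'), ?_⟩
      rw [smul_add, ← smul_mul_assoc, ← mul_smul_comm, ← e, ← e']
      simp only [comm]; noncomm_ring
  | algebraMap c =>
    exact ⟨0, zero_mem _, by rw [comm, Algebra.commutes, sub_self, smul_zero]⟩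
  | add x z hx hz e e' =>
    obtain ⟨w, hw, e⟩ := e
    obtain ⟨w', hw', e'⟩ := e'
    refine ⟨w + w', add_mem hw hw', ?_⟩
    rw [smul_add, ← e, ← e']
    simp only [comm]; noncomm_ring
  | mul x z hx hz e e' =>
    obtain ⟨w, hw, e⟩ := e
    obtain ⟨w', hw', e'⟩ := e'
    refine ⟨w * z + x * w', add_mem (mul_mem hw hz) (mul_mem hx hw'), ?_⟩
    rw [smul_add, ← smul_mul_assoc, ← mul_smul_comm, ← e, ← e']
    simp only [comm]; noncomm_ring

theorem comm_swap_mem {R : Type*} [Ring R] [Algebra ℂ[X] R] {S : Subalgebra ℂ[X] R} {x y : R}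
    (h : ∃ w ∈ S, comm x y = hb • w) : ∃ w ∈ S, comm y x = hb • w := by
  obtain ⟨w, hw, e⟩ := h
  refine ⟨-w, neg_mem hw, ?_⟩
  rw [smul_neg, ← e, comm, comm, neg_sub]

theorem comm_betaOp_mulOp (p : Idx m) (a : ℤ) (f : Fld m) : comm (betaOp p a) (mulOp f) =
    mulOp (shift (Pi.single p a) f - f) * betaOp p a := by
  refine LinearMap.ext fun g => ?_
  rw [comm, LinearMap.sub_apply, Module.End.mul_apply, Module.End.mul_apply, Module.End.mul_apply,
    mulOp_apply, mulOp_apply, mulOp_apply, betaOp_apply, betaOp_apply, map_mul, sub_mul]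

theorem comm_betaOp_betaOp (p q : Idx m) (a b : ℤ) : comm (betaOp p a) (betaOp q b) = 0 := by
  refine LinearMap.ext fun g => ?_
  rw [comm, LinearMap.sub_apply, Module.End.mul_apply, Module.End.mul_apply, betaOp_apply,
    betaOp_apply, betaOp_apply, betaOp_apply, shift_shift, shift_shift, add_comm, sub_self,
    LinearMap.zero_apply]

/-- Functions commute, shifts commute, and the commutator of a shift with a function is a finite
difference, divisible by ħ by `Pol_le_shiftDvd`. -/
theorem comm_mem_DiffAlg {x y : Op m} (hx : x ∈ DiffAlg m) (hy : y ∈ DiffAlg m) :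
    ∃ w ∈ DiffAlg m, comm x y = hb • w := by
  have hbm : ∀ (p : Idx m) (a : ℤ), betaOp p a ∈ DiffAlg m → ∀ f ∈ polGens m,
      ∃ w ∈ DiffAlg m, comm (betaOp p a) (mulOp f) = hb • w := fun p a ha f hf => by
    obtain ⟨w, hw, e⟩ := (Pol_le_shiftDvd (Pi.single p a) (Algebra.subset_adjoin hf)).2
    refine ⟨mulOp w * betaOp p a, mul_mem (mulOp_mem_DiffAlg hw) ha, ?_⟩
    rw [comm_betaOp_mulOp, e, mulOp_mul, smul_op_eq, mul_assoc]
    rfl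
  have hbb : ∀ (p q : Idx m) (a b : ℤ),
      ∃ w ∈ DiffAlg m, comm (betaOp p a) (betaOp q b) = hb • w := fun p q a b =>
    ⟨0, zero_mem _, by rw [comm_betaOp_betaOp, smul_zero]⟩
  refine comm_mem_of_adjoin ?_ hx hy
  rintro _ (⟨f, hf, rfl⟩ | ⟨p, rfl | rfl⟩) _ (⟨g, hg, rfl⟩ | ⟨q, rfl | rfl⟩)
  · exact ⟨0, zero_mem _, by rw [comm, ← mulOp_mul, ← mulOp_mul, mul_comm, sub_self, smul_zero]⟩
  · exact comm_swap_mem (hbm q 1 (betaOp_mem_DiffAlg q) f hf)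
  · exact comm_swap_mem (hbm q (-1) (betaOp_neg_mem_DiffAlg q) f hf)
  · exact hbm p 1 (betaOp_mem_DiffAlg p) g hg
  · exact hbb p q 1 1
  · exact hbb p q 1 (-1)
  · exact hbm p (-1) (betaOp_neg_mem_DiffAlg p) g hg
  · exact hbb p q (-1) 1
  · exact hbb p q (-1) (-1)

end DiffAlgebra

/-! ### The homomorphism -/

section Homomorphism

variable {N : ℕ} {m : Fin N → ℕ} {lam : Fin (N + 1) → ℤ} {ℓ : Fin N → ℕ}
  (r : (j : Fin N) → Fin (ℓ j) → ℂ) {μ : Fin (N + 1) → ℤ}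

theorem map_coeff_htSer_mul_hSer_sub_one {A B : Type*} [Ring A] [Algebra ℂ[X] A] [Ring B]
    [Algebra ℂ[X] B] (f : A →ₐ[ℂ[X]] B) (g : Gen N → A) (i : Fin (N + 1)) (d : ℕ) :
    f (PowerSeries.coeff d (htSer g i * hSer g i - 1)) =
      PowerSeries.coeff d (htSer (f ∘ g) i * hSer (f ∘ g) i - 1) := by
  rw [← map_htSer, ← map_hSer, ← map_one (PowerSeries.map (f : A →+* B)), ← map_mul, ← map_sub,
    PowerSeries.coeff_map]
  rfl

theorem comm_smul_smul {R : Type*} [Ring R] [Algebra ℂ[X] R] (c : ℂ[X]) (x y : R) :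
    comm (c • x) (c • y) = c • c • comm x y := by
  rw [comm, comm, smul_mul_smul_comm, smul_mul_smul_comm, ← smul_sub, mul_smul]

theorem algHom_ext_of_gen {B : Type*} [Semiring B] [Algebra ℂ[X] B] {Φ Ψ : TY μ →ₐ[ℂ[X]] B}
    (h : ∀ x, Φ (gen μ x) = Ψ (gen μ x)) : Φ = Ψ := by
  refine RingQuot.ringQuot_ext' _ _ _ (FreeAlgebra.hom_ext ?_)
  funext x
  exact h x

theorem mkAlgHom_eq_zero_of_isRelator {c : FreeAlgebra ℂ[X] (Gen N)}
    (h : IsRelator μ (FreeAlgebra.ι ℂ[X] : Gen N → _) c) : RingQuot.mkAlgHom ℂ[X] (Rel μ) c = 0 := by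
  rw [← map_zero (RingQuot.mkAlgHom ℂ[X] (Rel μ))]
  refine RingQuot.mkAlgHom_rel ℂ[X] ⟨0, ?_⟩
  rw [pow_zero, one_smul, sub_zero]
  exact TwoSidedIdeal.subset_span h

theorem htSer_mul_hSer_gen (i : Fin (N + 1)) : htSer (gen μ) i * hSer (gen μ) i = 1 := by
  rw [← sub_eq_zero]
  ext1 d
  have h := mkAlgHom_eq_zero_of_isRelator (IsRelator.inv_left (μ := μ)
    (g := (FreeAlgebra.ι ℂ[X] : Gen N → _)) i d)
  rw [map_coeff_htSer_mul_hSer_sub_one (B := TY μ)] at h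
  exact h

theorem coeff_hSer_eq_hCoeff (i : Fin (N + 1)) (d : ℕ) :
    PowerSeries.coeff d (hSer (gen μ) i) = hCoeff μ i (2 * μ i + d) := by
  rw [hCoeff, if_pos (by omega), add_sub_cancel_left, Int.toNat_natCast]

theorem apply_coeff_bSer {Ψ : TY μ →ₐ[ℂ[X]] Op m} (h : Ψ ∘ gen μ = genOp m lam r μ)
    (j : Fin N) (d : ℕ) : Ψ (PowerSeries.coeff d (bSer (gen μ) j)) = bImage r j d := by
  have h1 := congrArg (PowerSeries.coeff d) (map_bSer Ψ (gen μ) j)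
  rw [h, bSer_genOp, ← bImage_eq] at h1
  exact h1

variable (hm : lam - μ = ∑ j, (m j : ℤ) • simpleCoroot j)
  (hℓ : ∀ j, (ℓ j : ℤ) = rootPairing lam j)
include hm hℓ

theorem apply_coeff_hSer {Ψ : TY μ →ₐ[ℂ[X]] Op m} (h : Ψ ∘ gen μ = genOp m lam r μ)
    (i : Fin (N + 1)) (d : ℕ) : Ψ (PowerSeries.coeff d (hSer (gen μ) i)) =
      mulOp (PowerSeries.coeff d (hPS m lam r μ i)) := by
  have h1 := congrArg (PowerSeries.coeff d) (map_hSer Ψ (gen μ) i)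
  rw [h, hSer_genOp r hm hℓ] at h1
  exact h1

theorem apply_coeff_zSer {Ψ : TY μ →ₐ[ℂ[X]] Op m} (h : Ψ ∘ gen μ = genOp m lam r μ)
    (j : Fin N) (d : ℕ) : Ψ (PowerSeries.coeff d (zSer μ (gen μ) j)) =
      mulOp (PowerSeries.coeff d (zPS m lam r μ j)) := by
  have h1 := congrArg (PowerSeries.coeff d) (map_zSer Ψ μ (gen μ) j)
  rw [h, zSer_genOp r hm hℓ] at h1
  exact h1

/-- The formulas fix the images of b_j(u) and h_i(u), hence ħ times those of the generators; ħ is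
then cancelled in the torsion-free algebra of operators. -/
theorem IsTwistedGKLO.apply_gen {Φ : TY μ →ₐ[ℂ[X]] DiffAlgLoc m} (hΦ : IsTwistedGKLO μ lam r Φ)
    (x : Gen N) : (Φ (gen μ x) : Op m) = genOp m lam r μ x := by
  set Ψ : TY μ →ₐ[ℂ[X]] Op m := (DiffAlgLoc m).val.comp Φ with hΨ
  have hΨΦ : ∀ y, (Φ y : Op m) = Ψ y := fun y => rfl
  have hser : ∀ i, hSer (Ψ ∘ gen μ) i = hSer (genOp m lam r μ) i := fun i => by
    ext1 d
    rw [← map_hSer Ψ (gen μ), PowerSeries.coeff_map, coeff_hSer_eq_hCoeff, hSer_genOp r hm hℓ,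
      PowerSeries.coeff_map, hPS, PowerSeries.coeff_mk]
    refine (hΦ.map_h i _).trans ?_
    rw [hImage_eq_hOff, neg_mul, sub_neg_eq_add, add_comm]
    rfl
  -- No formula prescribes h̃_i(u), but it is a left inverse of h_i(u) in the source, and left and
  -- right inverses agree.
  have htser : ∀ i, htSer (Ψ ∘ gen μ) i = htSer (genOp m lam r μ) i := fun i => by
    have h1 := congrArg (PowerSeries.map (Ψ : TY μ →+* Op m)) (htSer_mul_hSer_gen (μ := μ) i)
    rw [map_mul, map_htSer Ψ (gen μ), map_hSer Ψ (gen μ), hser, map_one] at h1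
    have h2 : hSer (genOp m lam r μ) i * htSer (genOp m lam r μ) i = 1 := by
      rw [hSer_genOp r hm hℓ, htSer_genOp r hm hℓ, ← map_mul, hPS_mul_htPS r hm hℓ, map_one]
    exact left_inv_eq_right_inv h1 h2
  rw [hΨΦ]
  apply hb_smul_injective
  cases x with
  | h i k =>
    have := congrArg (PowerSeries.coeff (k + 1)) (hser i)
    rw [hSer, hSer, PowerSeries.coeff_mk, PowerSeries.coeff_mk, if_neg (Nat.succ_ne_zero _),
      if_neg (Nat.succ_ne_zero _)] at this
    exact this
  | ht i k =>
    have := congrArg (PowerSeries.coeff (k + 1)) (htser i)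
    rw [htSer, htSer, PowerSeries.coeff_mk, PowerSeries.coeff_mk, if_neg (Nat.succ_ne_zero _),
      if_neg (Nat.succ_ne_zero _)] at this
    exact this
  | b j k =>
    have := hΦ.map_b j (k + 1)
    rw [hΨΦ, bSer, PowerSeries.coeff_mk, if_neg (Nat.succ_ne_zero _), map_smul] at this
    rw [genOp, hb_smul_mulOp_inv_mul]
    exact this

theorem genOp_mem (x : Gen N) : genOp m lam r μ x ∈ DiffAlgLoc m := by
  have hinv : mulOp (hbF m)⁻¹ ∈ DiffAlgLoc m := Algebra.subset_adjoin (Set.mem_insert _ _)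
  cases x with
  | h i k =>
    rw [genOp, mulOp_mul]
    exact mul_mem hinv (DiffAlg_le_DiffAlgLoc (mulOp_mem_DiffAlg
      (polySub_le_Pol (coeff_hPS_mem r hm hℓ i _))))
  | ht i k =>
    rw [genOp, mulOp_mul]
    exact mul_mem hinv (DiffAlg_le_DiffAlgLoc (mulOp_mem_DiffAlg
      (polySub_le_Pol (coeff_htPS_mem r hm hℓ i _))))
  | b j k => exact mul_mem hinv (DiffAlg_le_DiffAlgLoc (bImage_mem_DiffAlg r j _))

theorem exists_isTwistedGKLO (hμ : IsDominantCoweight μ) :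
    ∃ Φ : TY μ →ₐ[ℂ[X]] DiffAlgLoc m, IsTwistedGKLO μ lam r Φ := by
  let g : Gen N → DiffAlgLoc m := fun x => ⟨genOp m lam r μ x, genOp_mem r hm hℓ x⟩
  have hg : ∀ c, IsRelator μ g c → c = 0 := fun c hc => by
    have h := IsRelator.map (A := DiffAlgLoc m) (B := Op m) (DiffAlgLoc m).val μ (g := g) hc
    exact Subtype.ext (eq_zero_of_isRelator_genOp r hm hℓ hμ h)
  have htf : ∀ b : DiffAlgLoc m, hb • b = 0 → b = 0 := fun b hb =>
    Subtype.ext (eq_zero_of_hb_smul (congrArg Subtype.val hb))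
  let Φ : TY μ →ₐ[ℂ[X]] DiffAlgLoc m := RingQuot.liftAlgHom ℂ[X]
    ⟨FreeAlgebra.lift ℂ[X] g, fun _ _ h => lift_eq_of_rel μ htf g hg h⟩
  have hΦ : (DiffAlgLoc m).val.comp Φ ∘ gen μ = genOp m lam r μ := by
    funext x
    have : Φ (gen μ x) = g x := by
      rw [gen, RingQuot.liftAlgHom_mkAlgHom_apply, FreeAlgebra.lift_ι_apply]
    exact congrArg Subtype.val this
  refine ⟨Φ, fun j d => apply_coeff_bSer r hΦ j d, fun i e => ?_⟩
  rw [hCoeff, hImage_eq_hOff]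
  split_ifs with he
  · refine (apply_coeff_hSer r hm hℓ hΦ i _).trans ?_
    rw [hPS, PowerSeries.coeff_mk, Int.toNat_of_nonneg (by omega), neg_mul, sub_neg_eq_add,
      sub_add_cancel]
  -- Below the leading power of u⁻¹ both coefficients are 0.
  · rw [hOff_eq r hm hℓ, coeff_upow_mul_lau_of_lt _ (by omega), map_zero, ← mulAlg_apply, map_zero]
    rfl

/-- Induction on the height. If ħx and ħy lie in D, then ħ · ħ[x, y] = [ħx, ħy] is ħ times an
element of D, and one factor ħ cancels. -/
theorem hb_smul_rootVector_mem {Φ : TY μ →ₐ[ℂ[X]] DiffAlgLoc m} (hΦ : IsTwistedGKLO μ lam r Φ)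
    (j : Fin N) (k d : ℕ) (hd : (j : ℕ) + d < N) :
    hb • (Φ (rootVector μ j k d) : Op m) ∈ DiffAlg m := by
  have h0 : ∀ (j : Fin N) (k : ℕ), hb • (Φ (gen μ (.b j k)) : Op m) ∈ DiffAlg m := fun j k => by
    rw [hΦ.apply_gen r hm hℓ, genOp, hb_smul_mulOp_inv_mul]
    exact bImage_mem_DiffAlg r j _
  induction d with
  | zero => exact h0 j k
  | succ d ih =>
    rw [rootVector, dif_pos hd]
    set x : Op m := (Φ (gen μ (.b ⟨(j : ℕ) + (d + 1), hd⟩ 0)) : Op m) with hx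
    set y : Op m := (Φ (rootVector μ j k d) : Op m) with hy
    obtain ⟨w, hw, e⟩ := comm_mem_DiffAlg (h0 ⟨(j : ℕ) + (d + 1), hd⟩ 0) (ih (by omega))
    have h1 : (Φ (comm (gen μ (.b ⟨(j : ℕ) + (d + 1), hd⟩ 0)) (rootVector μ j k d)) : Op m) =
        comm x y := map_comm (R := TY μ) (S := Op m) ((DiffAlgLoc m).val.comp Φ).toRingHom _ _
    rw [h1]
    rw [comm_smul_smul] at e
    rw [hb_smul_injective e]
    exact hw

/-- The root vectors are covered by `hb_smul_rootVector_mem`; the coefficients of z_j(u) act by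
polynomials in γ and ħ. -/
theorem integralTruncation_le {Φ : TY μ →ₐ[ℂ[X]] DiffAlgLoc m} (hΦ : IsTwistedGKLO μ lam r Φ) :
    integralTruncation Φ ≤ DiffAlg m := by
  rw [integralTruncation, Subalgebra.map_le, integralForm]
  refine Algebra.adjoin_le ?_
  rintro _ (⟨j, k, d, hd, rfl⟩ | ⟨j, k, rfl⟩)
  · have := hb_smul_rootVector_mem r hm hℓ hΦ j k d hd
    have e : ((DiffAlgLoc m).val.comp Φ) (hb • rootVector μ j k d) =
        hb • (Φ (rootVector μ j k d) : Op m) := map_smul _ _ _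
    exact (Subalgebra.mem_comap _ _ _).2 (e ▸ this)
  · have h := apply_coeff_zSer (Ψ := (DiffAlgLoc m).val.comp Φ) r hm hℓ
      (funext fun x => hΦ.apply_gen r hm hℓ x) j (2 * k + 2)
    refine (Subalgebra.mem_comap _ _ _).2 ?_
    rw [h]
    exact mulOp_mem_DiffAlg (polySub_le_Pol (zPS_coeff_mem r hm hℓ j _))

end Homomorphism

end TwistedYangian

end

theorem mainTheorem3 {N : ℕ} (μ lam : Fin (N + 1) → ℤ)
    (hμ : TwistedYangian.IsDominantCoweight μ) (hlam : TwistedYangian.IsDominantCoweight lam)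
    (m : Fin N → ℕ) (hm : lam - μ = ∑ j, (m j : ℤ) • TwistedYangian.simpleCoroot j)
    (ℓ : Fin N → ℕ) (hℓ : ∀ j, (ℓ j : ℤ) = TwistedYangian.rootPairing lam j)
    (r : (j : Fin N) → Fin (ℓ j) → ℂ) :
    (∃! Φ : TwistedYangian.TY μ →ₐ[Polynomial ℂ] TwistedYangian.DiffAlgLoc m,
      TwistedYangian.IsTwistedGKLO μ lam r Φ) ∧
    ∀ Φ : TwistedYangian.TY μ →ₐ[Polynomial ℂ] TwistedYangian.DiffAlgLoc m,
      TwistedYangian.IsTwistedGKLO μ lam r Φ →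
        (∀ x ∈ TwistedYangian.truncation Φ, ∀ f ∈ TwistedYangian.PolLoc m,
          x f ∈ TwistedYangian.PolLoc m) ∧
        TwistedYangian.integralTruncation Φ ≤ TwistedYangian.DiffAlg m ∧
        (∀ x ∈ TwistedYangian.integralTruncation Φ, ∀ f ∈ TwistedYangian.Pol m,
          x f ∈ TwistedYangian.Pol m) := by
  refine ⟨?_, fun Φ hΦ => ⟨?_, TwistedYangian.integralTruncation_le r hm hℓ hΦ, fun x hx f hf =>
    TwistedYangian.DiffAlg_le_stab (TwistedYangian.integralTruncation_le r hm hℓ hΦ hx) f hf⟩⟩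
  · obtain ⟨Φ, hΦ⟩ := TwistedYangian.exists_isTwistedGKLO r hm hℓ hμ
    refine ⟨Φ, hΦ, fun Ψ hΨ => TwistedYangian.algHom_ext_of_gen fun x => Subtype.ext ?_⟩
    rw [hΨ.apply_gen r hm hℓ, hΦ.apply_gen r hm hℓ]
  · rintro _ ⟨y, rfl⟩ f hf
    exact TwistedYangian.DiffAlgLoc_le_stab (Φ y).2 f hf
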